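/- **Setting.** Let $n,d,B,N\ge 1$ be integers, $\mu,M_2,\varepsilon>0$, $G\ge 0$, $\chi\ge 1$, and put $D=nd$, $\gamma=\varepsilon/(2M_2)$, $L_\gamma=\sqrt D\,M_2/\gamma$. Let $E=(\mathbb R^d)^n$ with its Euclidean norm, $\mathcal L=\{x\in E: x_1=\dots=x_n\}$ and $\mathcal L^\perp=\{z\in E:\sum_i z_i=0\}$. Consider the objective $F(x)=\mathbb E_\xi F(x,\xi)$, $F(x,\xi)=\sum_{i=1}^n f_i(x_i,\xi)$, where every $f_i(\cdot)=\mathbb E_\xi f_i(\cdot,\xi):\mathbb R^d\to\mathbb R$ is $\mu$-strongly convex (not necessarily differentiable), the problem $\min_{x\in\mathcal L}F(x)$, and the smoothed function $F_\gamma(x)=\mathbb E\,F(x+\gamma\tilde e)$, $\tilde e$ uniform on the unit ball of $E$. Let $x^*$ and $x^*_\gamma$ be the minimizers of $F$ and $F_\gamma$ over $\mathcal L$. Let $S\subseteq E$ be a (measurable) convex set with $x^*,x_\gamma^*\in S$, such that on the neighbourhood $S_\gamma=\{p:\|p-x\|\le\gamma\text{ for some }x\in S\}$: $F(\cdot,\xi)$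 is $M_2(\xi)$-Lipschitz with $\mathbb E_\xi M_2(\xi)^2\le M_2^2$, and $\mathbb E_\xi|F(x,\xi)|^2\le G^2$. The oracle returns $F_\delta(x,\xi)=F(x,\xi)+\delta(x,\xi)$ with $|\delta|\le\widetilde\Delta$. The network is described by graphs $\mathcal G^q$ on $n$ nodes and matrices $W(q)$, $q=0,1,\dots$: $W(q)$ is symmetric positive semidefinite, $W(q)_{ij}=0$ if $i\ne j$ are not adjacent in $\mathcal G^q$, $\ker W(q)=\{v: v_1=\dots=v_n\}$, and $\|W(q)v-v\|^2\le(1-\chi^{-1})\|v\|^2$ whenever $\sum_iv_i=0$. **Algorithm.** ZO-SADOM starts at $x^0=x^0_f$, $y^0=y^0_f$, $m^0\in E$, $z^0=z^0_f\in\mathcal L^\perp$ and runs, for $k=0,1,\dots$, with $\mathbf W_k=W(k)\otimes I_d$, $$\begin{aligned} x_g^k&=\tau_1x^k+(1-\tau_1)x_f^k,\quad y_g^k=\vartheta_1y^k+(1-\vartheta_1)y_f^k,\quad z_g^k=\vartheta_1z^k+(1-\vartheta_1)z_f^k,\\ x^{k+1}&=x^k+\eta\alpha(x_g^k-x^{k+1})-\eta[\mathbf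 g^k-\nu x_g^k-y^{k+1}],\quad x_f^{k+1}=x_g^k+\tau_2(x^{k+1}-x^k),\\ y^{k+1}&=y^k+\theta\beta(\mathbf g^k-\nu x_g^k-y^{k+1})-\theta[\nu^{-1}(y_g^k+z_g^k)+x^{k+1}],\quad y_f^{k+1}=y_g^k+\vartheta_2(y^{k+1}-y^k),\\ z^{k+1}&=z^k+\varkappa\pi(z_g^k-z^k)-\mathbf W_k[\varkappa\nu^{-1}(y_g^k+z_g^k)+m^k],\quad z_f^{k+1}=z_g^k-\zeta\mathbf W_k(y_g^k+z_g^k),\\ m^{k+1}&=\varkappa\nu^{-1}(y_g^k+z_g^k)+m^k-\mathbf W_k[\varkappa\nu^{-1}(y_g^k+z_g^k)+m^k], \end{aligned}$$ with the batched one-point estimator $\mathbf g^k=\frac1B\sum_{j=1}^B\frac D\gamma F_\delta(x_g^k+\gamma e^{k,j},\xi^{k,j})\,e^{k,j}$, the $e^{k,j}$ uniform on the unit sphere of $E$, and all $\xi^{k,j}$, $e^{k,j}$ independent. The parameters are the functions of two numbers $L\ge L_\gamma$ and $0<\beta\le 1/(2L)$ given by $\tau_2=\sqrt{\mu/L}$,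 $\tau_1=(1/\tau_2+1/2)^{-1}$, $\eta=([1/\beta+L]\tau_2)^{-1}$, $\alpha=\mu/4$, $\nu=\mu/2$, $\vartheta_2=\sqrt{\beta\mu}/(16\chi)$, $\vartheta_1=(1/\vartheta_2+1/2)^{-1}$, $\theta=\nu/(4\vartheta_2)$, $\varkappa=\nu/(14\vartheta_2\chi^2)$, $\pi=\beta/16$, $\zeta=1/2$. Let $D_{F_\gamma}(x,y)=F_\gamma(x)-F_\gamma(y)-\langle\nabla F_\gamma(y),x-y\rangle$, let $$C_0=\mu\|x^0-x_\gamma^*\|^2+D_{F_\gamma}(x^0,x_\gamma^*)+\tfrac\chi\mu\big(\|y^0-\nabla F_\gamma(x_\gamma^*)+\tfrac\mu2x_\gamma^*\|^2+\|z^0+\nabla F_\gamma(x^*_\gamma)\|^2+\|m^0\|^2\big),$$ and let $A_N$ be the event that $x_g^k\in S$ for all $k<N$ and $x_f^k\in S$ for all $k\le N$. **Claim.** There are universal constants $C,c>0$ such that for all $n,d,B,N,\mu,M_2,G,\chi,\varepsilon$ as above there are $L\ge L_\gamma$ and $0<\beta\le1/(2L)$, depending only on these numbers, for which, in every setting as above: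 if $$N\ \ge\ C\log\!\Big(2+\frac{C_0}{\varepsilon}\Big)\max\Big\{\frac{D^{1/4}M_2\chi}{\sqrt{\varepsilon\mu}},\ \frac{\chi^2D^2M_2^2G^2}{\varepsilon^3B\mu}\Big\}$$ and $$\widetilde\Delta^2\ \le\ c\,\min\Big\{\frac{\varepsilon^{5/2}\mu^{1/2}}{D^{7/4}M_2N},\ \frac{B\mu N\varepsilon^3}{\chi^2M_2^2D^2}\Big\},$$ then $$\mathbb E\Big[\mathbf 1_{A_N}\Big(\tfrac\mu2\|x^N-x_\gamma^*\|^2+D_{F_\gamma}(x_f^N,x_\gamma^*)-\tfrac\mu4\|x_f^N-x_\gamma^*\|^2\Big)\Big]\le\frac\varepsilon2,$$ $$\mathbb E\Big[\mathbf 1_{A_N}\Big(\tfrac\mu2\|x^N-x^*\|^2+F(x_f^N)-F(x^*)-\langle\nabla F_\gamma(x_\gamma^*),x_f^N-x^*\rangle-\tfrac\mu4\|x_f^N-x^*\|^2\Big)\Big]\le\varepsilon,$$ both random variables being integrable. -/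

import Mathlib

open MeasureTheory ProbabilityTheory

noncomputable section

/-- The space of stacked vectors `x = (x₁, …, xₙ)`, `xᵢ ∈ ℝᵈ`, with its Euclidean norm. Its
dimension is `n * d`. -/
abbrev Stack (n d : ℕ) : Type := PiLp 2 (fun _ : Fin n => EuclideanSpace ℝ (Fin d))

/-- The consensus space `𝓛 = {x : x₁ = ⋯ = xₙ}`. -/
def consensus (n d : ℕ) : Set (Stack n d) := {x | ∀ i j, x i = x j}

/-- The orthogonal complement `𝓛^⊥ = {z : z₁ + ⋯ + zₙ = 0}` of the consensus space. -/
def consensusPerp (n d : ℕ) : Set (Stack n d) := {z | ∑ i, z i = 0}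

/-- The action of `W ⊗ I_d` on stacked vectors. -/
def gossipMul {n d : ℕ} (W : Matrix (Fin n) (Fin n) ℝ) (x : Stack n d) : Stack n d :=
  WithLp.toLp 2 (fun i => ∑ j, W i j • x j)

/-- `W q` is a gossip matrix of the time-varying network `𝒢 q`, with condition number `χ`,
at every communication round `q`. -/
structure IsGossip {n : ℕ} (𝒢 : ℕ → SimpleGraph (Fin n)) (W : ℕ → Matrix (Fin n) (Fin n) ℝ)
    (χ : ℝ) : Prop where
  posSemidef : ∀ q, (W q).PosSemidef
  sparse : ∀ q i j, i ≠ j → ¬ (𝒢 q).Adj i j → W q i j = 0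
  ker : ∀ (q : ℕ) (v : Fin n → ℝ), (W q).mulVec v = 0 ↔ ∀ i j, v i = v j
  contract : ∀ (q : ℕ) (v : Fin n → ℝ), ∑ i, v i = 0 →
    ∑ i, ((W q).mulVec v i - v i) ^ 2 ≤ (1 - χ⁻¹) * ∑ i, v i ^ 2

section Objective

variable {n d : ℕ} {Ξ : Type*} [MeasurableSpace Ξ]

/-- The lifted stochastic function `F(x, ξ) = ∑ᵢ fᵢ(xᵢ, ξ)`. -/
def stochF (f : Fin n → EuclideanSpace ℝ (Fin d) → Ξ → ℝ) (x : Stack n d) (ξ : Ξ) : ℝ :=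
  ∑ i, f i (x i) ξ

/-- The objective `F(x) = 𝔼_ξ F(x, ξ)`. -/
def meanF (𝒟 : Measure Ξ) (f : Fin n → EuclideanSpace ℝ (Fin d) → Ξ → ℝ) (x : Stack n d) : ℝ :=
  ∫ ξ, stochF f x ξ ∂𝒟

/-- The smoothed function `F_γ(x) = 𝔼 F(x + γ u)`, `u` uniform on the Euclidean unit ball. -/
def smoothF (γ : ℝ) (F : Stack n d → ℝ) (x : Stack n d) : ℝ :=
  ⨍ u in Metric.closedBall (0 : Stack n d) 1, F (x + γ • u)

/-- The `γ`-neighbourhood `S + γ B` of a set `S`, `B` the closed Euclidean unit ball. -/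
def neigh (S : Set (Stack n d)) (γ : ℝ) : Set (Stack n d) :=
  {p | ∃ x ∈ S, ‖p - x‖ ≤ γ}

/-- `F(·, ξ)` is `M(ξ)`-Lipschitz on `K`, with `𝔼 M(ξ)² ≤ M²`. -/
def LipschitzInMean (𝒟 : Measure Ξ) (f : Fin n → EuclideanSpace ℝ (Fin d) → Ξ → ℝ)
    (K : Set (Stack n d)) (M : ℝ) : Prop :=
  ∃ Mξ : Ξ → ℝ, MemLp Mξ 2 𝒟 ∧ ∫ ξ, Mξ ξ ^ 2 ∂𝒟 ≤ M ^ 2 ∧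
    ∀ ξ, ∀ x ∈ K, ∀ y ∈ K, |stochF f y ξ - stochF f x ξ| ≤ Mξ ξ * ‖y - x‖

/-- `𝔼_ξ |F(x, ξ)|² ≤ G²` for all `x ∈ K`. -/
def SecondMomentBound (𝒟 : Measure Ξ) (f : Fin n → EuclideanSpace ℝ (Fin d) → Ξ → ℝ)
    (K : Set (Stack n d)) (G : ℝ) : Prop :=
  ∀ x ∈ K, MemLp (stochF f x) 2 𝒟 ∧ ∫ ξ, stochF f x ξ ^ 2 ∂𝒟 ≤ G ^ 2

/-- The Bregman divergence `D_F(x, y) = F(x) - F(y) - ⟨∇F(y), x - y⟩`. -/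
def bregman (F : Stack n d → ℝ) (x y : Stack n d) : ℝ :=
  F x - F y - inner ℝ (gradient F y) (x - y)

/-- One-point feedback `(D / γ) F_δ(x + γ e, ξ) e`, `F_δ = F + δ`, `D = n d`: one function value. -/
def opf (γ : ℝ) (f : Fin n → EuclideanSpace ℝ (Fin d) → Ξ → ℝ) (δ : Stack n d → Ξ → ℝ)
    (x : Stack n d) (ξ : Ξ) (e : Stack n d) : Stack n d :=
  (((n * d : ℕ) : ℝ) / γ * (stochF f (x + γ • e) ξ + δ (x + γ • e) ξ)) • e

/-- The batched one-point estimator `(1 / B) ∑ⱼ g(x, ξʲ, eʲ)`. -/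
def opfBatch {B : ℕ} (γ : ℝ) (f : Fin n → EuclideanSpace ℝ (Fin d) → Ξ → ℝ)
    (δ : Stack n d → Ξ → ℝ) (x : Stack n d) (ξ : Fin B → Ξ) (e : Fin B → Stack n d) :
    Stack n d :=
  (B : ℝ)⁻¹ • ∑ j, opf γ f δ x (ξ j) (e j)

end Objective

/-- The uniform probability distribution on the Euclidean unit sphere of `Stack n d`. -/
def uniformSphere (n d : ℕ) : Measure (Stack n d) :=
  (((volume : Measure (Stack n d)).toSphere Set.univ)⁻¹ •
    (volume : Measure (Stack n d)).toSphere).map Subtype.val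

/-- The parameters of SADOM. -/
structure Params where
  τ₁ : ℝ
  τ₂ : ℝ
  η : ℝ
  α : ℝ
  β : ℝ
  ϑ₁ : ℝ
  ϑ₂ : ℝ
  θ : ℝ
  ν : ℝ
  ϰ : ℝ
  ϖ : ℝ
  ζ : ℝ

/-- The parameters of SADOM for a `μ`-strongly convex function with smoothness constant `L`, as
functions of the remaining free parameter `β`. -/
def sadomParams (μ χ L β : ℝ) : Params :=
  let τ₂ := √(μ / L)
  let ν := μ / 2
  let ϑ₂ := √(β * μ) / (16 * χ)
  { τ₁ := (1 / τ₂ + 1 / 2)⁻¹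
    τ₂ := τ₂
    η := ((1 / β + L) * τ₂)⁻¹
    α := μ / 4
    β := β
    ϑ₁ := (1 / ϑ₂ + 1 / 2)⁻¹
    ϑ₂ := ϑ₂
    θ := ν / (4 * ϑ₂)
    ν := ν
    ϰ := ν / (14 * ϑ₂ * χ ^ 2)
    ϖ := β / 16
    ζ := 1 / 2 }

/-- All the sequences generated by one run of SADOM. -/
structure Iterates (n d : ℕ) where
  x : ℕ → Stack n d
  xg : ℕ → Stack n d
  xf : ℕ → Stack n d
  y : ℕ → Stack n d
  yg : ℕ → Stack n d
  yf : ℕ → Stack n d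
  z : ℕ → Stack n d
  zg : ℕ → Stack n d
  zf : ℕ → Stack n d
  m : ℕ → Stack n d

/-- The sequences are those produced by SADOM with parameters `p`, gossip matrices `W k` and
gradient estimators `g k`, started at `(x0, y0, z0, m0)`. The lines for `x (k + 1)` and `y (k + 1)`
form, for `p = sadomParams μ χ L β` with positive arguments, a uniquely solvable linear system. -/
structure IsSADOM {n d : ℕ} (p : Params) (W : ℕ → Matrix (Fin n) (Fin n) ℝ)
    (g : ℕ → Stack n d → Stack n d) (x0 y0 z0 m0 : Stack n d) (T : Iterates n d) : Prop where
  x_zero : T.x 0 = x0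
  y_zero : T.y 0 = y0
  z_zero : T.z 0 = z0
  m_zero : T.m 0 = m0
  xf_zero : T.xf 0 = x0
  yf_zero : T.yf 0 = y0
  zf_zero : T.zf 0 = z0
  xg_eq : ∀ k, T.xg k = p.τ₁ • T.x k + (1 - p.τ₁) • T.xf k
  x_succ : ∀ k, T.x (k + 1) = T.x k + (p.η * p.α) • (T.xg k - T.x (k + 1))
    - p.η • (g k (T.xg k) - p.ν • T.xg k - T.y (k + 1))
  xf_succ : ∀ k, T.xf (k + 1) = T.xg k + p.τ₂ • (T.x (k + 1) - T.x k)
  yg_eq : ∀ k, T.yg k = p.ϑ₁ • T.y k + (1 - p.ϑ₁) • T.yf k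
  y_succ : ∀ k, T.y (k + 1) = T.y k
    + (p.θ * p.β) • (g k (T.xg k) - p.ν • T.xg k - T.y (k + 1))
    - p.θ • (p.ν⁻¹ • (T.yg k + T.zg k) + T.x (k + 1))
  yf_succ : ∀ k, T.yf (k + 1) = T.yg k + p.ϑ₂ • (T.y (k + 1) - T.y k)
  zg_eq : ∀ k, T.zg k = p.ϑ₁ • T.z k + (1 - p.ϑ₁) • T.zf k
  z_succ : ∀ k, T.z (k + 1) = T.z k + (p.ϰ * p.ϖ) • (T.zg k - T.z k)
    - gossipMul (W k) ((p.ϰ * p.ν⁻¹) • (T.yg k + T.zg k) + T.m k)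
  m_succ : ∀ k, T.m (k + 1) = (p.ϰ * p.ν⁻¹) • (T.yg k + T.zg k) + T.m k
    - gossipMul (W k) ((p.ϰ * p.ν⁻¹) • (T.yg k + T.zg k) + T.m k)
  zf_succ : ∀ k, T.zf (k + 1) = T.zg k - p.ζ • gossipMul (W k) (T.yg k + T.zg k)

/-- All the points `x_g^k`, `k < N`, at which the oracle is used, and all the points `x_f^k`,
`k ≤ N`, lie in `S`. -/
def StaysIn {n d : ℕ} (S : Set (Stack n d)) (N : ℕ) (T : Iterates n d) : Prop :=
  (∀ k < N, T.xg k ∈ S) ∧ ∀ k ≤ N, T.xf k ∈ S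

/-- The initial error of SADOM for a smooth function `H` whose minimizer over the consensus space
is `x'`; the saddle point is `(x', y', z')` with `y' = ∇H(x') - (μ/2) x'`, `z' = -∇H(x')`. -/
def initialError {n d : ℕ} (μ χ : ℝ) (H : Stack n d → ℝ) (x' x0 y0 z0 m0 : Stack n d) : ℝ :=
  μ * ‖x0 - x'‖ ^ 2 + bregman H x0 x'
    + χ / μ * (‖y0 - (gradient H x' - (μ / 2) • x')‖ ^ 2 + ‖z0 + gradient H x'‖ ^ 2 + ‖m0‖ ^ 2)

end

/-! Write H = F_γ. Its gradient at x is the sphere average (D/γ) E[F(x + γe) e] even when F is only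
continuous (`hasFDerivAt_integral_closedBall`, `hasGradientAt_smoothF`). One-point feedback
therefore estimates ∇H, with bias at most √D Δ/γ (`norm_opfMean_sub_le`) and, after batching, a
variance of order (D/γ)²(G² + Δ²)/B (`batchNoise_moments`). H is μ-strongly convex, and on S it
satisfies the smoothness and cocoercivity inequalities with constant L_γ (`smoothF_regularity`),
because there it agrees with the smoothing of a globally Lipschitz convex extension of F. Finally F
≤ H everywhere and H ≤ F + ε/2 on S.

The algorithm is thus a stochastic accelerated primal-dual method for H, whose saddle point is x* =
x_γ*, y* = ∇H(x*) - (μ/2)x*, z* = -∇H(x*). Four descent inequalities (`primal_descent`,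
`dual_descent`, `consensus_descent`, `sum_descent`) are added with weights for which the bilinear
couplings cancel (`potential_combine`). The outcome is `IsSADOM.potential_succ_le`: with t = √(βμ),
one step multiplies the potential by 1 - t/(100χ), up to squared bias, squared noise v and the
linear term -2⟨v, x^k - x*⟩.

The linear term must vanish in expectation although the estimate holds only while the run stays in
S. Whether x_f^{k+1} lies in S depends on the fresh samples, so that event cannot be conditioned on.
The one-step bound is however nonnegative, hence it may be integrated over the larger event that is
decided by the past (`IsRegularOn.contracted_potential_nonneg`, `setIntegral_le_of_step`).

The parameters are tied by 2βL = 1, leaving one scale t. The contraction rate is proportional to t/χ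
and the variance part of the limiting error to tχ. Taking t proportional to χ/K, with K the maximum
in the condition on N, settles both: the first term of K gives L ≥ 4L_γ, the second makes the
variance part of order ε. Accuracy ε/14 for H then gives accuracy ε for F
(`IsRegularOn.original_le`). -/

set_option linter.unusedSectionVars false

/-! ### Derivative of a ball average as a flux through the sphere -/

section SphereGradient

open Metric Set Filter Topology Convolution

variable {E : Type*} [NormedAddCommGroup E] [InnerProductSpace ℝ E] [FiniteDimensional ℝ E]
  [MeasurableSpace E] [BorelSpace E]

/-- Integration in polar coordinates. -/
theorem integral_polar [Nontrivial E] {G : Type*} [NormedAddCommGroup G] [NormedSpace ℝ G]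
    {f : E → G} (hf : Integrable f) :
    ∫ u, f u = ∫ r in Ioi (0 : ℝ), r ^ (Module.finrank ℝ E - 1) •
      ∫ e : sphere (0 : E) 1, f (r • (e : E)) ∂(volume : Measure E).toSphere := by
  have hmp := (volume : Measure E).measurePreserving_homeomorphUnitSphereProd
  have hemb := (homeomorphUnitSphereProd E).measurableEmbedding
  have key : ∀ x : ({(0 : E)}ᶜ : Set E), f x =
      f (((homeomorphUnitSphereProd E x).2 : ℝ) • ((homeomorphUnitSphereProd E x).1 : E)) := by
    intro x
    have : ((homeomorphUnitSphereProd E).symm (homeomorphUnitSphereProd E x) : E) = x := by simp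
    rw [homeomorphUnitSphereProd_symm_apply_coe] at this
    rw [this]
  have hint : Integrable (fun p : sphere (0 : E) 1 × Ioi (0 : ℝ) => f ((p.2 : ℝ) • (p.1 : E)))
      ((volume : Measure E).toSphere.prod (.volumeIoiPow (Module.finrank ℝ E - 1))) := by
    rw [← hmp.integrable_comp_emb hemb]
    have h1 : Integrable (fun x : ({(0 : E)}ᶜ : Set E) => f x)
        ((volume : Measure E).comap Subtype.val) := by
      have := (integrableOn_iff_comap_subtypeVal (μ := (volume : Measure E)) (f := f)
        (measurableSet_singleton (0 : E)).compl).1 hf.integrableOn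
      exact this
    exact h1.congr (Eventually.of_forall key)
  calc ∫ u, f u = ∫ x : ({(0 : E)}ᶜ : Set E), f x ∂((volume : Measure E).comap (↑)) := by
        rw [integral_subtype_comap (measurableSet_singleton _).compl f, restrict_compl_singleton]
    _ = ∫ p : sphere (0 : E) 1 × Ioi (0 : ℝ), f ((p.2 : ℝ) • (p.1 : E))
        ∂((volume : Measure E).toSphere.prod (.volumeIoiPow (Module.finrank ℝ E - 1))) := by
        rw [← hmp.integral_comp hemb]
        exact integral_congr_ae (Eventually.of_forall key)
    _ = ∫ r : Ioi (0 : ℝ), ∫ e : sphere (0 : E) 1, f ((r : ℝ) • (e : E))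
        ∂(volume : Measure E).toSphere ∂(.volumeIoiPow (Module.finrank ℝ E - 1)) :=
        integral_prod_symm _ hint
    _ = _ := by
        simp only [Measure.volumeIoiPow, ENNReal.ofReal]
        rw [integral_withDensity_eq_integral_smul,
          integral_subtype_comap measurableSet_Ioi fun a => Real.toNNReal
            (a ^ (Module.finrank ℝ E - 1)) • ∫ e : sphere (0 : E) 1, f (a • (e : E))
              ∂(volume : Measure E).toSphere,
          setIntegral_congr_fun measurableSet_Ioi fun x hx ↦ ?_]
        · rw [NNReal.smul_def, Real.coe_toNNReal _ (pow_nonneg (le_of_lt hx) _)]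
        · exact (measurable_subtype_coe.pow_const _).real_toNNReal

/-- A smooth radial approximation of the indicator of the unit ball. -/
noncomputable def radialBump (h : ℝ) (u : E) : ℝ := Real.smoothTransition ((1 + h - ‖u‖ ^ 2) / h)

/-- The density of the radius in the gradient of `radialBump h`. -/
noncomputable def radialDensity (h r : ℝ) : ℝ := 2 / h * deriv Real.smoothTransition ((1 + h - r ^ 2) / h)

theorem contDiff_radialBump (h : ℝ) : ContDiff ℝ 1 (radialBump (E := E) h) := by
  unfold radialBump
  exact Real.smoothTransition.contDiff.comp ((contDiff_const.sub (contDiff_norm_sq ℝ)).div_const h)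

theorem fderiv_radialBump (h : ℝ) (u : E) :
    fderiv ℝ (radialBump h) u = -(radialDensity h ‖u‖) • innerSL ℝ u := by
  have hs : HasDerivAt Real.smoothTransition
      (deriv Real.smoothTransition ((1 + h - ‖u‖ ^ 2) / h)) ((1 + h - ‖u‖ ^ 2) / h) :=
    ((Real.smoothTransition.contDiff (n := 1)).differentiable one_ne_zero).differentiableAt.hasDerivAt
  have hn : HasFDerivAt (fun u : E => (1 + h - ‖u‖ ^ 2) / h) ((h⁻¹ : ℝ) • (-((2 : ℕ) • (innerSL ℝ u : E →L[ℝ] ℝ)))) u := by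
    simp only [div_eq_mul_inv]
    exact ((hasStrictFDerivAt_norm_sq u).hasFDerivAt.const_sub (1 + h)).mul_const h⁻¹
  have := hs.comp_hasFDerivAt u hn
  rw [show radialBump (E := E) h
    = Real.smoothTransition ∘ (fun u : E => (1 + h - ‖u‖ ^ 2) / h) from rfl, this.fderiv]
  ext v
  simp [radialDensity]
  ring

theorem radialBump_eq_zero {h : ℝ} (hh : 0 < h) (hh1 : h ≤ 1) {u : E} (hu : 2 ≤ ‖u‖) :
    radialBump h u = 0 := by
  apply Real.smoothTransition.zero_of_nonpos
  apply div_nonpos_of_nonpos_of_nonneg _ hh.le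
  nlinarith

theorem hasCompactSupport_radialBump {h : ℝ} (hh : 0 < h) (hh1 : h ≤ 1) :
    HasCompactSupport (radialBump (E := E) h) := by
  refine HasCompactSupport.intro (isCompact_closedBall (0 : E) 2) fun u hu => ?_
  apply radialBump_eq_zero hh hh1
  simp at hu
  exact hu.le

theorem continuous_radialDensity (h : ℝ) : Continuous (radialDensity h) := by
  unfold radialDensity
  have := (Real.smoothTransition.contDiff (n := 1)).continuous_deriv le_rfl
  fun_prop

theorem radialDensity_nonneg {h : ℝ} (hh : 0 < h) (r : ℝ) : 0 ≤ radialDensity h r :=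
  mul_nonneg (by positivity) Real.smoothTransition.monotone.deriv_nonneg

theorem deriv_smoothTransition_eq_zero {x : ℝ} (hx : x < 0 ∨ 1 < x) :
    deriv Real.smoothTransition x = 0 := by
  rcases hx with hx | hx
  · have : Real.smoothTransition =ᶠ[𝓝 x] fun _ => 0 := by
      filter_upwards [Iio_mem_nhds hx] with y hy
      exact Real.smoothTransition.zero_of_nonpos (le_of_lt hy)
    simpa using this.deriv_eq
  · have : Real.smoothTransition =ᶠ[𝓝 x] fun _ => 1 := by
      filter_upwards [Ioi_mem_nhds hx] with y hy
      exact Real.smoothTransition.one_of_one_le (le_of_lt hy)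
    simpa using this.deriv_eq

theorem radialDensity_eq_zero {h : ℝ} (hh : 0 < h) {r : ℝ} (hr : 0 ≤ r)
    (hr1 : r < 1 ∨ 1 + h < r) : radialDensity h r = 0 := by
  unfold radialDensity
  rw [deriv_smoothTransition_eq_zero, mul_zero]
  rcases hr1 with hr1 | hr1
  · right; rw [lt_div_iff₀ hh]; nlinarith
  · left; apply div_neg_of_neg_of_pos _ hh; nlinarith

/-- The integrand is minus the derivative of the radial profile, which falls from 1 at r = 1 to 0 at
r = 1 + h. Unit mass makes the gradient of the regularised integral a true average of fluxes,
converging to the flux at radius 1 as h → 0. -/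
theorem integral_radialDensity {h : ℝ} (hh : 0 < h) :
    ∫ r in (1 : ℝ)..(1 + h), r * radialDensity h r = 1 := by
  have hd : ∀ r ∈ uIcc 1 (1 + h),
      HasDerivAt (fun r : ℝ => - Real.smoothTransition ((1 + h - r ^ 2) / h))
        (r * radialDensity h r) r := by
    intro r _
    have hs : HasDerivAt Real.smoothTransition
        (deriv Real.smoothTransition ((1 + h - r ^ 2) / h)) ((1 + h - r ^ 2) / h) :=
      ((Real.smoothTransition.contDiff (n := 1)).differentiable
        one_ne_zero).differentiableAt.hasDerivAt
    have hn : HasDerivAt (fun r : ℝ => (1 + h - r ^ 2) / h) (-(2 * r) / h) r := by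
      simpa using (((hasDerivAt_id r).pow 2).const_sub (1 + h)).div_const h
    have := (hs.comp r hn).neg
    refine this.congr_deriv ?_
    unfold radialDensity
    ring
  rw [intervalIntegral.integral_eq_sub_of_hasDerivAt hd
    ((continuous_id.mul (continuous_radialDensity h)).intervalIntegrable _ _)]
  rw [Real.smoothTransition.zero_of_nonpos, Real.smoothTransition.one_of_one_le]
  · ring
  · rw [one_le_div hh]; linarith
  · apply div_nonpos_of_nonpos_of_nonneg _ hh.le
    nlinarith

/-- The integral of `F e` over the sphere of radius `r` around `x`. -/
noncomputable def sphereFlux (F : E → ℝ) (r : ℝ) (x : E) : E :=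
  r ^ (Module.finrank ℝ E - 1) • ∫ e : sphere (0 : E) 1, F (x + r • (e : E)) • (e : E)
    ∂(volume : Measure E).toSphere

theorem continuous_sphereFlux {F : E → ℝ} (hF : Continuous F) :
    Continuous (fun p : ℝ × E => sphereFlux F p.1 p.2) := by
  unfold sphereFlux
  refine (continuous_fst.pow _).smul ?_
  have := continuous_parametric_integral_of_continuous
    (μ := (volume : Measure E).toSphere)
    (f := fun (p : ℝ × E) (e : sphere (0 : E) 1) => F (p.2 + p.1 • (e : E)) • (e : E))
    (by unfold Function.uncurry; fun_prop) isCompact_univ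
  simpa using this

/-- In the convolution the derivative falls on the smooth bump, so F need only be continuous. The
gradient of the bump is radial, and polar coordinates turn the integral into an average of fluxes
over radii in [1, 1 + h]. -/
theorem hasFDerivAt_integral_radialBump [Nontrivial E] {F : E → ℝ} (hF : Continuous F)
    {h : ℝ} (hh : 0 < h) (hh1 : h ≤ 1) (x : E) :
    HasFDerivAt (fun x => ∫ u, F (x + u) * radialBump h u)
      (innerSL ℝ (∫ r in (1 : ℝ)..(1 + h), (r * radialDensity h r) • sphereFlux F r x)) x := by
  have hc := hasCompactSupport_radialBump (E := E) hh hh1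
  have hcd := contDiff_radialBump (E := E) h
  have h1 := hc.hasFDerivAt_convolution_right (𝕜 := ℝ) (μ := (volume : Measure E))
    (ContinuousLinearMap.mul ℝ ℝ) hF.locallyIntegrable hcd x
  have e1 : (F ⋆[ContinuousLinearMap.mul ℝ ℝ, (volume : Measure E)] radialBump h)
      = fun x => ∫ u, F (x + u) * radialBump h u := by
    funext x
    rw [convolution_def, ← integral_add_left_eq_self _ x]
    refine integral_congr_ae (Eventually.of_forall fun u => ?_)
    simp [radialBump]
  rw [e1] at h1
  refine h1.congr_fderiv ?_
  have hcdens : HasCompactSupport (fun u : E => radialDensity h ‖u‖) := by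
    refine HasCompactSupport.intro (isCompact_closedBall (0 : E) 2) fun u hu => ?_
    simp at hu
    exact radialDensity_eq_zero hh (norm_nonneg _) (Or.inr (by linarith))
  have hcont : Continuous (fun u : E => radialDensity h ‖u‖) :=
    (continuous_radialDensity h).comp continuous_norm
  have hint : Integrable (fun u : E => radialDensity h ‖u‖ • F (x + u) • u) := by
    apply Continuous.integrable_of_hasCompactSupport
    · fun_prop
    · exact hcdens.smul_right (f' := fun u : E => F (x + u) • u)
  have e2 : ∫ u : E, radialDensity h ‖u‖ • F (x + u) • u
      = ∫ r in (1 : ℝ)..(1 + h), (r * radialDensity h r) • sphereFlux F r x := by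
    rw [integral_polar hint, intervalIntegral.integral_of_le (by linarith)]
    rw [← integral_Icc_eq_integral_Ioc]
    have e3 : ∀ r ∈ Ioi (0 : ℝ), r ^ (Module.finrank ℝ E - 1) •
        ∫ e : sphere (0 : E) 1, radialDensity h ‖r • (e : E)‖ • F (x + r • (e : E)) • r • (e : E)
          ∂(volume : Measure E).toSphere = (r * radialDensity h r) • sphereFlux F r x := by
      intro r hr
      have hr' : (0 : ℝ) < r := hr
      unfold sphereFlux
      rw [smul_comm (r * radialDensity h r)]
      congr 1
      rw [← integral_smul]
      refine integral_congr_ae (Eventually.of_forall fun e => ?_)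
      have he : ‖(e : E)‖ = 1 := by simp
      simp only [norm_smul, he, Real.norm_eq_abs, abs_of_pos hr', mul_one, smul_smul]
      congr 1; ring
    rw [setIntegral_congr_fun measurableSet_Ioi e3]
    refine (setIntegral_eq_of_subset_of_forall_sdiff_eq_zero measurableSet_Ioi ?_ ?_)
    · intro r hr; exact lt_of_lt_of_le one_pos hr.1
    · rintro r ⟨hr0, hr⟩
      rw [radialDensity_eq_zero hh (le_of_lt hr0), mul_zero, zero_smul]
      by_contra hcon
      push Not at hcon
      exact hr ⟨hcon.1, hcon.2⟩
  rw [← e2]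
  ext v
  rw [innerSL_apply_apply, real_inner_comm, ← integral_inner (𝕜 := ℝ) hint]
  rw [convolution_precompR_apply]
  · rw [convolution_def, ← integral_add_left_eq_self _ x]
    refine integral_congr_ae (Eventually.of_forall fun u => ?_)
    simp only [fderiv_radialBump, sub_add_cancel_left]
    simp [inner_smul_right, real_inner_comm]
    ring
  · exact hF.locallyIntegrable
  · exact hc.fderiv ℝ
  · exact hcd.continuous_fderiv one_ne_zero

/-- The derivative of a ball average in its centre is a flux through the sphere. -/
theorem hasFDerivAt_integral_closedBall [Nontrivial E] {F : E → ℝ} (hF : Continuous F) (x : E) :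
    HasFDerivAt (fun x => ∫ u in closedBall (0 : E) 1, F (x + u))
      (innerSL ℝ (sphereFlux F 1 x)) x := by
  have hpos : ∀ k : ℕ, (0 : ℝ) < 1 / ((k : ℝ) + 1) := fun k => by positivity
  have hle : ∀ k : ℕ, 1 / ((k : ℝ) + 1) ≤ 1 := fun k => by
    rw [div_le_one (by positivity)]; linarith [(Nat.cast_nonneg k : (0 : ℝ) ≤ k)]
  have hlim : Tendsto (fun k : ℕ => 1 / ((k : ℝ) + 1)) atTop (𝓝 0) :=
    tendsto_one_div_add_atTop_nhds_zero_nat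
  refine hasFDerivAt_of_tendstoUniformlyOnFilter (l := atTop)
    (f := fun (k : ℕ) x => ∫ u, F (x + u) * radialBump (1 / ((k : ℝ) + 1)) u)
    (f' := fun (k : ℕ) x => innerSL ℝ (∫ r in (1 : ℝ)..(1 + 1 / ((k : ℝ) + 1)),
      (r * radialDensity (1 / ((k : ℝ) + 1)) r) • sphereFlux F r x))
    (g' := fun x => innerSL ℝ (sphereFlux F 1 x)) ?_ ?_ ?_
  · rw [Metric.tendstoUniformlyOnFilter_iff]
    intro ε hε
    have hct := (continuous_sphereFlux hF).tendsto (1, x)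
    rw [Metric.tendsto_nhds] at hct
    have h1 := hct (ε / 4) (by positivity)
    rw [nhds_prod_eq, eventually_prod_iff] at h1
    obtain ⟨p, hp, q, hq, hpq⟩ := h1
    obtain ⟨δ, hδ, hball⟩ := Metric.eventually_nhds_iff.1 hp
    have hk : ∀ᶠ k : ℕ in atTop, 1 / ((k : ℝ) + 1) < δ := hlim.eventually_lt_const hδ
    filter_upwards [hk.prod_mk hq] with ⟨k, y⟩ ⟨hk, hy⟩
    set h := 1 / ((k : ℝ) + 1) with hh
    have hh0 : 0 < h := hpos k
    rw [dist_eq_norm, ← map_sub, innerSL_apply_norm]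
    -- The limit is written as an average against the same unit-mass weight. What remains is the
    -- variation of the flux over radii in [1, 1 + h], which joint continuity makes small uniformly
    -- for y near x.
    have hid : sphereFlux F 1 y = ∫ r in (1 : ℝ)..(1 + h), (r * radialDensity h r) •
        sphereFlux F 1 y := by
      rw [intervalIntegral.integral_smul_const, integral_radialDensity hh0, one_smul]
    have hcd := continuous_radialDensity h
    have hcs : Continuous (fun r => sphereFlux F r y) :=
      (continuous_sphereFlux hF).comp (by fun_prop : Continuous fun r : ℝ => (r, y))
    rw [hid, ← intervalIntegral.integral_sub]
    · have hb : ‖∫ r in (1 : ℝ)..(1 + h), ((r * radialDensity h r) • sphereFlux F 1 y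
          - (r * radialDensity h r) • sphereFlux F r y)‖
          ≤ ∫ r in (1 : ℝ)..(1 + h), (r * radialDensity h r) * (ε / 2) := by
        apply intervalIntegral.norm_integral_le_of_norm_le (by linarith)
        · refine Eventually.of_forall fun r hr => ?_
          have hr1 : 0 ≤ r * radialDensity h r :=
            mul_nonneg (by linarith [hr.1]) (radialDensity_nonneg hh0 r)
          rw [← smul_sub, norm_smul, Real.norm_eq_abs, abs_of_nonneg hr1]
          refine mul_le_mul_of_nonneg_left ?_ hr1
          have a1 := hpq (x := 1) (hball (by simpa using hδ)) hy
          have a2 := hpq (x := r) (hball (by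
            rw [Real.dist_eq, abs_of_nonneg (by linarith [hr.1])]; linarith [hr.2])) hy
          have := dist_triangle_right (sphereFlux F 1 y) (sphereFlux F r y) (sphereFlux F 1 x)
          simp only at a1 a2
          rw [dist_eq_norm (sphereFlux F 1 y) (sphereFlux F r y)] at this
          linarith
        · exact (by fun_prop : Continuous fun r => (r * radialDensity h r) * (ε / 2)).intervalIntegrable _ _
      rw [intervalIntegral.integral_mul_const, integral_radialDensity hh0] at hb
      linarith
    · exact (by fun_prop : Continuous fun r => (r * radialDensity h r) • sphereFlux F 1 y).intervalIntegrable _ _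
    · exact (by fun_prop : Continuous fun r => (r * radialDensity h r) • sphereFlux F r y).intervalIntegrable _ _
  · exact Eventually.of_forall fun ⟨k, y⟩ => hasFDerivAt_integral_radialBump hF (hpos k) (hle k) y
  · refine Eventually.of_forall fun y => ?_
    rw [← integral_indicator measurableSet_closedBall]
    have hbd : Integrable ((closedBall (0 : E) 2).indicator fun u => |F (y + u)|) := by
      rw [integrable_indicator_iff measurableSet_closedBall]
      exact (by fun_prop : Continuous fun u => |F (y + u)|).continuousOn.integrableOn_compact
        (isCompact_closedBall _ _)
    refine tendsto_integral_of_dominated_convergence _ (fun k => ?_) hbd (fun k => ?_) ?_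
    · have := (contDiff_radialBump (E := E) (1 / ((k : ℝ) + 1))).continuous
      exact (by fun_prop : Continuous fun u => F (y + u)
        * radialBump (1 / ((k : ℝ) + 1)) u).aestronglyMeasurable
    · refine Eventually.of_forall fun u => ?_
      by_cases hu : u ∈ closedBall (0 : E) 2
      · rw [indicator_of_mem hu, norm_mul, Real.norm_eq_abs, Real.norm_eq_abs]
        refine mul_le_of_le_one_right (abs_nonneg _) ?_
        rw [radialBump, abs_of_nonneg (Real.smoothTransition.nonneg _)]
        exact Real.smoothTransition.le_one _
      · rw [indicator_of_notMem hu, radialBump_eq_zero (hpos k) (hle k)]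
        · simp
        · simp at hu; exact hu.le
    · refine Eventually.of_forall fun u => ?_
      by_cases hu : u ∈ closedBall (0 : E) 1
      · rw [indicator_of_mem hu]
        refine tendsto_const_nhds.congr fun k => ?_
        rw [radialBump, Real.smoothTransition.one_of_one_le, mul_one]
        rw [one_le_div (hpos k)]
        simp at hu
        nlinarith [norm_nonneg u]
      · rw [indicator_of_notMem hu]
        have hu' : 1 < ‖u‖ := by simpa using hu
        have : ∀ᶠ k : ℕ in atTop, 1 / ((k : ℝ) + 1) < ‖u‖ ^ 2 - 1 :=
          hlim.eventually_lt_const (by nlinarith)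
        refine tendsto_const_nhds.congr' ?_
        filter_upwards [this] with k hk
        rw [radialBump, Real.smoothTransition.zero_of_nonpos, mul_zero]
        apply div_nonpos_of_nonpos_of_nonneg _ (hpos k).le
        linarith

end SphereGradient

/-! ### First-order inequalities for convex functions, and Lipschitz extension -/

section ConvexGradient

open Set Filter Topology

variable {E : Type*} [NormedAddCommGroup E] [InnerProductSpace ℝ E] [CompleteSpace E]

theorem HasGradientAt.hasDerivAt_add_smul {f : E → ℝ} {g x v : E} {t : ℝ}
    (hg : HasGradientAt f g (x + t • v)) :
    HasDerivAt (fun s : ℝ => f (x + s • v)) (inner ℝ g v) t := by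
  have h1 : HasDerivAt (fun s : ℝ => x + s • v) v t := by
    simpa using ((hasDerivAt_id t).smul_const v).const_add x
  have h2 := (hasGradientAt_iff_hasFDerivAt.1 hg).comp_hasDerivAt t h1
  simpa using! h2

/-- Divide the strong convexity inequality on the segment from x to y by t and let t decrease to 0.
-/
theorem StrongConvexOn.le_of_hasGradientAt {f : E → ℝ} {m : ℝ} (hf : StrongConvexOn univ m f)
    {x g : E} (hg : HasGradientAt f g x) (y : E) :
    f x + inner ℝ g (y - x) + m / 2 * ‖y - x‖ ^ 2 ≤ f y := by
  have hd : HasDerivAt (fun s : ℝ => f (x + s • (y - x))) (inner ℝ g (y - x)) 0 :=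
    HasGradientAt.hasDerivAt_add_smul (by simpa using hg)
  have hs := hd.tendsto_slope_zero_right
  have hr : Tendsto (fun t : ℝ => f y - f x - (1 - t) * (m / 2 * ‖y - x‖ ^ 2)) (𝓝[>] 0)
      (𝓝 (f y - f x - (1 - 0) * (m / 2 * ‖y - x‖ ^ 2))) := by
    refine Tendsto.mono_left ?_ nhdsWithin_le_nhds
    exact (by fun_prop : Continuous fun t : ℝ =>
      f y - f x - (1 - t) * (m / 2 * ‖y - x‖ ^ 2)).tendsto 0
  have := le_of_tendsto_of_tendsto hs hr ?_
  · linarith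
  · filter_upwards [Ioo_mem_nhdsGT (zero_lt_one' ℝ)] with t ht
    have h1 := hf.2 (mem_univ y) (mem_univ x) ht.1.le (sub_nonneg.2 ht.2.le) (by ring)
    have e1 : t • y + (1 - t) • x = x + t • (y - x) := by
      rw [smul_sub, sub_smul, one_smul]; abel
    rw [e1] at h1
    simp only [smul_eq_mul, zero_add, zero_smul, add_zero] at h1 ⊢
    rw [inv_mul_le_iff₀ ht.1]
    nlinarith

/-- Along the segment, f minus its quadratic model is antitone, by Cauchy–Schwarz. Only points of
the segment are compared with x, so a Lipschitz bound on a convex set suffices. -/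
theorem le_add_sq_of_lipschitz_gradient {f : E → ℝ} {g : E → E} {S : Set E} {L : ℝ}
    (hS : Convex ℝ S) (hg : ∀ x, HasGradientAt f (g x) x)
    (hL : ∀ x ∈ S, ∀ y ∈ S, ‖g x - g y‖ ≤ L * ‖x - y‖) {x y : E} (hx : x ∈ S) (hy : y ∈ S) :
    f y ≤ f x + inner ℝ (g x) (y - x) + L / 2 * ‖y - x‖ ^ 2 := by
  set v := y - x with hv
  have hd : ∀ t : ℝ, HasDerivAt (fun s : ℝ => f (x + s • v) - s * inner ℝ (g x) v
      - L / 2 * ‖v‖ ^ 2 * s ^ 2) (inner ℝ (g (x + t • v)) v - inner ℝ (g x) v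
        - L * ‖v‖ ^ 2 * t) t := by
    intro t
    have := ((HasGradientAt.hasDerivAt_add_smul (hg (x + t • v))).sub
      ((hasDerivAt_id t).mul_const (inner ℝ (g x) v))).sub
      (((hasDerivAt_id t).pow 2).const_mul (L / 2 * ‖v‖ ^ 2))
    refine this.congr_deriv ?_
    simp
    ring
  have ha : AntitoneOn (fun s : ℝ => f (x + s • v) - s * inner ℝ (g x) v
      - L / 2 * ‖v‖ ^ 2 * s ^ 2) (Icc 0 1) := by
    apply antitoneOn_of_deriv_nonpos (convex_Icc 0 1)
    · exact fun t _ => (hd t).continuousAt.continuousWithinAt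
    · exact fun t _ => (hd t).differentiableAt.differentiableWithinAt
    · intro t ht
      rw [interior_Icc] at ht
      rw [(hd t).deriv]
      have hm : x + t • v ∈ S := hS.add_smul_sub_mem hx hy ⟨ht.1.le, ht.2.le⟩
      have h1 := hL _ hm _ hx
      rw [add_sub_cancel_left, norm_smul, Real.norm_eq_abs, abs_of_pos ht.1] at h1
      have h2 := real_inner_le_norm (g (x + t • v) - g x) v
      rw [inner_sub_left] at h2
      nlinarith [norm_nonneg v]
  have := ha (left_mem_Icc.2 zero_le_one) (right_mem_Icc.2 zero_le_one) zero_le_one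
  simp only [one_smul, zero_smul, add_zero, hv, add_sub_cancel] at this
  simp only [hv]
  linarith

/-- Compare the upper bound centred at x with the tangent at y, both at the gradient step x - L⁻¹(g
x - g y). That point may leave any prescribed set, hence the global Lipschitz assumption. -/
theorem ConvexOn.sq_norm_gradient_sub_le {f : E → ℝ} {g : E → E} {L : ℝ} (hLpos : 0 < L)
    (hf : ConvexOn ℝ univ f) (hg : ∀ x, HasGradientAt f (g x) x)
    (hL : ∀ x y, ‖g x - g y‖ ≤ L * ‖x - y‖) (x y : E) :
    ‖g x - g y‖ ^ 2 ≤ 2 * L * (f x - f y - inner ℝ (g y) (x - y)) := by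
  set p := g x - g y with hp
  have h1 := le_add_sq_of_lipschitz_gradient (S := univ) convex_univ hg
    (fun x _ y _ => hL x y) (mem_univ x) (mem_univ (x - L⁻¹ • p))
  have h2 := (strongConvexOn_zero.2 hf).le_of_hasGradientAt (hg y) (x - L⁻¹ • p)
  have e1 : x - L⁻¹ • p - x = -(L⁻¹ • p) := by abel
  have e2 : x - L⁻¹ • p - y = (x - y) - L⁻¹ • p := by abel
  rw [e1, inner_neg_right, inner_smul_right, norm_neg, norm_smul] at h1
  rw [e2, inner_sub_right, inner_smul_right] at h2
  have e3 : inner ℝ (g x) p - inner ℝ (g y) p = ‖p‖ ^ 2 := by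
    rw [← inner_sub_left, ← hp, real_inner_self_eq_norm_sq]
  rw [Real.norm_eq_abs, abs_of_pos (inv_pos.2 hLpos)] at h1
  have h3 : L⁻¹ * (inner ℝ (g x) p - inner ℝ (g y) p) - L / 2 * (L⁻¹ * ‖p‖) ^ 2
      ≤ f x - f y - inner ℝ (g y) (x - y) := by linarith
  rw [e3] at h3
  have e4 : L⁻¹ * ‖p‖ ^ 2 - L / 2 * (L⁻¹ * ‖p‖) ^ 2 = ‖p‖ ^ 2 / (2 * L) := by
    field_simp; ring
  rw [e4, div_le_iff₀ (by positivity)] at h3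
  linarith

/-- A convex Lipschitz function on a convex set extends to a convex Lipschitz function. -/
theorem exists_convexOn_lipschitz_extension {f : E → ℝ} {K : Set E} {M : ℝ} (hM : 0 ≤ M)
    (hK : K.Nonempty) (hf : ConvexOn ℝ K f)
    (hL : ∀ x ∈ K, ∀ y ∈ K, |f y - f x| ≤ M * ‖y - x‖) :
    ∃ F : E → ℝ, ConvexOn ℝ univ F ∧ (∀ x y, |F y - F x| ≤ M * ‖y - x‖) ∧ EqOn F f K := by
  have : Nonempty K := hK.to_subtype
  -- Infimal convolution with M‖·‖. The bracket is jointly convex in (x, u), which makes the infimum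
  -- convex; the Lipschitz bound on K keeps it finite and makes u = x optimal when x ∈ K.
  let F : E → ℝ := fun x => ⨅ u : K, (f u + M * ‖x - u‖)
  have hlow : ∀ (x : E) (w u : K), f w - M * ‖x - w‖ ≤ f u + M * ‖x - u‖ := by
    intro x w u
    have h1 := (abs_le.1 (hL u u.2 w w.2)).2
    have h2 : ‖(w : E) - u‖ ≤ ‖x - w‖ + ‖x - u‖ := by
      have := norm_sub_le (x - (u : E)) (x - w)
      rw [sub_sub_sub_cancel_left] at this
      linarith
    nlinarith
  have hbdd : ∀ x : E, BddBelow (range fun u : K => f u + M * ‖x - u‖) := by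
    intro x
    obtain ⟨w⟩ := this
    exact ⟨f w - M * ‖x - w‖, by rintro _ ⟨u, rfl⟩; exact hlow x w u⟩
  have hle : ∀ (x : E) (u : K), F x ≤ f u + M * ‖x - u‖ := fun x u => ciInf_le (hbdd x) u
  have hlip : ∀ x y, F y ≤ F x + M * ‖y - x‖ := by
    intro x y
    rw [← sub_le_iff_le_add]
    refine le_ciInf fun u => ?_
    have := hle y u
    have h2 := norm_sub_le_norm_sub_add_norm_sub y x (u : E)
    nlinarith
  refine ⟨F, ⟨convex_univ, ?_⟩, ?_, ?_⟩
  · intro x _ y _ a b ha hb hab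
    have key : ∀ u w : K, F (a • x + b • y)
        ≤ a * (f u + M * ‖x - u‖) + b * (f w + M * ‖y - w‖) := by
      intro u w
      have h1 := hle (a • x + b • y) ⟨a • (u : E) + b • (w : E), hf.1 u.2 w.2 ha hb hab⟩
      have h2 := hf.2 u.2 w.2 ha hb hab
      have h3 : ‖a • x + b • y - (a • (u : E) + b • (w : E))‖ ≤ a * ‖x - u‖ + b * ‖y - w‖ := by
        have e : a • x + b • y - (a • (u : E) + b • (w : E))
            = a • (x - u) + b • (y - w) := by rw [smul_sub, smul_sub]; abel
        rw [e]
        refine (norm_add_le _ _).trans ?_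
        rw [norm_smul, norm_smul, Real.norm_eq_abs, Real.norm_eq_abs, abs_of_nonneg ha,
          abs_of_nonneg hb]
      simp only [smul_eq_mul] at h1 h2
      nlinarith
    have k1 : ∀ w : K, F (a • x + b • y) - b * (f w + M * ‖y - w‖) ≤ a * F x := by
      intro w
      rw [Real.mul_iInf_of_nonneg ha]
      exact le_ciInf fun u => by linarith [key u w]
    have k2 : F (a • x + b • y) - a * F x ≤ b * F y := by
      rw [Real.mul_iInf_of_nonneg hb]
      exact le_ciInf fun w => by linarith [k1 w]
    simp only [smul_eq_mul]
    linarith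
  · intro x y
    rw [abs_le]
    have h1 := hlip x y
    have h2 := hlip y x
    rw [norm_sub_rev] at h2
    constructor <;> linarith
  · intro x hx
    apply le_antisymm
    · simpa using hle x ⟨x, hx⟩
    · refine le_ciInf fun u => ?_
      simpa using hlow x ⟨x, hx⟩ u

end ConvexGradient

/-! ### The smoothed function: gradient, strong convexity, smoothness on S -/

section Smoothing

open Set Filter Topology Metric

variable {n d : ℕ}

theorem finrank_stack (n d : ℕ) : Module.finrank ℝ (Stack n d) = n * d := by
  have e : Stack n d ≃ₗ[ℝ] (Fin n → Fin d → ℝ) :=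
    (WithLp.linearEquiv 2 ℝ (Fin n → EuclideanSpace ℝ (Fin d))).trans
      (LinearEquiv.piCongrRight fun _ => WithLp.linearEquiv 2 ℝ (Fin d → ℝ))
  rw [e.finrank_eq, Module.finrank_pi_fintype]
  simp

theorem nontrivial_stack (hn : 1 ≤ n) (hd : 1 ≤ d) : Nontrivial (Stack n d) := by
  apply Module.nontrivial_of_finrank_pos (R := ℝ)
  rw [finrank_stack]
  positivity

theorem toSphere_univ_ne_zero (hn : 1 ≤ n) (hd : 1 ≤ d) :
    (volume : Measure (Stack n d)).toSphere univ ≠ 0 := by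
  have := nontrivial_stack hn hd
  simp only [ne_eq, Measure.measure_univ_eq_zero]
  exact Measure.toSphere_ne_zero _

theorem isProbabilityMeasure_uniformSphere (hn : 1 ≤ n) (hd : 1 ≤ d) :
    IsProbabilityMeasure (uniformSphere n d) := by
  constructor
  rw [uniformSphere, Measure.map_apply measurable_subtype_coe MeasurableSet.univ]
  simp only [preimage_univ, Measure.smul_apply, smul_eq_mul]
  exact ENNReal.inv_mul_cancel (toSphere_univ_ne_zero hn hd) (measure_ne_top _ _)

theorem integral_uniformSphere {G : Type*} [NormedAddCommGroup G] [NormedSpace ℝ G]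
    (g : Stack n d → G) :
    ∫ e, g e ∂uniformSphere n d = ((volume : Measure (Stack n d)).toSphere.real univ)⁻¹ •
      ∫ e : sphere (0 : Stack n d) 1, g e ∂(volume : Measure (Stack n d)).toSphere := by
  rw [uniformSphere, (MeasurableEmbedding.subtype_coe isClosed_sphere.measurableSet).integral_map,
    integral_smul_measure, ENNReal.toReal_inv]
  rfl

theorem ae_norm_uniformSphere : ∀ᵐ e ∂uniformSphere n d, ‖e‖ = 1 := by
  rw [uniformSphere, (MeasurableEmbedding.subtype_coe isClosed_sphere.measurableSet).ae_map_iff]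
  exact Eventually.of_forall fun e => by simp

theorem integrable_uniformSphere (hn : 1 ≤ n) (hd : 1 ≤ d) {G : Type*} [NormedAddCommGroup G]
    {g : Stack n d → G} (hg : Continuous g) : Integrable g (uniformSphere n d) := by
  rw [uniformSphere,
    (MeasurableEmbedding.subtype_coe isClosed_sphere.measurableSet).integrable_map_iff]
  refine Integrable.smul_measure ?_ (ENNReal.inv_ne_top.2 (toSphere_univ_ne_zero hn hd))
  have h1 : Continuous (g ∘ (Subtype.val : sphere (0 : Stack n d) 1 → Stack n d)) := by fun_prop
  rw [← integrableOn_univ]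
  exact h1.continuousOn.integrableOn_compact isCompact_univ

/-- The expectation of the one-point estimator without noise. -/
noncomputable def sphereGrad (γ : ℝ) (F : Stack n d → ℝ) (x : Stack n d) : Stack n d :=
  (((n * d : ℕ) : ℝ) / γ) • ∫ e, F (x + γ • e) • e ∂uniformSphere n d

/-- The flux formula for the unit ball, rescaled by γ. The factor n d is the ratio of the area of
the sphere to the volume of the ball. -/
theorem hasGradientAt_smoothF (hn : 1 ≤ n) (hd : 1 ≤ d) {γ : ℝ} (hγ : 0 < γ) {F : Stack n d → ℝ}
    (hF : Continuous F) (x : Stack n d) :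
    HasGradientAt (smoothF γ F) (sphereGrad γ F x) x := by
  have := nontrivial_stack hn hd
  have h1 := hasFDerivAt_integral_closedBall (F := fun y => F (γ • y)) (by fun_prop) (γ⁻¹ • x)
  have h2 : HasFDerivAt (fun x : Stack n d => γ⁻¹ • x)
      (γ⁻¹ • ContinuousLinearMap.id ℝ (Stack n d)) x := (hasFDerivAt_id x).const_smul γ⁻¹
  have h3 := (h1.comp x h2).const_smul
    ((volume : Measure (Stack n d)).real (closedBall (0 : Stack n d) 1))⁻¹
  rw [hasGradientAt_iff_hasFDerivAt]
  have e1 : smoothF γ F = ((volume : Measure (Stack n d)).real (closedBall (0 : Stack n d) 1))⁻¹ •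
      ((fun x => ∫ u in closedBall (0 : Stack n d) 1, F (γ • (x + u))) ∘ fun x => γ⁻¹ • x) := by
    funext x
    simp only [smoothF, setAverage_eq, Pi.smul_apply, Function.comp, smul_add,
      smul_inv_smul₀ hγ.ne']
  rw [e1]
  refine h3.congr_fderiv ?_
  ext v
  have hv : (volume : Measure (Stack n d)).real (closedBall (0 : Stack n d) 1) ≠ 0 := by
    rw [Measure.real, ENNReal.toReal_ne_zero]
    exact ⟨(measure_closedBall_pos _ _ one_pos).ne', measure_closedBall_lt_top.ne⟩
  have hs : (volume : Measure (Stack n d)).toSphere.real univ = ((n * d : ℕ) : ℝ) *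
      (volume : Measure (Stack n d)).real (closedBall (0 : Stack n d) 1) := by
    rw [Measure.toSphere_real_apply_univ, finrank_stack, Measure.real, Measure.real,
      Measure.addHaar_closedBall_eq_addHaar_ball]
  have hnd : ((n * d : ℕ) : ℝ) ≠ 0 := by
    have : 0 < n * d := by positivity
    exact_mod_cast this.ne'
  rw [sphereGrad, integral_uniformSphere, hs]
  simp only [sphereFlux, one_pow, one_smul, smul_add, smul_inv_smul₀ hγ.ne']
  simp
  field_simp

/-- The uniform probability distribution on the Euclidean unit ball. -/
noncomputable def uniformBall (n d : ℕ) : Measure (Stack n d) :=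
  ((volume.restrict (closedBall (0 : Stack n d) 1)) univ)⁻¹ •
    volume.restrict (closedBall (0 : Stack n d) 1)

theorem smoothF_eq_integral (γ : ℝ) (F : Stack n d → ℝ) (x : Stack n d) :
    smoothF γ F x = ∫ u, F (x + γ • u) ∂uniformBall n d :=
  rfl

theorem volume_closedBall_ne_zero :
    (volume.restrict (closedBall (0 : Stack n d) 1)) univ ≠ 0 := by
  rw [Measure.restrict_apply_univ]
  exact (measure_closedBall_pos _ _ one_pos).ne'

instance isProbabilityMeasure_uniformBall : IsProbabilityMeasure (uniformBall n d) := by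
  constructor
  have : IsFiniteMeasure (volume.restrict (closedBall (0 : Stack n d) 1)) :=
    ⟨by rw [Measure.restrict_apply_univ]; exact measure_closedBall_lt_top⟩
  rw [uniformBall, Measure.smul_apply, smul_eq_mul]
  exact ENNReal.inv_mul_cancel volume_closedBall_ne_zero (measure_ne_top _ _)

theorem ae_norm_uniformBall : ∀ᵐ u ∂uniformBall n d, ‖u‖ ≤ 1 := by
  refine Measure.ae_smul_measure ?_ _
  filter_upwards [ae_restrict_mem measurableSet_closedBall] with u hu
  simpa using hu

theorem integrable_uniformBall {G : Type*} [NormedAddCommGroup G] {g : Stack n d → G}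
    (hg : Continuous g) : Integrable g (uniformBall n d) :=
  (hg.continuousOn.integrableOn_compact (isCompact_closedBall _ _)).smul_measure
    (ENNReal.inv_ne_top.2 volume_closedBall_ne_zero)

theorem integral_neg_uniformBall (g : Stack n d → ℝ) :
    ∫ u, g (-u) ∂uniformBall n d = ∫ u, g u ∂uniformBall n d := by
  rw [uniformBall, integral_smul_measure, integral_smul_measure]
  congr 1
  rw [← integral_indicator measurableSet_closedBall, ← integral_indicator measurableSet_closedBall,
    ← (LinearIsometryEquiv.neg ℝ (E := Stack n d)).measurePreserving.integral_comp
      (LinearIsometryEquiv.neg ℝ (E := Stack n d)).toHomeomorph.measurableEmbedding]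
  refine integral_congr_ae (Eventually.of_forall fun u => ?_)
  simp [indicator]

/-- Isotropy of the sphere, read off from the gradient formula: smoothing a linear form only adds a
constant, so the gradient is still v. -/
theorem integral_inner_smul_uniformSphere (hn : 1 ≤ n) (hd : 1 ≤ d) (v : Stack n d) :
    ((n * d : ℕ) : ℝ) • ∫ e, inner ℝ e v • e ∂uniformSphere n d = v := by
  have hc : Continuous fun y : Stack n d => inner ℝ y v := by fun_prop
  have h1 := hasGradientAt_smoothF hn hd one_pos hc 0
  have h2 : HasGradientAt (smoothF 1 fun y : Stack n d => inner ℝ y v) v 0 := by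
    have e : (smoothF 1 fun y : Stack n d => inner ℝ y v)
        = fun x => (InnerProductSpace.toDual ℝ (Stack n d) v) x
          + ∫ u, inner ℝ u v ∂uniformBall n d := by
      funext x
      rw [smoothF_eq_integral]
      simp only [one_smul, inner_add_left]
      rw [integral_add (integrable_const _) (integrable_uniformBall hc)]
      simp [real_inner_comm]
    rw [e, hasGradientAt_iff_hasFDerivAt]
    exact (ContinuousLinearMap.hasFDerivAt _).add_const _
  have h3 := h1.unique h2
  simpa [sphereGrad] using h3

theorem integral_inner_sq_uniformSphere (hn : 1 ≤ n) (hd : 1 ≤ d) (v : Stack n d) :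
    ∫ e, inner ℝ e v ^ 2 ∂uniformSphere n d = ‖v‖ ^ 2 / ((n * d : ℕ) : ℝ) := by
  have hnd : (0 : ℝ) < ((n * d : ℕ) : ℝ) := by
    have : 0 < n * d := by positivity
    exact_mod_cast this
  have h := congrArg (fun w => inner ℝ v w) (integral_inner_smul_uniformSphere hn hd v)
  simp only [inner_smul_right, real_inner_self_eq_norm_sq] at h
  rw [← integral_inner (𝕜 := ℝ) (integrable_uniformSphere hn hd (by fun_prop))] at h
  rw [← h, mul_div_cancel_left₀ _ hnd.ne']
  refine integral_congr_ae (Eventually.of_forall fun e => ?_)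
  simp only [inner_smul_right, real_inner_comm e v]
  ring

/-- The second moment is ‖v‖²/D; a pointwise AM–GM inequality with balanced weights replaces
Cauchy–Schwarz. This gain of √D is why both the smoothness constant and the bias carry √D rather
than D. -/
theorem integral_abs_inner_uniformSphere_le (hn : 1 ≤ n) (hd : 1 ≤ d) (v : Stack n d) :
    ∫ e, |inner ℝ e v| ∂uniformSphere n d ≤ ‖v‖ / √((n * d : ℕ) : ℝ) := by
  have := isProbabilityMeasure_uniformSphere hn hd
  have hnd : (0 : ℝ) < ((n * d : ℕ) : ℝ) := by
    have : 0 < n * d := by positivity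
    exact_mod_cast this
  set s := √((n * d : ℕ) : ℝ) with hs
  have hs0 : 0 < s := Real.sqrt_pos.2 hnd
  have hs2 : s ^ 2 = ((n * d : ℕ) : ℝ) := Real.sq_sqrt hnd.le
  rcases eq_or_ne v 0 with rfl | hv
  · simp
  have hv0 : 0 < ‖v‖ := norm_pos_iff.2 hv
  have hpt : ∀ e : Stack n d, |inner ℝ e v| ≤ inner ℝ e v ^ 2 * (s / (2 * ‖v‖)) + ‖v‖ / (2 * s) := by
    intro e
    have h := sq_nonneg (|inner ℝ e v| * s - ‖v‖)
    have e1 : inner ℝ e v ^ 2 * (s / (2 * ‖v‖)) + ‖v‖ / (2 * s) - |inner ℝ e v|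
        = (|inner ℝ e v| * s - ‖v‖) ^ 2 / (2 * ‖v‖ * s) := by
      rw [← sq_abs]
      field_simp
      ring
    have : 0 ≤ (|inner ℝ e v| * s - ‖v‖) ^ 2 / (2 * ‖v‖ * s) := by positivity
    linarith
  have i2 : Integrable (fun e : Stack n d => inner ℝ e v ^ 2) (uniformSphere n d) :=
    integrable_uniformSphere hn hd (by fun_prop)
  have i3 : Integrable (fun e : Stack n d => inner ℝ e v ^ 2 * (s / (2 * ‖v‖)) + ‖v‖ / (2 * s))
      (uniformSphere n d) := (i2.mul_const _).add (integrable_const _)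
  refine (integral_mono (integrable_uniformSphere hn hd (by fun_prop)) i3 hpt).trans ?_
  rw [integral_add (i2.mul_const _) (integrable_const _), integral_mul_const,
    integral_inner_sq_uniformSphere hn hd, ← hs2]
  simp
  apply le_of_eq
  field_simp
  ring

theorem uniformConvexOn_smoothF {γ m : ℝ} {F : Stack n d → ℝ} (hc : Continuous F)
    (hF : StrongConvexOn univ m F) : StrongConvexOn univ m (smoothF γ F) := by
  refine ⟨convex_univ, fun x _ y _ a b ha hb hab => ?_⟩
  simp only [smoothF_eq_integral, smul_eq_mul]
  have i : ∀ z : Stack n d, Integrable (fun u => F (z + γ • u)) (uniformBall n d) :=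
    fun z => integrable_uniformBall (by fun_prop)
  have hi : Integrable (fun u => a * F (x + γ • u) + b * F (y + γ • u)) (uniformBall n d) :=
    ((i x).const_mul a).add ((i y).const_mul b)
  have : ∫ u, F (a • x + b • y + γ • u) ∂uniformBall n d
      ≤ ∫ u, (a * F (x + γ • u) + b * F (y + γ • u) - a * b * (m / 2 * ‖x - y‖ ^ 2))
        ∂uniformBall n d := by
    refine integral_mono (i _) (hi.sub (integrable_const _)) fun u => ?_
    have h := hF.2 (mem_univ (x + γ • u)) (mem_univ (y + γ • u)) ha hb hab
    have e : a • (x + γ • u) + b • (y + γ • u) = a • x + b • y + γ • u := by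
      calc _ = a • x + b • y + (a + b) • γ • u := by rw [add_smul, smul_add, smul_add]; abel
        _ = _ := by rw [hab, one_smul]
    simpa only [e, add_sub_add_right_eq_sub, smul_eq_mul] using h
  refine this.trans (le_of_eq ?_)
  rw [integral_sub hi (integrable_const _), integral_add ((i x).const_mul a) ((i y).const_mul b),
    integral_const_mul, integral_const_mul]
  simp

/-- Pair u with -u, which have the same law, and use convexity at the midpoint. -/
theorem le_smoothF {γ : ℝ} {F : Stack n d → ℝ} (hc : Continuous F) (hF : ConvexOn ℝ univ F)
    (x : Stack n d) : F x ≤ smoothF γ F x := by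
  have i : ∀ c : ℝ, Integrable (fun u => F (x + c • u)) (uniformBall n d) :=
    fun z => integrable_uniformBall (by fun_prop)
  have h1 : smoothF γ F x = ∫ u, (1 / 2 * F (x + γ • u) + 1 / 2 * F (x + (-γ) • u))
      ∂uniformBall n d := by
    have e : ∫ u, F (x + (-γ) • u) ∂uniformBall n d = ∫ u, F (x + γ • u) ∂uniformBall n d := by
      rw [← integral_neg_uniformBall fun u => F (x + γ • u)]
      simp
    rw [integral_add ((i _).const_mul _) ((i _).const_mul _), integral_const_mul,
      integral_const_mul, e, smoothF_eq_integral]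
    ring
  rw [h1]
  calc F x = ∫ _, F x ∂uniformBall n d := by simp
    _ ≤ _ := by
      refine integral_mono (integrable_const _)
        (((i _).const_mul _).add ((i _).const_mul _)) fun u => ?_
      have h := hF.2 (mem_univ (x + γ • u)) (mem_univ (x + (-γ) • u))
        (by norm_num : (0 : ℝ) ≤ 1 / 2) (by norm_num : (0 : ℝ) ≤ 1 / 2) (by norm_num)
      have e : (1 / 2 : ℝ) • (x + γ • u) + (1 / 2 : ℝ) • (x + (-γ) • u) = x := by
        rw [← smul_add, neg_smul]
        rw [show x + γ • u + (x + -(γ • u)) = (2 : ℝ) • x by rw [two_smul]; abel, smul_smul]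
        norm_num
      rw [e] at h
      simpa using h

theorem add_smul_mem_neigh {S : Set (Stack n d)} {γ : ℝ} (hγ : 0 ≤ γ) {x u : Stack n d}
    (hx : x ∈ S) (hu : ‖u‖ ≤ 1) : x + γ • u ∈ neigh S γ := by
  refine ⟨x, hx, ?_⟩
  rw [add_sub_cancel_left, norm_smul, Real.norm_eq_abs, abs_of_nonneg hγ]
  exact mul_le_of_le_one_right hγ hu

theorem subset_neigh {S : Set (Stack n d)} {γ : ℝ} (hγ : 0 ≤ γ) : S ⊆ neigh S γ :=
  fun x hx => ⟨x, hx, by simpa using hγ⟩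

theorem convex_neigh {S : Set (Stack n d)} (hS : Convex ℝ S) (γ : ℝ) : Convex ℝ (neigh S γ) := by
  rintro x ⟨p, hp, hxp⟩ y ⟨q, hq, hyq⟩ a b ha hb hab
  refine ⟨a • p + b • q, hS hp hq ha hb hab, ?_⟩
  have e : a • x + b • y - (a • p + b • q) = a • (x - p) + b • (y - q) := by
    rw [smul_sub, smul_sub]; abel
  rw [e]
  refine (norm_add_le _ _).trans ?_
  rw [norm_smul, norm_smul, Real.norm_eq_abs, Real.norm_eq_abs, abs_of_nonneg ha,
    abs_of_nonneg hb]
  calc a * ‖x - p‖ + b * ‖y - q‖ ≤ a * γ + b * γ := by gcongr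
    _ = γ := by rw [← add_mul, hab, one_mul]

theorem smoothF_le {γ M : ℝ} (hγ : 0 ≤ γ) (hM : 0 ≤ M) {F : Stack n d → ℝ} (hc : Continuous F)
    {S : Set (Stack n d)}
    (hL : ∀ x ∈ neigh S γ, ∀ y ∈ neigh S γ, |F y - F x| ≤ M * ‖y - x‖)
    {x : Stack n d} (hx : x ∈ S) : smoothF γ F x ≤ F x + γ * M := by
  rw [smoothF_eq_integral]
  calc _ ≤ ∫ _, (F x + γ * M) ∂uniformBall n d := by
        refine integral_mono_ae (integrable_uniformBall (by fun_prop)) (integrable_const _) ?_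
        filter_upwards [ae_norm_uniformBall] with u hu
        have h := hL x (subset_neigh hγ hx) _ (add_smul_mem_neigh hγ hx hu)
        rw [add_sub_cancel_left, norm_smul, Real.norm_eq_abs, abs_of_nonneg hγ] at h
        have := (abs_le.1 h).2
        nlinarith [mul_le_of_le_one_right hγ hu]
    _ = _ := by simp

/-- Pair the difference p with itself: the integrand is at most M‖x - y‖ |⟨e, p⟩|, whose mean gains
the factor 1/√D. Then divide by ‖p‖. -/
theorem norm_sphereGrad_sub_le (hn : 1 ≤ n) (hd : 1 ≤ d) {γ M : ℝ} (hγ : 0 < γ) (hM : 0 ≤ M)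
    {F : Stack n d → ℝ} (hc : Continuous F) {S : Set (Stack n d)}
    (hL : ∀ x ∈ neigh S γ, ∀ y ∈ neigh S γ, |F y - F x| ≤ M * ‖y - x‖)
    {x y : Stack n d} (hx : x ∈ S) (hy : y ∈ S) :
    ‖sphereGrad γ F x - sphereGrad γ F y‖ ≤ √((n * d : ℕ) : ℝ) * M / γ * ‖x - y‖ := by
  have hnd : (0 : ℝ) < ((n * d : ℕ) : ℝ) := by
    have : 0 < n * d := by positivity
    exact_mod_cast this
  set D := ((n * d : ℕ) : ℝ) with hD
  set p := sphereGrad γ F x - sphereGrad γ F y with hp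
  have i : ∀ z : Stack n d, Integrable (fun e => F (z + γ • e) • e) (uniformSphere n d) :=
    fun z => integrable_uniformSphere hn hd (by fun_prop)
  have h1 : ‖p‖ ^ 2 ≤ D / γ * (M * ‖x - y‖ * (‖p‖ / √D)) := by
    calc ‖p‖ ^ 2 = inner ℝ p (sphereGrad γ F x - sphereGrad γ F y) := by
          rw [← hp, real_inner_self_eq_norm_sq]
      _ = D / γ * ∫ e, inner ℝ p (F (x + γ • e) • e - F (y + γ • e) • e)
            ∂uniformSphere n d := by
          have j : Integrable (fun e => F (x + γ • e) • e - F (y + γ • e) • e)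
            (uniformSphere n d) := (i x).sub (i y)
          rw [integral_inner (𝕜 := ℝ) j, integral_sub (i x) (i y), sphereGrad,
            sphereGrad, ← smul_sub, inner_smul_right]
      _ ≤ D / γ * ∫ e, M * ‖x - y‖ * |inner ℝ e p| ∂uniformSphere n d := by
          refine mul_le_mul_of_nonneg_left ?_ (by positivity)
          refine integral_mono_ae (integrable_uniformSphere hn hd (by fun_prop))
            (integrable_uniformSphere hn hd (by fun_prop)) ?_
          filter_upwards [ae_norm_uniformSphere] with e he
          rw [← sub_smul, inner_smul_right, real_inner_comm]
          refine (le_abs_self _).trans ?_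
          rw [abs_mul]
          refine mul_le_mul_of_nonneg_right ?_ (abs_nonneg _)
          have := hL _ (add_smul_mem_neigh hγ.le hy he.le) _ (add_smul_mem_neigh hγ.le hx he.le)
          simpa using this
      _ ≤ _ := by
          rw [integral_const_mul]
          have := integral_abs_inner_uniformSphere_le hn hd p
          gcongr
  have hs : D / √D = √D := Real.div_sqrt
  have e2 : D / γ * (M * ‖x - y‖ * (‖p‖ / √D)) = √D * M / γ * ‖x - y‖ * ‖p‖ := by
    calc _ = D / √D * M / γ * ‖x - y‖ * ‖p‖ := by ring
      _ = _ := by rw [hs]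
  rw [e2, sq] at h1
  rcases eq_or_lt_of_le (norm_nonneg p) with h0 | h0
  · rw [← h0]; positivity
  · exact le_of_mul_le_mul_right h1 h0

/-- On `S`, the smoothed function behaves as a globally smooth convex function. -/
theorem smoothF_regularity (hn : 1 ≤ n) (hd : 1 ≤ d) {γ M : ℝ} (hγ : 0 < γ) (hM : 0 < M)
    {F : Stack n d → ℝ} (hc : Continuous F) (hF : ConvexOn ℝ univ F) {S : Set (Stack n d)}
    (hS : Convex ℝ S)
    (hL : ∀ x ∈ neigh S γ, ∀ y ∈ neigh S γ, |F y - F x| ≤ M * ‖y - x‖)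
    {x y : Stack n d} (hx : x ∈ S) (hy : y ∈ S) :
    smoothF γ F x ≤ smoothF γ F y + inner ℝ (gradient (smoothF γ F) y) (x - y)
        + √((n * d : ℕ) : ℝ) * M / γ / 2 * ‖x - y‖ ^ 2 ∧
      ‖gradient (smoothF γ F) x - gradient (smoothF γ F) y‖ ^ 2
        ≤ 2 * (√((n * d : ℕ) : ℝ) * M / γ) * bregman (smoothF γ F) x y := by
  have hnd : (0 : ℝ) < ((n * d : ℕ) : ℝ) := by
    have : 0 < n * d := by positivity
    exact_mod_cast this
  have hgrad : ∀ z, gradient (smoothF γ F) z = sphereGrad γ F z :=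
    fun z => (hasGradientAt_smoothF hn hd hγ hc z).gradient
  -- Cocoercivity evaluates the function at a gradient step that may leave S, where F has no
  -- Lipschitz bound. Values and gradients of the smoothing at points of S involve F only on the
  -- γ-neighbourhood, so F may be replaced by its extension.
  obtain ⟨G, hGc, hGL, hGF⟩ := exists_convexOn_lipschitz_extension hM.le
    ⟨x, subset_neigh hγ.le hx⟩ (hF.subset (subset_univ _) (convex_neigh hS γ)) hL
  have hGcont : Continuous G := by
    have : LipschitzWith M.toNNReal G := by
      refine LipschitzWith.of_dist_le_mul fun a b => ?_
      rw [Real.coe_toNNReal _ hM.le, Real.dist_eq, dist_eq_norm]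
      exact hGL b a
    exact this.continuous
  have hval : ∀ z ∈ S, smoothF γ G z = smoothF γ F z := by
    intro z hz
    rw [smoothF_eq_integral, smoothF_eq_integral]
    refine integral_congr_ae ?_
    filter_upwards [ae_norm_uniformBall] with u hu
    exact hGF (add_smul_mem_neigh hγ.le hz hu)
  have hgr : ∀ z ∈ S, sphereGrad γ G z = sphereGrad γ F z := by
    intro z hz
    rw [sphereGrad, sphereGrad]
    congr 1
    refine integral_congr_ae ?_
    filter_upwards [ae_norm_uniformSphere] with u hu
    simp only [hGF (add_smul_mem_neigh hγ.le hz hu.le)]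
  have hGgrad := fun z => hasGradientAt_smoothF hn hd hγ hGcont z
  have hGlip : ∀ a b, ‖sphereGrad γ G a - sphereGrad γ G b‖
      ≤ √((n * d : ℕ) : ℝ) * M / γ * ‖a - b‖ := fun a b =>
    norm_sphereGrad_sub_le hn hd hγ hM.le hGcont (S := univ) (fun x _ y _ => hGL x y)
      (mem_univ _) (mem_univ _)
  have hGconv : ConvexOn ℝ univ (smoothF γ G) :=
    strongConvexOn_zero.1 (uniformConvexOn_smoothF hGcont (strongConvexOn_zero.2 hGc))
  constructor
  · have := le_add_sq_of_lipschitz_gradient convex_univ hGgrad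
      (fun a _ b _ => hGlip a b) (mem_univ y) (mem_univ x)
    rwa [hval x hx, hval y hy, hgr y hy, ← hgrad] at this
  · have := hGconv.sq_norm_gradient_sub_le (by positivity) hGgrad hGlip x y
    rwa [hval x hx, hval y hy, hgr y hy, hgr x hx, ← hgrad, ← hgrad] at this

end Smoothing

/-! ### The descent inequalities of the four groups of variables -/

section DescentSteps

variable {E : Type*} [NormedAddCommGroup E] [InnerProductSpace ℝ E]

theorem two_mul_inner_le (c : ℝ) (hc : 0 < c) (u v : E) :
    2 * inner ℝ u v ≤ c * ‖u‖ ^ 2 + c⁻¹ * ‖v‖ ^ 2 := by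
  have h := norm_sub_sq_real (c • u) v
  have h2 := sq_nonneg ‖c • u - v‖
  rw [h, norm_smul, inner_smul_left, Real.norm_eq_abs, abs_of_pos hc] at h2
  simp only [conj_trivial] at h2
  have h3 : 0 ≤ c⁻¹ * ((c * ‖u‖) ^ 2 - 2 * (c * inner ℝ u v) + ‖v‖ ^ 2) :=
    mul_nonneg (inv_pos.2 hc).le h2
  have h4 : c⁻¹ * ((c * ‖u‖) ^ 2 - 2 * (c * inner ℝ u v) + ‖v‖ ^ 2)
      = c * ‖u‖ ^ 2 - 2 * inner ℝ u v + c⁻¹ * ‖v‖ ^ 2 := by field_simp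
  linarith

theorem norm_add_sq_le_two_mul (u v : E) : ‖u + v‖ ^ 2 ≤ 2 * ‖u‖ ^ 2 + 2 * ‖v‖ ^ 2 := by
  have h1 := norm_add_sq_real u v
  have h2 := norm_sub_sq_real u v
  nlinarith [sq_nonneg ‖u - v‖]

theorem norm_sub_sq_le_two_mul (u v : E) : ‖u - v‖ ^ 2 ≤ 2 * ‖u‖ ^ 2 + 2 * ‖v‖ ^ 2 := by
  simpa [sub_eq_add_neg] using norm_add_sq_le_two_mul u (-v)

/-- Descent of the primal part. Here `A = x - x*`, `G = x_g - x*`, `d = x⁺ - x`, `w = x_f - x_g`,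
`p` is the gradient difference, `Y = y⁺ - y*`. -/
theorem primal_descent {A G d w p r Y : E} {iη α τ κ L μ φf φf' φg : ℝ}
    (hτ : 0 < τ) (hκ : κ = 1 / τ - 1 / 2) (hκ0 : 0 ≤ κ) (hα : 0 ≤ α)
    (hw : κ • w = G - A)
    (hx : iη • d = α • (G - A - d) - (p + r - Y))
    (h1 : φf' ≤ φg + inner ℝ p (τ • d) + L / 2 * ‖τ • d‖ ^ 2)
    (h2 : φg + μ / 4 * ‖G‖ ^ 2 ≤ inner ℝ p G)
    (h3 : φg + inner ℝ p w ≤ φf) :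
    (iη + α) * ‖A + d‖ ^ 2 + 2 / τ * φf' ≤ iη * ‖A‖ ^ 2 + (2 / τ - 1) * φf - φg
      + (α - μ / 2) * ‖G‖ ^ 2 + (L * τ - iη) * ‖d‖ ^ 2
      + 2 * inner ℝ Y (A + d) - 2 * inner ℝ r (A + d) := by
  have e1 := congrArg (fun v => inner ℝ v (A + d)) hx
  have e2 := congrArg (fun v => inner ℝ p v) hw
  simp only [inner_smul_left, inner_smul_right, inner_sub_left, inner_sub_right, inner_add_left,
    inner_add_right, conj_trivial] at e1 e2
  rw [inner_smul_right, norm_smul, Real.norm_eq_abs, abs_of_pos hτ] at h1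
  have h1' : 2 / τ * φf' ≤ 2 / τ * φg + 2 * inner ℝ p d + L * τ * ‖d‖ ^ 2 := by
    have := mul_le_mul_of_nonneg_left h1 (by positivity : 0 ≤ 2 / τ)
    refine this.trans (le_of_eq ?_)
    field_simp
  have h3' := mul_le_mul_of_nonneg_left h3 hκ0
  have h4 : 0 ≤ α * ‖G - A - d‖ ^ 2 := by positivity
  have h5 : (2 / τ - 1) = 2 * κ := by rw [hκ]; ring
  have h6 : 2 / τ = 2 * κ + 1 := by rw [hκ]; ring
  rw [h5]
  rw [h6] at h1' ⊢
  simp only [← real_inner_self_eq_norm_sq, inner_sub_left, inner_sub_right, inner_add_left,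
    inner_add_right, real_inner_comm d A, real_inner_comm d G, real_inner_comm G A] at *
  simp only [real_inner_comm A d, real_inner_comm A G] at *
  linarith

/-- Descent of the dual variable. Here `w = y - y*`, `d = y⁺ - y`, `X = x⁺ - x*`. -/
theorem dual_descent {w d s X p r : E} {iθ β iν : ℝ} (hβ : 0 ≤ β)
    (hy : iθ • d = β • (p + r - (w + d)) - (iν • s + X)) :
    (iθ + β) * ‖w + d‖ ^ 2 ≤ iθ * ‖w‖ ^ 2 + 2 * β * ‖p‖ ^ 2 + 2 * β * ‖r‖ ^ 2
      - 2 * iν * inner ℝ s (w + d) - 2 * inner ℝ X (w + d) - iθ * ‖d‖ ^ 2 := by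
  have e1 := congrArg (fun v => inner ℝ v (w + d)) hy
  -- The implicit β-term is polarised in the same way, and the second square below splits ‖p + r‖²
  -- into gradient and noise.
  have h1 : 0 ≤ β * ‖p + r - (w + d)‖ ^ 2 := by positivity
  have h2 : 0 ≤ β * ‖p - r‖ ^ 2 := by positivity
  simp only [← real_inner_self_eq_norm_sq, inner_smul_left, inner_sub_left, inner_sub_right,
    inner_add_left, inner_add_right, conj_trivial] at *
  simp only [real_inner_comm w d, real_inner_comm p r, real_inner_comm w p, real_inner_comm d p,
    real_inner_comm w r, real_inner_comm d r] at *
  linarith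

/-- The lower bound that produces the term `y_f` of the potential. -/
theorem dual_averaging {a f w d : E} {ϑ κ : ℝ} (hϑ : 0 < ϑ) (hκ : κ = 1 / ϑ - 1 / 2)
    (hκ0 : 0 ≤ κ) (hw : w = a + κ • (a - f)) :
    1 / ϑ * ‖a + ϑ • d‖ ^ 2 - κ * ‖f‖ ^ 2 + 1 / 2 * ‖a‖ ^ 2 - ϑ * ‖d‖ ^ 2 ≤ ‖w + d‖ ^ 2 := by
  have h1 : 0 ≤ κ * ‖a - f‖ ^ 2 := by positivity
  have h2 : 0 ≤ ‖κ • (a - f) + d‖ ^ 2 := by positivity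
  have e1 : 1 / ϑ * ‖a + ϑ • d‖ ^ 2 = (κ + 1 / 2) * ‖a‖ ^ 2 + 2 * inner ℝ a d + ϑ * ‖d‖ ^ 2 := by
    rw [norm_add_sq_real, norm_smul, inner_smul_right, Real.norm_eq_abs, abs_of_pos hϑ, hκ]
    field_simp
    ring
  rw [e1, hw]
  simp only [← real_inner_self_eq_norm_sq, inner_smul_left, inner_smul_right, inner_sub_left,
    inner_sub_right, inner_add_left, inner_add_right, conj_trivial] at *
  simp only [real_inner_comm a d, real_inner_comm a f, real_inner_comm d f] at *
  nlinarith

/-- Descent of the consensus variables. Here `Z = ẑ - z*`, `Zg = z_g - z*`, `m`, `s` are the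
projections of the corresponding vectors, and `Z'`, `m'` are the next iterates. -/
theorem consensus_descent {Z Z' Zg m m' s : E} {ϰ ϖ iν u χ : ℝ} (hϰ : 0 < ϰ) (hϖ : 0 ≤ ϖ)
    (hu : 0 < u) (hu1 : u ≤ 1) (hχ : χ = u⁻¹) (hs : 4 * (ϰ * ϖ) ≤ 1)
    (hZ : Z' = Z + (ϰ * ϖ) • (Zg - Z - m) - (ϰ * iν) • s)
    (hm : ‖m'‖ ^ 2 ≤ (1 - u) * ‖(ϰ * iν) • s + m‖ ^ 2) :
    1 / ϰ * (‖Z'‖ ^ 2 + ‖m'‖ ^ 2) ≤ (1 / ϰ - ϖ / 2) * ‖Z‖ ^ 2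
      + (1 / ϰ * (1 - u / 4) + 3 * ϖ) * ‖m‖ ^ 2 - 2 * iν * inner ℝ s (Z + m) + ϖ * ‖Zg‖ ^ 2
      + 16 / 3 * χ * ϰ * iν ^ 2 * ‖s‖ ^ 2 := by
  have hZ1 : 1 / ϰ * ‖Z'‖ ^ 2 = 1 / ϰ * ‖Z‖ ^ 2
      + 2 * inner ℝ Z (ϖ • (Zg - Z - m) - iν • s) + ϰ * ‖ϖ • (Zg - Z - m) - iν • s‖ ^ 2 := by
    have : Z' = Z + ϰ • (ϖ • (Zg - Z - m) - iν • s) := by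
      rw [hZ]; module
    rw [this, norm_add_sq_real, norm_smul, inner_smul_right, Real.norm_eq_abs, abs_of_pos hϰ]
    field_simp
  have hZ2 : ‖ϖ • (Zg - Z - m) - iν • s‖ ^ 2
      ≤ 4 * ϖ ^ 2 * (‖Zg - Z‖ ^ 2 + ‖m‖ ^ 2) + 2 * iν ^ 2 * ‖s‖ ^ 2 := by
    have a1 := norm_sub_sq_le_two_mul (ϖ • (Zg - Z - m)) (iν • s)
    have a2 := norm_sub_sq_le_two_mul (Zg - Z) m
    rw [norm_smul, norm_smul, mul_pow, mul_pow, Real.norm_eq_abs, Real.norm_eq_abs, sq_abs,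
      sq_abs] at a1
    nlinarith [sq_nonneg ϖ]
  have hZ3 : ϰ * (4 * ϖ ^ 2 * (‖Zg - Z‖ ^ 2 + ‖m‖ ^ 2)) ≤ ϖ * (‖Zg - Z‖ ^ 2 + ‖m‖ ^ 2) := by
    have : ϰ * (4 * ϖ ^ 2 * (‖Zg - Z‖ ^ 2 + ‖m‖ ^ 2))
        = (4 * (ϰ * ϖ)) * (ϖ * (‖Zg - Z‖ ^ 2 + ‖m‖ ^ 2)) := by ring
    rw [this]
    exact mul_le_of_le_one_left (by positivity) hs
  have hZ4 := mul_le_mul_of_nonneg_left hZ2 hϰ.le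
  have hcross : 0 ≤ ϖ * ‖Z + (2 : ℝ) • m‖ ^ 2 := by positivity
  have hm1 : 1 / ϰ * ‖m'‖ ^ 2 ≤ (1 - u) * (1 / ϰ * ‖m‖ ^ 2 + 2 * iν * inner ℝ s m
      + ϰ * iν ^ 2 * ‖s‖ ^ 2) := by
    have := mul_le_mul_of_nonneg_left hm (by positivity : 0 ≤ 1 / ϰ)
    refine this.trans (le_of_eq ?_)
    rw [norm_add_sq_real, norm_smul, inner_smul_left, mul_pow, Real.norm_eq_abs, sq_abs]
    simp only [conj_trivial]
    field_simp
    ring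
  -- The m-part carries the coupling with factor 1 - u while the conclusion wants -1, a discrepancy
  -- of 2 - u. Paying for it with three quarters of the contraction u of m leaves the factor 1 -
  -- u/4.
  have hyoung : (2 - u) * (2 * iν * inner ℝ s m)
      ≤ 3 / 4 * u * (1 / ϰ * ‖m‖ ^ 2) + 4 / 3 * (2 - u) ^ 2 * χ * ϰ * iν ^ 2 * ‖s‖ ^ 2 := by
    have hc : 0 < 3 / 4 * u / ϰ := by positivity
    have := two_mul_inner_le (3 / 4 * u / ϰ) hc m (((2 - u) * iν) • s)
    rw [inner_smul_right, norm_smul, mul_pow, Real.norm_eq_abs, sq_abs, real_inner_comm] at this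
    have e : (3 / 4 * u / ϰ)⁻¹ = 4 / 3 * χ * ϰ := by rw [hχ]; field_simp
    rw [e] at this
    refine le_trans (le_of_eq (by ring)) (this.trans (le_of_eq ?_))
    ring
  have hfin : (4 / 3 * (2 - u) ^ 2 * χ + (1 - u) + 2) * (ϰ * iν ^ 2 * ‖s‖ ^ 2)
      ≤ 16 / 3 * χ * (ϰ * iν ^ 2 * ‖s‖ ^ 2) := by
    refine mul_le_mul_of_nonneg_right ?_ (by positivity)
    have hχu : χ * u = 1 := by rw [hχ]; field_simp
    have hχ1 : 1 ≤ χ := by rw [hχ]; exact (one_le_inv₀ hu).2 hu1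
    nlinarith
  have e5 : inner ℝ Z (ϖ • (Zg - Z - m) - iν • s)
      = ϖ * (inner ℝ Z Zg - ‖Z‖ ^ 2 - inner ℝ Z m) - iν * inner ℝ s Z := by
    rw [inner_sub_right, inner_smul_right, inner_smul_right, inner_sub_right, inner_sub_right,
      real_inner_self_eq_norm_sq, real_inner_comm s Z]
  have e6 : ‖Zg - Z‖ ^ 2 = ‖Zg‖ ^ 2 - 2 * inner ℝ Z Zg + ‖Z‖ ^ 2 := by
    rw [norm_sub_sq_real, real_inner_comm Z Zg]
  have e7 : ‖Z + (2 : ℝ) • m‖ ^ 2 = ‖Z‖ ^ 2 + 4 * inner ℝ Z m + 4 * ‖m‖ ^ 2 := by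
    rw [norm_add_sq_real, norm_smul, inner_smul_right]
    norm_num
    ring
  rw [e5] at hZ1
  rw [e6] at hZ3 hZ4
  rw [e7] at hcross
  rw [inner_add_right]
  linarith

/-- Descent of `y_f + z_f`; `Ws`, `Ps` are the images of `s` under the gossip matrix and under the
projection. -/
theorem sum_descent {s Ws Ps d : E} {u ϑ : ℝ} (hW : ‖Ws‖ ^ 2 + u * ‖Ps‖ ^ 2 ≤ 2 * inner ℝ Ws s) :
    ‖s - (1 / 2 : ℝ) • Ws + ϑ • d‖ ^ 2
      ≤ ‖s‖ ^ 2 - u / 2 * ‖Ps‖ ^ 2 + 2 * ϑ * inner ℝ s d + 2 * ϑ ^ 2 * ‖d‖ ^ 2 := by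
  have h1 : 0 ≤ ‖(1 / 2 : ℝ) • Ws + ϑ • d‖ ^ 2 := by positivity
  simp only [← real_inner_self_eq_norm_sq, inner_smul_left, inner_smul_right, inner_sub_left,
    inner_sub_right, inner_add_left, inner_add_right, conj_trivial] at *
  simp only [real_inner_comm s Ws, real_inner_comm s d, real_inner_comm d Ws] at *
  linarith

/-- Polarise ⟨s, s - sf⟩ and drop ‖s - sf‖². This is how the momentum in y and z turns the coupling
into a decrease of the term of y_f + z_f. -/
theorem sum_averaging {s sf v : E} {κ : ℝ} (hκ0 : 0 ≤ κ) (hv : v = s + κ • (s - sf)) :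
    -2 * inner ℝ s v ≤ -(2 + κ) * ‖s‖ ^ 2 + κ * ‖sf‖ ^ 2 := by
  have h1 : 0 ≤ κ * ‖s - sf‖ ^ 2 := by positivity
  rw [hv]
  simp only [← real_inner_self_eq_norm_sq, inner_smul_right, inner_sub_left,
    inner_sub_right, inner_add_right] at *
  simp only [real_inner_comm s sf] at *
  linarith

end DescentSteps

/-! ### Gossip matrices on stacked vectors and the projection onto 𝓛^⊥ -/

section Gossip

variable {n d : ℕ}

/-- `consensusPerp` as a submodule. -/
def perpSubmodule (n d : ℕ) : Submodule ℝ (Stack n d) where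
  carrier := consensusPerp n d
  add_mem' {a b} ha hb := by
    simp only [consensusPerp, Set.mem_ofPred_eq] at *
    simp [Finset.sum_add_distrib, ha, hb]
  zero_mem' := by simp [consensusPerp]
  smul_mem' c a ha := by
    simp only [consensusPerp, Set.mem_ofPred_eq] at *
    simp [← Finset.smul_sum, ha]

theorem mem_perpSubmodule {z : Stack n d} : z ∈ perpSubmodule n d ↔ ∑ i, z i = 0 := Iff.rfl

theorem inner_eq_zero_of_consensus {x z : Stack n d} (hx : x ∈ consensus n d)
    (hz : z ∈ perpSubmodule n d) : inner ℝ x z = 0 := by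
  rcases n.eq_zero_or_pos with rfl | hn
  · simp [PiLp.inner_apply]
  · rw [PiLp.inner_apply]
    have : ∀ i, inner ℝ (x i) (z i) = inner ℝ (x ⟨0, hn⟩) (z i) := fun i => by rw [hx i ⟨0, hn⟩]
    simp only [this]
    rw [← inner_sum, mem_perpSubmodule.1 hz, inner_zero_right]

theorem starProjection_consensus {x : Stack n d} (hx : x ∈ consensus n d) :
    (perpSubmodule n d).starProjection x = 0 := by
  rw [Submodule.starProjection_apply_eq_zero_iff, Submodule.mem_orthogonal]
  intro u hu
  rw [real_inner_comm]
  exact inner_eq_zero_of_consensus hx hu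

theorem gossipMul_apply (W : Matrix (Fin n) (Fin n) ℝ) (x : Stack n d) (i : Fin n) :
    gossipMul W x i = ∑ j, W i j • x j := rfl

theorem gossipMul_add (W : Matrix (Fin n) (Fin n) ℝ) (x y : Stack n d) :
    gossipMul W (x + y) = gossipMul W x + gossipMul W y := by
  ext i c
  simp [gossipMul_apply, Finset.sum_add_distrib]

theorem gossipMul_smul (W : Matrix (Fin n) (Fin n) ℝ) (a : ℝ) (x : Stack n d) :
    gossipMul W (a • x) = a • gossipMul W x := by
  ext i c
  simp [gossipMul_apply, Finset.mul_sum, mul_left_comm]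

theorem gossipMul_apply_apply (W : Matrix (Fin n) (Fin n) ℝ) (x : Stack n d) (i : Fin n)
    (c : Fin d) : gossipMul W x i c = W.mulVec (fun j => x j c) i := by
  simp [gossipMul_apply, Matrix.mulVec, dotProduct]

theorem norm_sq_stack (x : Stack n d) : ‖x‖ ^ 2 = ∑ i, ∑ c, x i c ^ 2 := by
  rw [PiLp.norm_sq_eq_of_L2]
  simp [EuclideanSpace.norm_sq_eq]

section

variable {𝒢 : ℕ → SimpleGraph (Fin n)} {W : ℕ → Matrix (Fin n) (Fin n) ℝ} {χ : ℝ}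

theorem IsGossip.symm (h : IsGossip 𝒢 W χ) (q : ℕ) (i j : Fin n) : W q i j = W q j i := by
  have := (h.posSemidef q).isHermitian.apply i j
  simpa using this.symm

/-- The all-ones vector is in the kernel, so rows sum to zero, and by symmetry so do columns. -/
theorem IsGossip.gossipMul_mem (h : IsGossip 𝒢 W χ) (q : ℕ) (x : Stack n d) :
    gossipMul (W q) x ∈ perpSubmodule n d := by
  rw [mem_perpSubmodule]
  simp only [gossipMul_apply]
  rw [Finset.sum_comm]
  refine Finset.sum_eq_zero fun j _ => ?_
  rw [← Finset.sum_smul]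
  have h1 := congrFun ((h.ker q fun _ => 1).2 fun _ _ => rfl) j
  simp only [Matrix.mulVec, dotProduct, mul_one, Pi.zero_apply] at h1
  simp only [h.symm q _ j, h1, zero_smul]

theorem IsGossip.gossipMul_consensus (h : IsGossip 𝒢 W χ) (q : ℕ) {x : Stack n d}
    (hx : x ∈ consensus n d) : gossipMul (W q) x = 0 := by
  ext i c
  rw [gossipMul_apply_apply, (h.ker q _).2 fun i j => by rw [hx i j]]
  rfl

theorem IsGossip.inner_gossipMul (h : IsGossip 𝒢 W χ) (q : ℕ) (x y : Stack n d) :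
    inner ℝ (gossipMul (W q) x) y = inner ℝ x (gossipMul (W q) y) := by
  rw [PiLp.inner_apply, PiLp.inner_apply]
  simp only [gossipMul_apply, sum_inner, inner_sum, inner_smul_left, inner_smul_right,
    conj_trivial]
  rw [Finset.sum_comm]
  refine Finset.sum_congr rfl fun i _ => Finset.sum_congr rfl fun j _ => ?_
  rw [h.symm]

theorem IsGossip.gossipMul_starProjection (h : IsGossip 𝒢 W χ) (q : ℕ) (x : Stack n d) :
    gossipMul (W q) ((perpSubmodule n d).starProjection x) = gossipMul (W q) x := by
  set K := perpSubmodule n d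
  have h0 : gossipMul (W q) (x - K.starProjection x) = 0 := by
    rw [← inner_self_eq_zero (𝕜 := ℝ), h.inner_gossipMul]
    have := K.sub_starProjection_mem_orthogonal x
    rw [Submodule.mem_orthogonal'] at this
    exact this _ (h.gossipMul_mem q _)
  have h1 : x = K.starProjection x + (x - K.starProjection x) := by abel
  conv_rhs => rw [h1, gossipMul_add, h0, add_zero]

theorem IsGossip.norm_gossipMul_sub_sq_le (h : IsGossip 𝒢 W χ) (q : ℕ) {v : Stack n d}
    (hv : v ∈ perpSubmodule n d) : ‖gossipMul (W q) v - v‖ ^ 2 ≤ (1 - χ⁻¹) * ‖v‖ ^ 2 := by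
  rw [norm_sq_stack, norm_sq_stack, Finset.sum_comm, Finset.sum_comm (s := Finset.univ (α := Fin n)),
    Finset.mul_sum]
  refine Finset.sum_le_sum fun c _ => ?_
  have hs : ∑ i, v i c = 0 := by
    have := congrArg (fun w : EuclideanSpace ℝ (Fin d) => w c) (mem_perpSubmodule.1 hv)
    simpa using this
  have := h.contract q (fun i => v i c) hs
  simpa [gossipMul_apply_apply] using this

/-- Expand the contraction bound at the projection of s. The image of the gossip matrix lies in 𝓛^⊥,
so pairing it with s or with its projection gives the same number. -/
theorem IsGossip.norm_sq_add_le (h : IsGossip 𝒢 W χ) (q : ℕ) (s : Stack n d) :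
    ‖gossipMul (W q) s‖ ^ 2 + χ⁻¹ * ‖(perpSubmodule n d).starProjection s‖ ^ 2
      ≤ 2 * inner ℝ (gossipMul (W q) s) s := by
  set K := perpSubmodule n d
  have h1 := h.norm_gossipMul_sub_sq_le q (K.starProjection_apply_mem s)
  rw [h.gossipMul_starProjection, norm_sub_sq_real] at h1
  have h2 : inner ℝ (gossipMul (W q) s) (K.starProjection s)
      = inner ℝ (gossipMul (W q) s) s := by
    rw [← K.inner_starProjection_left_eq_right, K.starProjection_eq_self_iff.2 (h.gossipMul_mem q s)]
  rw [h2] at h1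
  linarith

end

end Gossip

/-! ### Adding up the descent inequalities -/

section Potential

/-- The scalar inequality behind one step of SADOM, before the noise is estimated. -/
theorem potential_combine
    {X X' φf φf' φg G Dx Yy Y' Yf Yf' Ya Dy Z Z' M M' Zg S PS Sf Sf' p2 r2 Iyx Irx Isw Isd Isz : ℝ}
    {cη α c2 iθ β cf cz ϖ cs iν u ϑ μ kx cp κ : ℝ}
    (hP : (cη + α) * X' + c2 * φf' ≤ cη * X + (c2 - 1) * φf - φg + (α - μ / 2) * G
      + (-kx) * Dx + 2 * Iyx - 2 * Irx)
    (hD : (iθ + β) * Y' ≤ iθ * Yy + 2 * β * p2 + 2 * β * r2 - 2 * iν * (Isw + Isd)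
      - 2 * Iyx - iθ * Dy)
    (hA : 1 / ϑ * Yf' - κ * Yf + 1 / 2 * Ya - ϑ * Dy ≤ Y')
    (hC : cz * (Z' + M') ≤ (cz - ϖ / 2) * Z + (cz * (1 - u / 4) + 3 * ϖ) * M - 2 * iν * Isz
      + ϖ * Zg + cp * PS)
    (hS : Sf' ≤ S - u / 2 * PS + 2 * ϑ * Isd + 2 * ϑ ^ 2 * Dy)
    (hV : -2 * (Isw + Isz) ≤ -(2 + κ) * S + κ * Sf)
    (hp : 2 * β * p2 ≤ φg) (hZg : Zg ≤ 2 * S + 2 * Ya)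
    (hβ : 0 ≤ β) (hiν : 0 ≤ iν) (hϖ : 0 ≤ ϖ) (hϑ : 0 < ϑ) (hκ : κ = 1 / ϑ - 1 / 2)
    (hcf : cf = β / 2 * (1 / ϑ)) (hcs : cs = iν * (1 / ϑ))
    (hSn : 0 ≤ S) (hYa : 0 ≤ Ya) (hDy : 0 ≤ Dy) (hPS : 0 ≤ PS) (hG : 0 ≤ G)
    (k1 : 2 * ϖ ≤ 3 / 2 * iν) (k2 : 2 * ϖ ≤ β / 4) (k3 : 2 * iν * ϑ + β / 2 * ϑ ≤ iθ)
    (k4 : cp ≤ cs * (u / 2)) (k5 : α ≤ μ / 2) :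
    (cη + α) * X' + c2 * φf' + (iθ + β / 2) * Y' + cf * Yf' + cz * (Z' + M') + cs * Sf'
      ≤ cη * X + (c2 - 1) * φf + iθ * Yy + (cf - β / 4) * Yf + (cz - ϖ / 2) * Z
        + (cz * (1 - u / 4) + 3 * ϖ) * M + (cs - iν / 2) * Sf - kx * Dx - 2 * Irx
        + 2 * β * r2 := by
  have a1 := mul_le_mul_of_nonneg_left hA (by positivity : 0 ≤ β / 2)
  have a2 := mul_le_mul_of_nonneg_left hS (by positivity : 0 ≤ iν * (1 / ϑ))
  have a3 := mul_le_mul_of_nonneg_left hV hiν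
  have a4 := mul_le_mul_of_nonneg_left hZg hϖ
  have a5 := mul_le_mul_of_nonneg_right k1 hSn
  have a6 := mul_le_mul_of_nonneg_right k2 hYa
  have a7 := mul_le_mul_of_nonneg_right k3 hDy
  have a8 := mul_le_mul_of_nonneg_right k4 hPS
  have a9 := mul_le_mul_of_nonneg_right k5 hG
  have e1 : iν * (1 / ϑ) * (S - u / 2 * PS + 2 * ϑ * Isd + 2 * ϑ ^ 2 * Dy)
      = cs * S - cs * (u / 2) * PS + 2 * iν * Isd + 2 * iν * ϑ * Dy := by
    rw [hcs]; field_simp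
  have e2 : β / 2 * (1 / ϑ * Yf' - κ * Yf + 1 / 2 * Ya - ϑ * Dy)
      = cf * Yf' - (cf - β / 4) * Yf + β / 4 * Ya - β / 2 * ϑ * Dy := by
    rw [hcf, hκ]; ring
  have e3 : iν * (-(2 + κ) * S + κ * Sf)
      = -(cs + 3 / 2 * iν) * S + (cs - iν / 2) * Sf := by
    rw [hcs, hκ]; ring
  rw [e1, ← hcs] at a2
  rw [e2] at a1
  rw [e3] at a3
  linarith

-- Regularity on S, the potential, and the parameters

end Potential

section Step

variable {n d : ℕ}

/-- `H` is `μ`-strongly convex, and on `S` it behaves as a globally `ℓ`-smooth convex function. -/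
structure IsRegularOn (H : Stack n d → ℝ) (S : Set (Stack n d)) (μ ℓ : ℝ) : Prop where
  strong : ∀ u v, H v + inner ℝ (gradient H v) (u - v) + μ / 2 * ‖u - v‖ ^ 2 ≤ H u
  upper : ∀ u ∈ S, ∀ v ∈ S,
    H u ≤ H v + inner ℝ (gradient H v) (u - v) + ℓ / 2 * ‖u - v‖ ^ 2
  cocoercive : ∀ u ∈ S, ∀ v ∈ S, ‖gradient H u - gradient H v‖ ^ 2 ≤ 2 * ℓ * bregman H u v

/-- The Bregman divergence of `H - (μ/4)‖·‖²`. -/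
noncomputable def reducedBregman (μ : ℝ) (H : Stack n d → ℝ) (xs u : Stack n d) : ℝ :=
  bregman H u xs - μ / 4 * ‖u - xs‖ ^ 2

/-- The gradient of `reducedBregman μ H xs`. -/
noncomputable def reducedGrad (μ : ℝ) (H : Stack n d → ℝ) (xs u : Stack n d) : Stack n d :=
  gradient H u - gradient H xs - (μ / 2) • (u - xs)

section

variable {H : Stack n d → ℝ} {S : Set (Stack n d)} {μ ℓ : ℝ}

theorem IsRegularOn.reducedBregman_ge (h : IsRegularOn H S μ ℓ) (xs u : Stack n d) :
    μ / 4 * ‖u - xs‖ ^ 2 ≤ reducedBregman μ H xs u := by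
  have := h.strong u xs
  unfold reducedBregman bregman
  linarith

theorem IsRegularOn.reducedBregman_upper (h : IsRegularOn H S μ ℓ) (hμ : 0 ≤ μ)
    (xs : Stack n d) {u v : Stack n d} (hu : u ∈ S) (hv : v ∈ S) :
    reducedBregman μ H xs u ≤ reducedBregman μ H xs v + inner ℝ (reducedGrad μ H xs v) (u - v)
      + ℓ / 2 * ‖u - v‖ ^ 2 := by
  have h1 := h.upper u hu v hv
  have h2 : 0 ≤ μ * ‖u - v‖ ^ 2 := by positivity
  have e1 : u - xs = (u - v) + (v - xs) := by abel
  unfold reducedBregman reducedGrad bregman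
  rw [e1]
  generalize u - v = a at *
  generalize v - xs = c at *
  rw [norm_add_sq_real, inner_sub_left, inner_sub_left, inner_smul_left, inner_add_right,
    real_inner_comm a c]
  simp only [conj_trivial]
  linarith

theorem IsRegularOn.reducedBregman_add_inner_le (h : IsRegularOn H S μ ℓ) (hμ : 0 ≤ μ)
    (xs u v : Stack n d) :
    reducedBregman μ H xs v + inner ℝ (reducedGrad μ H xs v) (u - v)
      ≤ reducedBregman μ H xs u := by
  have h1 := h.strong u v
  have h2 : 0 ≤ μ * ‖u - v‖ ^ 2 := by positivity
  have e1 : u - xs = (u - v) + (v - xs) := by abel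
  unfold reducedBregman reducedGrad bregman
  rw [e1]
  generalize u - v = a at *
  generalize v - xs = c at *
  rw [norm_add_sq_real, inner_sub_left, inner_sub_left, inner_smul_left, inner_add_right,
    real_inner_comm a c]
  simp only [conj_trivial]
  linarith

theorem IsRegularOn.reducedBregman_add_sq_le (h : IsRegularOn H S μ ℓ) (xs v : Stack n d) :
    reducedBregman μ H xs v + μ / 4 * ‖v - xs‖ ^ 2
      ≤ inner ℝ (reducedGrad μ H xs v) (v - xs) := by
  have h1 := h.strong xs v
  rw [← neg_sub v xs, inner_neg_right, norm_neg] at h1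
  unfold reducedBregman reducedGrad bregman
  rw [inner_sub_left, inner_sub_left, inner_smul_left, real_inner_self_eq_norm_sq]
  simp only [conj_trivial]
  linarith

/-- Strong monotonicity makes the shift by (μ/2)(v - xs) harmless, leaving 2ℓ times the full Bregman
divergence. By strong convexity the reduced divergence is at least half of the full one, which turns
2ℓ into 4ℓ. -/
theorem IsRegularOn.norm_reducedGrad_sq_le (h : IsRegularOn H S μ ℓ) (hμ : 0 < μ) (hℓ : 0 ≤ ℓ)
    {xs v : Stack n d} (hx : xs ∈ S) (hv : v ∈ S) :
    ‖reducedGrad μ H xs v‖ ^ 2 ≤ 4 * ℓ * reducedBregman μ H xs v := by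
  have h1 := h.cocoercive v hv xs hx
  have h2 := h.strong xs v
  have h3 := h.reducedBregman_ge xs v
  have h4 := mul_le_mul_of_nonneg_left h3 hℓ
  have h5 := h.strong v xs
  rw [← neg_sub v xs, inner_neg_right, norm_neg] at h2
  have e1 : inner ℝ (gradient H v - gradient H xs) (v - xs)
      = inner ℝ (gradient H v) (v - xs) - inner ℝ (gradient H xs) (v - xs) := inner_sub_left _ _ _
  have h6 : 0 ≤ μ * (inner ℝ (gradient H v - gradient H xs) (v - xs)
      - μ * ‖v - xs‖ ^ 2) := mul_nonneg hμ.le (by rw [e1]; linarith)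
  have h7 : 0 ≤ μ ^ 2 * ‖v - xs‖ ^ 2 := by positivity
  unfold reducedGrad
  unfold reducedBregman at h4 ⊢
  rw [norm_sub_sq_real, norm_smul, inner_smul_right, mul_pow, Real.norm_eq_abs, sq_abs]
  nlinarith

end

/-- The potential of SADOM; `t = √(β μ)`, `τ = τ₂`. -/
noncomputable def potential (μ χ t τ : ℝ) (H : Stack n d → ℝ) (xs : Stack n d) (T : Iterates n d) (k : ℕ) : ℝ :=
  (3 * μ / τ + μ / 8) * ‖T.x k - xs‖ ^ 2 + 2 / τ * reducedBregman μ H xs (T.xf k)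
    + (t / (2 * χ * μ) + t ^ 2 / μ / 2) * ‖T.y k - (gradient H xs - (μ / 2) • xs)‖ ^ 2
    + 8 * χ * t / μ * ‖T.yf k - (gradient H xs - (μ / 2) • xs)‖ ^ 2
    + 7 * t * χ / (4 * μ) * (‖T.z k - (perpSubmodule n d).starProjection (T.m k)
        + gradient H xs‖ ^ 2 + ‖(perpSubmodule n d).starProjection (T.m k)‖ ^ 2)
    + 32 * χ / (μ * t) * ‖T.yf k + T.zf k + (μ / 2) • xs‖ ^ 2

theorem potential_ge {H : Stack n d → ℝ} {μ χ t τ : ℝ} (hμ : 0 < μ) (hχ : 1 ≤ χ) (ht : 0 < t)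
    (xs : Stack n d) (T : Iterates n d) (k : ℕ) :
    3 * μ / τ * ‖T.x k - xs‖ ^ 2 + 2 / τ * reducedBregman μ H xs (T.xf k)
      ≤ potential μ χ t τ H xs T k := by
  unfold potential
  have : 0 ≤ μ / 8 * ‖T.x k - xs‖ ^ 2
    + (t / (2 * χ * μ) + t ^ 2 / μ / 2) * ‖T.y k - (gradient H xs - (μ / 2) • xs)‖ ^ 2
    + 8 * χ * t / μ * ‖T.yf k - (gradient H xs - (μ / 2) • xs)‖ ^ 2
    + 7 * t * χ / (4 * μ) * (‖T.z k - (perpSubmodule n d).starProjection (T.m k)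
        + gradient H xs‖ ^ 2 + ‖(perpSubmodule n d).starProjection (T.m k)‖ ^ 2)
    + 32 * χ / (μ * t) * ‖T.yf k + T.zf k + (μ / 2) • xs‖ ^ 2 := by positivity
  linarith

theorem IsRegularOn.potential_nonneg {H : Stack n d → ℝ} {S : Set (Stack n d)} {μ ℓ χ t τ : ℝ}
    (h : IsRegularOn H S μ ℓ) (hμ : 0 < μ) (hχ : 1 ≤ χ) (ht : 0 < t) (hτ : 0 < τ)
    (xs : Stack n d) (T : Iterates n d) (k : ℕ) : 0 ≤ potential μ χ t τ H xs T k := by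
  refine le_trans ?_ (potential_ge hμ hχ ht xs T k)
  have h1 := h.reducedBregman_ge xs (T.xf k)
  have h2 : 0 ≤ μ / 4 * ‖T.xf k - xs‖ ^ 2 := by positivity
  have h3 : 0 ≤ reducedBregman μ H xs (T.xf k) := h2.trans h1
  positivity

/-- The weights τ₁ and ϑ₁ are such that the averaged point g, solved back for x, gives an
extrapolation with coefficient 1/σ - 1/2, the κ of the descent inequalities. -/
theorem extrapolate_eq {E : Type*} [AddCommGroup E] [Module ℝ E] {σ : ℝ} (hσ : 0 < σ)
    {x f g : E} (hg : g = (1 / σ + 1 / 2)⁻¹ • x + (1 - (1 / σ + 1 / 2)⁻¹) • f) :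
    x = g + (1 / σ - 1 / 2) • (g - f) := by
  have h : (1 / σ + 1 / 2) ≠ 0 := by positivity
  have h1 : (1 / σ + 1 / 2) • g = x + (1 / σ + 1 / 2 - 1) • f := by
    rw [hg, smul_add, smul_smul, smul_smul, mul_inv_cancel₀ h, one_smul, mul_sub,
      mul_inv_cancel₀ h, mul_one]
  linear_combination (norm := module) (-1 : ℝ) • h1

section

variable {𝒢 : ℕ → SimpleGraph (Fin n)} {W : ℕ → Matrix (Fin n) (Fin n) ℝ} {p : Params}
  {g : ℕ → Stack n d → Stack n d} {x0 y0 z0 m0 : Stack n d} {T : Iterates n d} {χ : ℝ}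

theorem IsSADOM.mem_perp (h : IsSADOM p W g x0 y0 z0 m0 T) (hW : IsGossip 𝒢 W χ)
    (hz : z0 ∈ consensusPerp n d) (k : ℕ) :
    T.z k ∈ perpSubmodule n d ∧ T.zf k ∈ perpSubmodule n d := by
  set K := perpSubmodule n d
  induction k with
  | zero => rw [h.z_zero, h.zf_zero]; exact ⟨hz, hz⟩
  | succ k ih =>
    have hg : T.zg k ∈ K := by
      rw [h.zg_eq]
      exact K.add_mem (K.smul_mem _ ih.1) (K.smul_mem _ ih.2)
    constructor
    · rw [h.z_succ]
      exact K.sub_mem (K.add_mem ih.1 (K.smul_mem _ (K.sub_mem hg ih.1))) (hW.gossipMul_mem _ _)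
    · rw [h.zf_succ]
      exact K.sub_mem hg (K.smul_mem _ (hW.gossipMul_mem _ _))

end

/-- With β = t²/μ and L = μ/τ² the square roots disappear, and τ² = 2t² encodes 2βL = 1. Then 1/β +
L = 3μ/τ², which gives η = τ/(3μ). -/
theorem sadomParams_fields {μ χ t τ L : ℝ} (hμ : 0 < μ) (hχ : 1 ≤ χ) (ht : 0 < t)
    (hτ : 0 < τ) (hτt : τ ^ 2 = 2 * t ^ 2) (hL : L = μ / τ ^ 2) :
    sadomParams μ χ L (t ^ 2 / μ) =
    { τ₁ := (1 / τ + 1 / 2)⁻¹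
      τ₂ := τ
      η := τ / (3 * μ)
      α := μ / 4
      β := t ^ 2 / μ
      ϑ₁ := (1 / (t / (16 * χ)) + 1 / 2)⁻¹
      ϑ₂ := t / (16 * χ)
      θ := 2 * χ * μ / t
      ν := μ / 2
      ϰ := 4 * μ / (7 * t * χ)
      ϖ := t ^ 2 / (16 * μ)
      ζ := 1 / 2 } := by
  have e1 : √(μ / L) = τ := by
    rw [hL, div_div_cancel₀ hμ.ne', Real.sqrt_sq hτ.le]
  have e2 : √(t ^ 2 / μ * μ) = t := by
    rw [div_mul_cancel₀ _ hμ.ne', Real.sqrt_sq ht.le]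
  have hχ0 : 0 < χ := by linarith
  unfold sadomParams
  simp only [e1, e2, Params.mk.injEq, true_and]
  refine ⟨?_, ?_, ?_, ?_, trivial⟩
  · rw [hL, hτt]
    field_simp
    rw [hτt]
    field_simp
    norm_num
  · field_simp
    norm_num
  · field_simp
    norm_num
  · field_simp

end Step

/-! ### Absorbing the noise and comparing coefficients -/

section Scalars

/-- The bias is paid for with (μ/8)‖A + d‖², half of the gain α = μ/4 of the primal step; the
pairing of v with the increment d is paid for by -(2μ/τ)‖d‖². The only linear term left pairs v with
A = x^k - x*, which does not involve the samples of step k. -/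
theorem noise_absorb {E : Type*} [NormedAddCommGroup E] [InnerProductSpace ℝ E] {μ t τ : ℝ}
    {A d b v : E} (hμ : 0 < μ) (ht : 0 < t) (ht1 : t ≤ 1 / 2) (hτ : 0 < τ) (hτ1 : τ ≤ 1)
    (hτt : τ ^ 2 = 2 * t ^ 2) :
    -(2 * μ / τ) * ‖d‖ ^ 2 - 2 * inner ℝ (b + v) (A + d) + 2 * (t ^ 2 / μ) * ‖b + v‖ ^ 2
      ≤ μ / 8 * ‖A + d‖ ^ 2 - 2 * inner ℝ v A + 5 * (t ^ 2 / μ) / τ * ‖v‖ ^ 2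
        + 12 / μ * ‖b‖ ^ 2 := by
  have h1 := two_mul_inner_le (μ / 8) (by positivity) (A + d) (-b)
  have h2 := two_mul_inner_le (2 * μ / τ) (by positivity) d (-v)
  have h3 := norm_add_sq_le_two_mul b v
  have h4 := mul_le_mul_of_nonneg_left h3 (by positivity : 0 ≤ 2 * (t ^ 2 / μ))
  have e1 : (2 * μ / τ)⁻¹ = t ^ 2 / μ / τ := by
    rw [show t ^ 2 = τ ^ 2 / 2 by linarith]
    field_simp
  have e2 : (μ / 8)⁻¹ = 8 / μ := by field_simp
  rw [inner_neg_right, norm_neg, e2] at h1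
  rw [inner_neg_right, norm_neg, e1] at h2
  have e3 : inner ℝ (b + v) (A + d) = inner ℝ (A + d) b + inner ℝ v A + inner ℝ d v := by
    rw [inner_add_left, inner_add_right v, real_inner_comm b, real_inner_comm v d]
    ring
  have h5 : 4 * (t ^ 2 / μ) * ‖b‖ ^ 2 ≤ 4 / μ * ‖b‖ ^ 2 := by
    refine mul_le_mul_of_nonneg_right ?_ (sq_nonneg _)
    rw [mul_div_assoc']
    gcongr
    nlinarith
  have h6 : 4 * (t ^ 2 / μ) * ‖v‖ ^ 2 ≤ 4 * (t ^ 2 / μ) / τ * ‖v‖ ^ 2 := by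
    refine mul_le_mul_of_nonneg_right ?_ (sq_nonneg _)
    rw [le_div_iff₀ hτ]
    exact mul_le_of_le_one_right (by positivity) hτ1
  have e4 : 5 * (t ^ 2 / μ) / τ * ‖v‖ ^ 2
      = t ^ 2 / μ / τ * ‖v‖ ^ 2 + 4 * (t ^ 2 / μ) / τ * ‖v‖ ^ 2 := by ring
  have e5 : 12 / μ * ‖b‖ ^ 2 = 8 / μ * ‖b‖ ^ 2 + 4 / μ * ‖b‖ ^ 2 := by ring
  rw [e3, e4, e5]
  linarith

/-- The comparison is made coefficient by coefficient. The relative gains for y_f, z and y_f + z_f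
are t/(32χ), t/(56χ) and t/(32χ), so a rate of t/(100χ) fits below all of them. -/
theorem potential_contract {μ χ t τ X φ Y Yf Z M Sf : ℝ} (hμ : 0 < μ) (hχ : 1 ≤ χ) (ht : 0 < t)
    (ht1 : t ≤ 1 / 2) (hτ : 0 < τ) (hτt : τ ^ 2 = 2 * t ^ 2) (hX : 0 ≤ X) (hφ : 0 ≤ φ)
    (hY : 0 ≤ Y) (hYf : 0 ≤ Yf) (hZ : 0 ≤ Z) (hM : 0 ≤ M) (hSf : 0 ≤ Sf) :
    3 * μ / τ * X + (2 / τ - 1) * φ + t / (2 * χ * μ) * Y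
      + (8 * χ * t / μ - t ^ 2 / μ / 4) * Yf
      + (7 * t * χ / (4 * μ) - t ^ 2 / (16 * μ) / 2) * Z
      + (7 * t * χ / (4 * μ) * (1 - χ⁻¹ / 4) + 3 * (t ^ 2 / (16 * μ))) * M
      + (32 * χ / (μ * t) - 2 / μ / 2) * Sf
    ≤ (1 - t / (100 * χ)) * ((3 * μ / τ + μ / 8) * X + 2 / τ * φ
      + (t / (2 * χ * μ) + t ^ 2 / μ / 2) * Y + 8 * χ * t / μ * Yf
      + 7 * t * χ / (4 * μ) * (Z + M) + 32 * χ / (μ * t) * Sf) := by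
  have hχ0 : 0 < χ := by linarith
  have htτ : t ≤ τ := by nlinarith
  have hρ0 : 0 ≤ t / (100 * χ) := by positivity
  have hρ1 : t / (100 * χ) ≤ t / 100 := by
    gcongr
    linarith
  have c1 : 3 * μ / τ ≤ (1 - t / (100 * χ)) * (3 * μ / τ + μ / 8) := by
    have h1 : t / (100 * χ) * (3 * μ / τ + μ / 8) ≤ t / 100 * (3 * μ / t + μ / 8) := by gcongr
    have h2 : t / 100 * (3 * μ / t + μ / 8) = 3 * μ / 100 + t * μ / 800 := by
      field_simp; ring
    nlinarith
  have c2 : 2 / τ - 1 ≤ (1 - t / (100 * χ)) * (2 / τ) := by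
    have h1 : t / (100 * χ) * (2 / τ) ≤ t / 100 * (2 / t) := by gcongr
    have h2 : t / 100 * (2 / t) = 2 / 100 := by field_simp
    linarith
  have c3 : t / (2 * χ * μ) ≤ (1 - t / (100 * χ)) * (t / (2 * χ * μ) + t ^ 2 / μ / 2) := by
    have h1 : t / (100 * χ) * (t / (2 * χ * μ) + t ^ 2 / μ / 2)
        ≤ t / 100 * (t / (2 * 1 * μ) + t ^ 2 / μ / 2) := by gcongr
    have h2 : t / 100 * (t / (2 * 1 * μ) + t ^ 2 / μ / 2) = (1 + t) / 100 * (t ^ 2 / μ / 2) := by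
      field_simp
    have h3 : (1 + t) / 100 * (t ^ 2 / μ / 2) ≤ t ^ 2 / μ / 2 :=
      mul_le_of_le_one_left (by positivity) (by linarith)
    linarith
  have c4 : 8 * χ * t / μ - t ^ 2 / μ / 4 ≤ (1 - t / (100 * χ)) * (8 * χ * t / μ) := by
    have h2 : t / (100 * χ) * (8 * χ * t / μ) = 8 / 25 * (t ^ 2 / μ / 4) := by
      field_simp; norm_num
    have h3 : 0 ≤ t ^ 2 / μ / 4 := by positivity
    linarith
  have c5 : 7 * t * χ / (4 * μ) - t ^ 2 / (16 * μ) / 2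
      ≤ (1 - t / (100 * χ)) * (7 * t * χ / (4 * μ)) := by
    have h2 : t / (100 * χ) * (7 * t * χ / (4 * μ)) = 14 / 25 * (t ^ 2 / (16 * μ) / 2) := by
      field_simp; norm_num
    have h3 : 0 ≤ t ^ 2 / (16 * μ) / 2 := by positivity
    linarith
  have c6 : 7 * t * χ / (4 * μ) * (1 - χ⁻¹ / 4) + 3 * (t ^ 2 / (16 * μ))
      ≤ (1 - t / (100 * χ)) * (7 * t * χ / (4 * μ)) := by
    have h2 : t / (100 * χ) * (7 * t * χ / (4 * μ)) = 7 * t / 100 * (t / (4 * μ)) := by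
      field_simp
    have h3 : 7 * t * χ / (4 * μ) * (χ⁻¹ / 4) = 7 / 4 * (t / (4 * μ)) := by
      field_simp
    have h4 : 3 * (t ^ 2 / (16 * μ)) = 3 / 4 * t * (t / (4 * μ)) := by
      field_simp; norm_num
    have h5 : 0 < t / (4 * μ) := by positivity
    nlinarith
  have c7 : 32 * χ / (μ * t) - 2 / μ / 2 ≤ (1 - t / (100 * χ)) * (32 * χ / (μ * t)) := by
    have h2 : t / (100 * χ) * (32 * χ / (μ * t)) = 8 / 25 * (2 / μ / 2) := by
      field_simp; norm_num
    have h3 : 0 ≤ 2 / μ / 2 := by positivity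
    linarith
  have d1 := mul_le_mul_of_nonneg_right c1 hX
  have d2 := mul_le_mul_of_nonneg_right c2 hφ
  have d3 := mul_le_mul_of_nonneg_right c3 hY
  have d4 := mul_le_mul_of_nonneg_right c4 hYf
  have d5 := mul_le_mul_of_nonneg_right c5 hZ
  have d6 := mul_le_mul_of_nonneg_right c6 hM
  have d7 := mul_le_mul_of_nonneg_right c7 hSf
  linarith

end Scalars

/-! ### One step of the algorithm -/

section Step

variable {n d : ℕ} {𝒢 : ℕ → SimpleGraph (Fin n)} {W : ℕ → Matrix (Fin n) (Fin n) ℝ}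
  {g : ℕ → Stack n d → Stack n d} {x0 y0 z0 m0 : Stack n d} {T : Iterates n d}

set_option maxHeartbeats 1000000 in
/-- One step of SADOM contracts the potential, up to the bias `b` and the noise `v` of the gradient
estimator. -/
theorem IsSADOM.potential_succ_le {μ χ t τ ℓ : ℝ} {H : Stack n d → ℝ} {S : Set (Stack n d)}
    {xs : Stack n d}
    (h : IsSADOM (sadomParams μ χ (μ / τ ^ 2) (t ^ 2 / μ)) W g x0 y0 z0 m0 T)
    (hW : IsGossip 𝒢 W χ) (hz : z0 ∈ consensusPerp n d)
    (hμ : 0 < μ) (hχ : 1 ≤ χ) (ht : 0 < t) (ht1 : t ≤ 1 / 2) (hτ : 0 < τ)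
    (hτt : τ ^ 2 = 2 * t ^ 2) (hℓ0 : 0 ≤ ℓ) (hℓ : 8 * (t ^ 2 / μ) * ℓ ≤ 1)
    (hreg : IsRegularOn H S μ ℓ) (hxs : xs ∈ S) (hxc : xs ∈ consensus n d)
    (hgr : gradient H xs ∈ perpSubmodule n d) (k : ℕ) (hxg : T.xg k ∈ S)
    (hxf : T.xf (k + 1) ∈ S) {b v : Stack n d}
    (hr : g k (T.xg k) = gradient H (T.xg k) + (b + v)) :
    potential μ χ t τ H xs T (k + 1) ≤ (1 - t / (100 * χ)) * potential μ χ t τ H xs T k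
      - 2 * inner ℝ v (T.x k - xs) + 5 * (t ^ 2 / μ) / τ * ‖v‖ ^ 2 + 12 / μ * ‖b‖ ^ 2 := by
  have hχ0 : 0 < χ := by linarith
  rw [sadomParams_fields hμ hχ ht hτ hτt rfl] at h
  set K := perpSubmodule n d with hK
  have hmem := h.mem_perp hW hz k
  have hxge := h.xg_eq k
  have hx1 := h.x_succ k
  have hxf1 := h.xf_succ k
  have hyge := h.yg_eq k
  have hy1 := h.y_succ k
  have hyf1 := h.yf_succ k
  have hzge := h.zg_eq k
  have hz1 := h.z_succ k
  have hm1 := h.m_succ k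
  have hzf1 := h.zf_succ k
  simp only at hxge hx1 hxf1 hyge hy1 hyf1 hzge hz1 hm1 hzf1
  rw [hr] at hx1 hy1
  have hτ1 : τ ≤ 1 := by nlinarith
  have hϑ0 : 0 < t / (16 * χ) := by positivity
  have hϑ1 : t / (16 * χ) ≤ 1 := by rw [div_le_one (by positivity)]; linarith
  have hκτ : 0 ≤ 1 / τ - 1 / 2 := by
    have : 1 ≤ 1 / τ := (one_le_div hτ).2 hτ1
    linarith
  have hκϑ : 0 ≤ 1 / (t / (16 * χ)) - 1 / 2 := by
    have : 1 ≤ 1 / (t / (16 * χ)) := (one_le_div hϑ0).2 hϑ1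
    linarith
  have hxe := extrapolate_eq hτ hxge
  have hye := extrapolate_eq hϑ0 hyge
  have hze := extrapolate_eq hϑ0 hzge
  set ys := gradient H xs - (μ / 2) • xs with hys
  set Δ := reducedGrad μ H xs (T.xg k) with hΔ
  set dx := T.x (k + 1) - T.x k with hdx
  set dy := T.y (k + 1) - T.y k with hdy
  set s := T.yg k + T.zg k + (μ / 2) • xs with hs
  set m := K.starProjection (T.m k) with hm
  have hPxs : K.starProjection xs = 0 := starProjection_consensus hxc
  have hμ0 : μ ≠ 0 := hμ.ne'
  -- the primal part
  have hX := primal_descent (A := T.x k - xs) (G := T.xg k - xs) (d := dx) (w := T.xf k - T.xg k)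
    (p := Δ) (r := b + v) (Y := T.y (k + 1) - ys) (iη := 3 * μ / τ) (α := μ / 4) (τ := τ)
    (κ := 1 / τ - 1 / 2) (L := μ / τ ^ 2) (μ := μ) (φf := reducedBregman μ H xs (T.xf k))
    (φf' := reducedBregman μ H xs (T.xf (k + 1))) (φg := reducedBregman μ H xs (T.xg k))
    hτ rfl hκτ (by positivity)
    (by linear_combination (norm := module) (1 : ℝ) • hxe)
    (by
      have e : dx = (τ / (3 * μ)) • ((μ / 4) • (T.xg k - T.x (k + 1))
          - (gradient H (T.xg k) + (b + v) - (μ / 2) • T.xg k - T.y (k + 1))) := by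
        rw [hdx]
        linear_combination (norm := module) (1 : ℝ) • hx1
      rw [e, smul_smul, show 3 * μ / τ * (τ / (3 * μ)) = 1 by field_simp, one_smul, ← e, hΔ, hdx,
        reducedGrad, hys]
      module)
    (by
      have h1 := hreg.reducedBregman_upper hμ.le xs hxf hxg
      have e : T.xf (k + 1) - T.xg k = τ • dx := by rw [hxf1]; abel
      rw [e] at h1
      refine h1.trans ?_
      gcongr
      rw [le_div_iff₀ (by positivity), hτt]
      rw [show 8 * (t ^ 2 / μ) * ℓ = 8 * t ^ 2 * ℓ / μ by ring, div_le_one hμ] at hℓ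
      nlinarith only [hℓ, mul_nonneg (sq_nonneg t) hℓ0])
    (hreg.reducedBregman_add_sq_le xs _)
    (hreg.reducedBregman_add_inner_le hμ.le xs _ _)
  -- the dual part
  have hY := dual_descent (w := T.y k - ys) (d := dy) (s := s) (X := T.x (k + 1) - xs) (p := Δ)
    (r := b + v) (iθ := t / (2 * χ * μ)) (β := t ^ 2 / μ) (iν := 2 / μ) (by positivity)
    (by
      have e : dy = (2 * χ * μ / t) • ((t ^ 2 / μ) • (gradient H (T.xg k) + (b + v)
          - (μ / 2) • T.xg k - T.y (k + 1))
          - ((μ / 2)⁻¹ • (T.yg k + T.zg k) + T.x (k + 1))) := by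
        rw [hdy]
        linear_combination (norm := module) (1 : ℝ) • hy1
      rw [e, smul_smul, show t / (2 * χ * μ) * (2 * χ * μ / t) = 1 by field_simp, one_smul, ← e,
        hΔ, hdy, reducedGrad, hys, hs, smul_add (2 / μ), smul_smul,
        show 2 / μ * (μ / 2) = 1 by field_simp, show (μ / 2)⁻¹ = 2 / μ by field_simp]
      module)
  have hA := dual_averaging (a := T.yg k - ys) (f := T.yf k - ys) (w := T.y k - ys) (d := dy)
    hϑ0 rfl hκϑ (by linear_combination (norm := module) (1 : ℝ) • hye)
  -- the consensus part
  have hWm : ∀ u, gossipMul (W k) u ∈ K := fun u => hW.gossipMul_mem k u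
  set q := (4 * μ / (7 * t * χ) * (μ / 2)⁻¹) • (T.yg k + T.zg k) + T.m k with hq
  have hPs : K.starProjection (T.yg k + T.zg k) = K.starProjection s := by
    rw [hs, map_add K.starProjection (T.yg k + T.zg k), map_smul, hPxs, smul_zero, add_zero]
  have hPq : K.starProjection q = (4 * μ / (7 * t * χ) * (2 / μ)) • K.starProjection s + m := by
    rw [hq, map_add, map_smul, hPs, show (μ / 2)⁻¹ = 2 / μ by field_simp]
  have hPm1 : K.starProjection (T.m (k + 1)) = K.starProjection q - gossipMul (W k) q := by
    rw [hm1, map_sub, K.starProjection_eq_self_iff.2 (hWm q)]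
  have hzg : T.zg k ∈ K := by
    rw [hzge]
    exact K.add_mem (K.smul_mem _ hmem.1) (K.smul_mem _ hmem.2)
  have hC := consensus_descent (Z := T.z k - m + gradient H xs)
    (Z' := T.z (k + 1) - K.starProjection (T.m (k + 1)) + gradient H xs)
    (Zg := T.zg k + gradient H xs) (m := m) (m' := K.starProjection (T.m (k + 1)))
    (s := K.starProjection s) (ϰ := 4 * μ / (7 * t * χ)) (ϖ := t ^ 2 / (16 * μ)) (iν := 2 / μ)
    (u := χ⁻¹) (χ := χ) (by positivity) (by positivity) (by positivity) (inv_le_one_of_one_le₀ hχ)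
    (inv_inv χ).symm
    (by
      rw [show 4 * (4 * μ / (7 * t * χ) * (t ^ 2 / (16 * μ))) = t / (7 * χ) by
        field_simp; norm_num,
        div_le_one (by positivity)]
      linarith only [ht1, hχ])
    (by
      -- The gossip product is subtracted both in z and in m, so it cancels in z - Pm. This
      -- corrected variable makes a step along the exact projection, and the communication error is
      -- stored in m.
      rw [hPm1, hPq, hz1]
      module)
    (by
      rw [hPm1, ← hPq, norm_sub_rev, ← hW.gossipMul_starProjection]
      exact hW.norm_gossipMul_sub_sq_le k (K.starProjection_apply_mem q))
  -- Both z^k and z* = -∇H(x*) lie in 𝓛^⊥, so the projection of s may be replaced by s and the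
  -- coupling can be matched with the one of the dual variable.
  have hzz : inner ℝ (K.starProjection s) (T.z k - m + gradient H xs + m)
      = inner ℝ s (T.z k + gradient H xs) := by
    rw [show T.z k - m + gradient H xs + m = T.z k + gradient H xs by abel,
      K.inner_starProjection_left_eq_right,
      K.starProjection_eq_self_iff.2 (K.add_mem hmem.1 hgr)]
  rw [hzz] at hC
  have hF := sum_descent (s := s) (Ws := gossipMul (W k) s) (Ps := K.starProjection s) (d := dy)
    (u := χ⁻¹) (ϑ := t / (16 * χ)) (hW.norm_sq_add_le k s)
  have hsf : s - (1 / 2 : ℝ) • gossipMul (W k) s + (t / (16 * χ)) • dy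
      = T.yf (k + 1) + T.zf (k + 1) + (μ / 2) • xs := by
    rw [hs, gossipMul_add, gossipMul_smul, hW.gossipMul_consensus k hxc, smul_zero, add_zero,
      hyf1, hzf1]
    abel
  rw [hsf] at hF
  have hV := sum_averaging (s := s) (sf := T.yf k + T.zf k + (μ / 2) • xs)
    (v := (T.y k - ys) + (T.z k + gradient H xs)) hκϑ
    (by
      rw [hys, hs]
      linear_combination (norm := module) (1 : ℝ) • hye + (1 : ℝ) • hze)
  have hZg : ‖T.zg k + gradient H xs‖ ^ 2 ≤ 2 * ‖s‖ ^ 2 + 2 * ‖T.yg k - ys‖ ^ 2 := by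
    have := norm_sub_sq_le_two_mul s (T.yg k - ys)
    rwa [show s - (T.yg k - ys) = T.zg k + gradient H xs by rw [hs, hys]; module] at this
  -- This needs β ≤ 1/(8ℓ), four times smaller than 1/(2ℓ): cocoercivity of the reduced gradient has
  -- constant 4ℓ and the dual inequality contributes a factor 2β.
  have hp : 2 * (t ^ 2 / μ) * ‖Δ‖ ^ 2 ≤ reducedBregman μ H xs (T.xg k) := by
    have h1 := hreg.norm_reducedGrad_sq_le hμ hℓ0 hxs hxg
    have h2 := mul_le_mul_of_nonneg_left h1 (by positivity : 0 ≤ 2 * (t ^ 2 / μ))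
    have h3 : 0 ≤ reducedBregman μ H xs (T.xg k) :=
      le_trans (by positivity) (hreg.reducedBregman_ge xs (T.xg k))
    have h4 := mul_le_mul_of_nonneg_right hℓ h3
    linarith only [h2, h4]
  have ex : T.x k - xs + dx = T.x (k + 1) - xs := by rw [hdx]; abel
  have ey : T.y k - ys + dy = T.y (k + 1) - ys := by rw [hdy]; abel
  have eyf : T.yg k - ys + (t / (16 * χ)) • dy = T.yf (k + 1) - ys := by rw [hyf1]; abel
  rw [ex] at hX
  have hYs : inner ℝ s (T.y k - ys + dy) = inner ℝ s (T.y k - ys) + inner ℝ s dy :=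
    inner_add_right _ _ _
  rw [hYs, ey] at hY
  rw [ey, eyf] at hA
  rw [inner_add_right] at hV
  rw [real_inner_comm (T.x (k + 1) - xs) (T.y (k + 1) - ys)] at hX
  have hfin := potential_combine (cη := 3 * μ / τ) (α := μ / 4) (c2 := 2 / τ)
    (iθ := t / (2 * χ * μ)) (β := t ^ 2 / μ) (cf := 8 * χ * t / μ) (cz := 7 * t * χ / (4 * μ))
    (ϖ := t ^ 2 / (16 * μ)) (cs := 32 * χ / (μ * t)) (iν := 2 / μ) (u := χ⁻¹)
    (ϑ := t / (16 * χ)) (μ := μ) (kx := 2 * μ / τ) (cp := 256 / (21 * t * μ))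
    (κ := 1 / (t / (16 * χ)) - 1 / 2)
    (by
      refine hX.trans (le_of_eq ?_)
      rw [show μ / τ ^ 2 * τ - 3 * μ / τ = -(2 * μ / τ) by field_simp; ring])
    hY hA
    (by
      rw [show 1 / (4 * μ / (7 * t * χ)) = 7 * t * χ / (4 * μ) by field_simp] at hC
      rw [show 16 / 3 * χ * (4 * μ / (7 * t * χ)) * (2 / μ) ^ 2 = 256 / (21 * t * μ) by
        field_simp; norm_num] at hC
      exact hC)
    hF hV hp hZg (by positivity) (by positivity) (by positivity) hϑ0 rfl
    (by field_simp; norm_num) (by field_simp; norm_num) (by positivity) (by positivity)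
    (by positivity) (by positivity) (by positivity)
    (by
      rw [show 2 * (t ^ 2 / (16 * μ)) = t ^ 2 / 8 / μ by field_simp; norm_num,
        show 3 / 2 * (2 / μ) = 3 / μ by ring]
      gcongr
      nlinarith only [ht, ht1])
    (by
      rw [show 2 * (t ^ 2 / (16 * μ)) = 1 / 2 * (t ^ 2 / μ / 4) by field_simp; norm_num]
      exact mul_le_of_le_one_left (by positivity) (by norm_num))
    (by
      rw [show 2 * (2 / μ) * (t / (16 * χ)) + t ^ 2 / μ / 2 * (t / (16 * χ))
          = (1 / 2 + t ^ 2 / 16) * (t / (2 * χ * μ)) by field_simp; ring]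
      refine mul_le_of_le_one_left (by positivity) ?_
      nlinarith only [ht, ht1])
    (by
      rw [show 32 * χ / (μ * t) * (χ⁻¹ / 2) = 16 / (t * μ) by field_simp; norm_num,
        show 256 / (21 * t * μ) = (256 / 21) / (t * μ) by field_simp]
      gcongr
      norm_num)
    (by linarith only [hμ])
  have hnoise := noise_absorb hμ ht ht1 hτ hτ1 hτt (A := T.x k - xs) (d := dx) (b := b) (v := v)
  rw [ex] at hnoise
  have hφ : 0 ≤ reducedBregman μ H xs (T.xf k) :=
    le_trans (by positivity) (hreg.reducedBregman_ge xs (T.xf k))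
  have hcon := potential_contract hμ hχ ht ht1 hτ hτt (sq_nonneg ‖T.x k - xs‖) hφ
    (sq_nonneg ‖T.y k - ys‖) (sq_nonneg ‖T.yf k - ys‖)
    (sq_nonneg ‖T.z k - m + gradient H xs‖) (sq_nonneg ‖m‖)
    (sq_nonneg ‖T.yf k + T.zf k + (μ / 2) • xs‖)
  unfold potential
  clear_value m ys
  clear_value K
  subst hK hm hys
  linarith only [hfin, hnoise, hcon]

end Step

/-! ### Bounds on the potential, optimality, and transfer to the original problem -/

section Bounds

variable {n d : ℕ}

/-- This allows enlarging the domain of integration to an event independent of the fresh samples.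
Half of the potential still controls (3μ/(2τ))‖x^k - x*‖², and Young's inequality costs only
2τ/(3μ)‖v‖², below the available 5τ/(2μ)‖v‖². -/
theorem IsRegularOn.contracted_potential_nonneg {μ χ t τ ℓ : ℝ} {H : Stack n d → ℝ}
    {S : Set (Stack n d)} (hreg : IsRegularOn H S μ ℓ) (hμ : 0 < μ) (hχ : 1 ≤ χ) (ht : 0 < t)
    (ht1 : t ≤ 1 / 2) (hτ : 0 < τ) (hτt : τ ^ 2 = 2 * t ^ 2) (xs b v : Stack n d)
    (T : Iterates n d) (k : ℕ) :
    0 ≤ (1 - t / (100 * χ)) * potential μ χ t τ H xs T k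
      - 2 * inner ℝ v (T.x k - xs) + 5 * (t ^ 2 / μ) / τ * ‖v‖ ^ 2 + 12 / μ * ‖b‖ ^ 2 := by
  have h1 := potential_ge (H := H) (τ := τ) hμ hχ ht xs T k
  have h0 : 0 ≤ 2 / τ * reducedBregman μ H xs (T.xf k) :=
    mul_nonneg (by positivity) (le_trans (by positivity) (hreg.reducedBregman_ge xs (T.xf k)))
  have h2 := hreg.potential_nonneg hμ hχ ht hτ xs T k
  have h3 := two_mul_inner_le (2 * τ / (3 * μ)) (by positivity) v (T.x k - xs)
  have hρ : t / (100 * χ) ≤ 1 / 2 := by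
    rw [div_le_iff₀ (by positivity)]; linarith
  have h4 : 1 / 2 * potential μ χ t τ H xs T k
      ≤ (1 - t / (100 * χ)) * potential μ χ t τ H xs T k :=
    mul_le_mul_of_nonneg_right (by linarith) h2
  have e1 : (2 * τ / (3 * μ))⁻¹ = 1 / 2 * (3 * μ / τ) := by field_simp
  have e2 : 5 * (t ^ 2 / μ) / τ = 5 * τ / (2 * μ) := by
    rw [show t ^ 2 = τ ^ 2 / 2 by linarith]; field_simp
  have h5 : 2 * τ / (3 * μ) * ‖v‖ ^ 2 ≤ 5 * τ / (2 * μ) * ‖v‖ ^ 2 := by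
    refine mul_le_mul_of_nonneg_right ?_ (sq_nonneg _)
    rw [div_le_div_iff₀ (by positivity) (by positivity)]
    nlinarith [mul_pos hτ hμ]
  have h6 : 0 ≤ 12 / μ * ‖b‖ ^ 2 := by positivity
  rw [e1] at h3
  rw [e2]
  linarith

theorem le_mul_potential {μ χ t τ : ℝ} {H : Stack n d → ℝ} (hμ : 0 < μ) (hχ : 1 ≤ χ) (ht : 0 < t)
    (hτ : 0 < τ) (xs : Stack n d) (T : Iterates n d) (k : ℕ) :
    μ / 2 * ‖T.x k - xs‖ ^ 2 + reducedBregman μ H xs (T.xf k)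
      ≤ τ / 2 * potential μ χ t τ H xs T k := by
  have h1 := mul_le_mul_of_nonneg_left (potential_ge (H := H) (τ := τ) hμ hχ ht xs T k)
    (by positivity : 0 ≤ τ / 2)
  have e : τ / 2 * (3 * μ / τ * ‖T.x k - xs‖ ^ 2 + 2 / τ * reducedBregman μ H xs (T.xf k))
      = 3 / 2 * μ * ‖T.x k - xs‖ ^ 2 + reducedBregman μ H xs (T.xf k) := by field_simp
  have h2 : 0 ≤ μ * ‖T.x k - xs‖ ^ 2 := by positivity
  rw [e] at h1
  linarith

/-- Multiplication by τ/2 expresses the potential in units of function values; τ ≤ 3t/2 makes every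
dual weight a multiple of χ/μ. The largest total is that of Y, namely 1 + 2 + 48 = 51. -/
theorem potential_zero_bound {μ χ t τ X R D Y Z m A P U : ℝ} (hμ : 0 < μ) (hχ : 1 ≤ χ)
    (ht : 0 < t) (ht1 : t ≤ 1 / 2) (hτ : 0 < τ) (hτt : τ ^ 2 = 2 * t ^ 2) (hX : 0 ≤ X)
    (hD : 0 ≤ D) (hR : R ≤ D) (hY : 0 ≤ Y) (hZ : 0 ≤ Z) (hm : 0 ≤ m) (hP0 : 0 ≤ P) (hP : P ≤ m)
    (hA0 : 0 ≤ A) (hA : A ≤ 2 * Z + 2 * m) (hU0 : 0 ≤ U) (hU : U ≤ 2 * Y + 2 * Z) :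
    τ / 2 * ((3 * μ / τ + μ / 8) * X + 2 / τ * R + (t / (2 * χ * μ) + t ^ 2 / μ / 2) * Y
      + 8 * χ * t / μ * Y + 7 * t * χ / (4 * μ) * (A + P) + 32 * χ / (μ * t) * U) ≤ 51 * (μ * X + D + χ / μ * (Y + Z + m)) := by
  have hχ0 : 0 < χ := by linarith
  have hτ1 : τ ≤ 1 := by nlinarith
  have hτ2 : τ ≤ 3 / 2 * t := by nlinarith
  have hQ0 : 0 < χ / μ := by positivity
  have a1 : τ / 2 * (3 * μ / τ + μ / 8) ≤ 2 * μ := by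
    have : τ / 2 * (3 * μ / τ + μ / 8) = 3 / 2 * μ + τ * μ / 16 := by field_simp; ring
    nlinarith
  have a2 : τ / 2 * (2 / τ) = 1 := by field_simp
  have a3 : τ / 2 * (t / (2 * χ * μ) + t ^ 2 / μ / 2) ≤ χ / μ := by
    have e : τ / 2 * (t / (2 * χ * μ) + t ^ 2 / μ / 2)
        ≤ 1 / 2 * (1 / (2 * 1 * μ) + 1 ^ 2 / μ / 2) := by
      gcongr <;> linarith
    have e2 : 1 / 2 * (1 / (2 * 1 * μ) + 1 ^ 2 / μ / 2) = 1 / 2 * (1 / μ) := by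
      field_simp; norm_num
    have e3 : 1 / μ ≤ χ / μ := by gcongr
    have : 0 < 1 / μ := by positivity
    linarith
  have a4 : τ / 2 * (8 * χ * t / μ) ≤ 2 * (χ / μ) := by
    have e : τ / 2 * (8 * χ * t / μ) = 4 * (τ * t) * (χ / μ) := by field_simp; norm_num
    rw [e]
    refine mul_le_mul_of_nonneg_right ?_ hQ0.le
    nlinarith
  have a5 : τ / 2 * (7 * t * χ / (4 * μ)) ≤ χ / μ := by
    have e : τ / 2 * (7 * t * χ / (4 * μ)) = 7 / 8 * (τ * t) * (χ / μ) := by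
      field_simp; norm_num
    rw [e]
    refine mul_le_of_le_one_left hQ0.le ?_
    nlinarith
  have a6 : τ / 2 * (32 * χ / (μ * t)) ≤ 24 * (χ / μ) := by
    have e : τ / 2 * (32 * χ / (μ * t)) = 16 * (τ / t) * (χ / μ) := by field_simp; norm_num
    have : τ / t ≤ 3 / 2 := by rwa [div_le_iff₀ ht]
    rw [e]
    refine mul_le_mul_of_nonneg_right (by linarith) hQ0.le
  have b1 := mul_le_mul_of_nonneg_right a1 hX
  have b3 := mul_le_mul_of_nonneg_right a3 hY
  have b4 := mul_le_mul_of_nonneg_right a4 hY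
  have b5 : τ / 2 * (7 * t * χ / (4 * μ)) * (A + P) ≤ χ / μ * (2 * Z + 3 * m) :=
    mul_le_mul a5 (by linarith) (by positivity) hQ0.le
  have b6 : τ / 2 * (32 * χ / (μ * t)) * U ≤ 24 * (χ / μ) * (2 * Y + 2 * Z) :=
    mul_le_mul a6 hU hU0 (by positivity)
  have d1 : τ / 2 * (2 / τ * R) = R := by rw [← mul_assoc, a2, one_mul]
  have c1 : 0 ≤ μ * X := by positivity
  have c2 : 0 ≤ χ / μ * Y := by positivity
  have c3 : 0 ≤ χ / μ * Z := by positivity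
  have c4 : 0 ≤ χ / μ * m := by positivity
  linarith

theorem IsSADOM.potential_zero_le {μ χ t τ : ℝ} {H : Stack n d → ℝ} {p : Params}
    {W : ℕ → Matrix (Fin n) (Fin n) ℝ} {g : ℕ → Stack n d → Stack n d}
    {x0 y0 z0 m0 : Stack n d} {T : Iterates n d} (h : IsSADOM p W g x0 y0 z0 m0 T)
    (hμ : 0 < μ) (hχ : 1 ≤ χ) (ht : 0 < t) (ht1 : t ≤ 1 / 2) (hτ : 0 < τ)
    (hτt : τ ^ 2 = 2 * t ^ 2) (xs : Stack n d) (hb : 0 ≤ bregman H x0 xs) :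
    τ / 2 * potential μ χ t τ H xs T 0 ≤ 51 * initialError μ χ H xs x0 y0 z0 m0 := by
  unfold potential initialError
  rw [h.x_zero, h.xf_zero, h.y_zero, h.yf_zero, h.z_zero, h.zf_zero, h.m_zero]
  have hP : ‖(perpSubmodule n d).starProjection m0‖ ^ 2 ≤ ‖m0‖ ^ 2 := by
    have := (perpSubmodule n d).norm_starProjection_apply_le m0
    gcongr
  have h1 := norm_sub_sq_le_two_mul (z0 + gradient H xs) ((perpSubmodule n d).starProjection m0)
  rw [show z0 + gradient H xs - (perpSubmodule n d).starProjection m0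
    = z0 - (perpSubmodule n d).starProjection m0 + gradient H xs by abel] at h1
  have h2 := norm_add_sq_le_two_mul (y0 - (gradient H xs - (μ / 2) • xs)) (z0 + gradient H xs)
  rw [show y0 - (gradient H xs - (μ / 2) • xs) + (z0 + gradient H xs)
    = y0 + z0 + (μ / 2) • xs by abel] at h2
  have hR : reducedBregman μ H xs x0 ≤ bregman H x0 xs := by
    unfold reducedBregman
    have : 0 ≤ μ / 4 * ‖x0 - xs‖ ^ 2 := by positivity
    linarith
  exact potential_zero_bound hμ hχ ht ht1 hτ hτt (sq_nonneg _) hb hR (sq_nonneg _) (sq_nonneg _)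
    (sq_nonneg _) (sq_nonneg _) hP (sq_nonneg _) (h1.trans (by linarith)) (sq_nonneg _) h2

theorem inner_eq_zero_of_isMinOn {H : Stack n d → ℝ} {x v : Stack n d}
    (hd : DifferentiableAt ℝ H x) (hx : x ∈ consensus n d) (hmin : IsMinOn H (consensus n d) x)
    (hv : v ∈ consensus n d) : inner ℝ (gradient H x) v = 0 := by
  have h1 : HasDerivAt (fun s : ℝ => H (x + s • v)) (inner ℝ (gradient H x) v) 0 :=
    HasGradientAt.hasDerivAt_add_smul (by simpa using hd.hasGradientAt)
  refine IsLocalMin.hasDerivAt_eq_zero (Filter.Eventually.of_forall fun s => ?_) h1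
  simp only [zero_smul, add_zero]
  refine hmin ?_
  intro i j
  simp [hx i j, hv i j]

/-- Test stationarity with the consensus vector all of whose blocks equal the sum of the partial
gradients: the squared norm of that sum vanishes. It places z* in 𝓛^⊥. -/
theorem gradient_mem_perpSubmodule {H : Stack n d → ℝ} {x : Stack n d}
    (hd : DifferentiableAt ℝ H x) (hx : x ∈ consensus n d) (hmin : IsMinOn H (consensus n d) x) :
    gradient H x ∈ perpSubmodule n d := by
  rw [mem_perpSubmodule]
  set c := ∑ i, gradient H x i with hc
  have h := inner_eq_zero_of_isMinOn hd hx hmin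
    (v := WithLp.toLp 2 fun _ => c) (fun _ _ => rfl)
  rw [PiLp.inner_apply] at h
  simp only [← sum_inner] at h
  rw [← hc] at h
  exact inner_self_eq_zero.1 h

/-- Accuracy for the smoothed problem implies accuracy for the original problem. -/
theorem IsRegularOn.original_le {μ ℓ ε : ℝ} {F H : Stack n d → ℝ} {S : Set (Stack n d)}
    (hreg : IsRegularOn H S μ ℓ) (hμ : 0 < μ) (hFH : ∀ x, F x ≤ H x)
    (hHF : ∀ x ∈ S, H x ≤ F x + ε / 2) {xs xγ : Stack n d} (hxs : xs ∈ S)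
    (hort : inner ℝ (gradient H xγ) (xs - xγ) = 0) (x u : Stack n d) :
    μ / 2 * ‖x - xs‖ ^ 2 + (F u - F xs - inner ℝ (gradient H xγ) (u - xs))
        - μ / 4 * ‖u - xs‖ ^ 2
      ≤ 7 * (μ / 2 * ‖x - xγ‖ ^ 2 + reducedBregman μ H xγ u) + ε / 2 := by
  have h1 := hreg.strong xs xγ
  have h2 := hHF xs hxs
  have h3 := hFH u
  have h4 := hreg.reducedBregman_ge xγ u
  rw [hort] at h1
  have e0 : inner ℝ (gradient H xγ) (u - xs)
      = inner ℝ (gradient H xγ) (u - xγ) := by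
    rw [show u - xs = (u - xγ) - (xs - xγ) by abel, inner_sub_right, hort, sub_zero]
  rw [e0]
  unfold reducedBregman bregman at *
  rw [show x - xs = (x - xγ) - (xs - xγ) by abel, show u - xs = (u - xγ) - (xs - xγ) by abel]
  generalize x - xγ = a at *
  generalize u - xγ = b at *
  generalize xs - xγ = c at *
  rw [norm_sub_sq_real, norm_sub_sq_real b c]
  -- Strong convexity at xγ contributes -(μ/2)‖c‖², of which -(μ/4)‖c‖² survives. Completing this
  -- square removes the cross terms of c with a and b, and leaves (μ/4)‖2a - b‖², bounded by a
  -- multiple of the smoothed error.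
  have h5 := mul_nonneg hμ.le (sq_nonneg ‖c + (2 : ℝ) • a - b‖)
  have h6 := mul_nonneg hμ.le (sq_nonneg ‖(2 : ℝ) • a + b‖)
  simp only [← real_inner_self_eq_norm_sq, inner_smul_left, inner_smul_right, inner_sub_left,
    inner_sub_right, inner_add_left, inner_add_right, conj_trivial] at *
  simp only [real_inner_comm a c, real_inner_comm a b, real_inner_comm b c] at *
  nlinarith [mul_nonneg hμ.le (real_inner_self_nonneg (x := a)),
    mul_nonneg hμ.le (real_inner_self_nonneg (x := b))]

end Bounds

/-! ### Convexity and Lipschitz continuity of the mean objective -/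

section Mean

variable {n d : ℕ} {Ξ : Type*} [MeasurableSpace Ξ] {𝒟 : Measure Ξ}
  {f : Fin n → EuclideanSpace ℝ (Fin d) → Ξ → ℝ}

theorem integrable_stochF (hf : ∀ i x, Integrable (f i x) 𝒟) (x : Stack n d) :
    Integrable (stochF f x) 𝒟 :=
  integrable_finsetSum _ fun i _ => hf i (x i)

theorem meanF_eq_sum (hf : ∀ i x, Integrable (f i x) 𝒟) (x : Stack n d) :
    meanF 𝒟 f x = ∑ i, ∫ ξ, f i (x i) ξ ∂𝒟 :=
  integral_finsetSum _ fun i _ => hf i (x i)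

theorem strongConvexOn_meanF {μ : ℝ} (hf : ∀ i x, Integrable (f i x) 𝒟)
    (hc : ∀ i, StrongConvexOn Set.univ μ fun x => ∫ ξ, f i x ξ ∂𝒟) :
    StrongConvexOn Set.univ μ (meanF 𝒟 f) := by
  refine ⟨convex_univ, fun x _ y _ a b ha hb hab => ?_⟩
  have h := Finset.sum_le_sum fun i (_ : i ∈ Finset.univ) =>
    (hc i).2 (Set.mem_univ (x i)) (Set.mem_univ (y i)) ha hb hab
  beta_reduce at h ⊢
  rw [meanF_eq_sum hf, meanF_eq_sum hf, meanF_eq_sum hf, PiLp.norm_sq_eq_of_L2]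
  simp only [Finset.sum_sub_distrib, Finset.sum_add_distrib, ← Finset.smul_sum,
    ← Finset.mul_sum] at h
  exact h

theorem continuous_of_convexOn {F : Stack n d → ℝ} (hF : ConvexOn ℝ Set.univ F) : Continuous F :=
  continuousOn_univ.1 (hF.continuousOn isOpen_univ)

/-- The mean of the random Lipschitz constant is at most the root of its second moment;
nonnegativity of the variance supplies this. -/
theorem abs_meanF_sub_le [IsProbabilityMeasure 𝒟] {M : ℝ} (hM : 0 ≤ M)
    (hf : ∀ i x, Integrable (f i x) 𝒟)
    {K : Set (Stack n d)} (hL : LipschitzInMean 𝒟 f K M) {x y : Stack n d} (hx : x ∈ K)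
    (hy : y ∈ K) : |meanF 𝒟 f y - meanF 𝒟 f x| ≤ M * ‖y - x‖ := by
  obtain ⟨Mξ, hMξ, hM2, hlip⟩ := hL
  have hi : Integrable Mξ 𝒟 := hMξ.integrable one_le_two
  have hle : ∫ ξ, Mξ ξ ∂𝒟 ≤ M := by
    have h0 : 0 ≤ ∫ ξ, (Mξ ξ - ∫ ξ, Mξ ξ ∂𝒟) ^ 2 ∂𝒟 := integral_nonneg fun _ => sq_nonneg _
    have h1 : ∫ ξ, (Mξ ξ - ∫ ξ, Mξ ξ ∂𝒟) ^ 2 ∂𝒟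
        = ∫ ξ, Mξ ξ ^ 2 ∂𝒟 - (∫ ξ, Mξ ξ ∂𝒟) ^ 2 := by
      have := variance_eq_sub hMξ
      rw [variance_eq_integral hMξ.aestronglyMeasurable.aemeasurable] at this
      simpa using this
    exact abs_le_of_sq_le_sq' (by linarith) hM |>.2
  rw [meanF, meanF, ← integral_sub (integrable_stochF hf y) (integrable_stochF hf x)]
  refine (abs_integral_le_integral_abs).trans ?_
  calc _ ≤ ∫ ξ, Mξ ξ * ‖y - x‖ ∂𝒟 :=
        integral_mono ((integrable_stochF hf y).sub (integrable_stochF hf x)).abs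
          (hi.mul_const _) fun ξ => hlip ξ x hx y hy
    _ = (∫ ξ, Mξ ξ ∂𝒟) * ‖y - x‖ := integral_mul_const _ _
    _ ≤ _ := by gcongr

/-- At the midpoint of x ± γe strong convexity forces an average rise of at least μγ²/2, while
Lipschitz continuity allows at most Mγ. For γ = ε/(2M) this reads με ≤ 4M², which later keeps t ≤
1/2. -/
theorem mul_le_of_strongConvexOn_of_lipschitz (hn : 1 ≤ n) (hd : 1 ≤ d) {F : Stack n d → ℝ}
    {S : Set (Stack n d)} {γ μ M : ℝ} (hγ : 0 < γ) (hF : StrongConvexOn Set.univ μ F)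
    (hL : ∀ x ∈ neigh S γ, ∀ y ∈ neigh S γ, |F y - F x| ≤ M * ‖y - x‖) {x : Stack n d}
    (hx : x ∈ S) : μ * γ ≤ 2 * M := by
  have := nontrivial_stack hn hd
  obtain ⟨e, he⟩ := exists_norm_eq (Stack n d) zero_le_one
  have h1 := hF.2 (Set.mem_univ (x + γ • e)) (Set.mem_univ (x + γ • -e))
    (by norm_num : (0 : ℝ) ≤ 1 / 2) (by norm_num : (0 : ℝ) ≤ 1 / 2) (by norm_num)
  have h2 := hL x (subset_neigh hγ.le hx) _ (add_smul_mem_neigh hγ.le hx he.le)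
  have h3 := hL x (subset_neigh hγ.le hx) _ (add_smul_mem_neigh hγ.le hx (u := -e)
    (by rw [norm_neg, he]))
  have e1 : (1 / 2 : ℝ) • (x + γ • e) + (1 / 2 : ℝ) • (x + γ • -e) = x := by module
  have e2 : x + γ • e - (x + γ • -e) = (2 * γ) • e := by module
  rw [e1, e2, norm_smul, he, Real.norm_eq_abs, abs_of_pos (by positivity)] at h1
  rw [add_sub_cancel_left, norm_smul, he, Real.norm_eq_abs, abs_of_pos hγ] at h2
  rw [add_sub_cancel_left, norm_smul, norm_neg, he, Real.norm_eq_abs, abs_of_pos hγ] at h3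
  have h4 := (abs_le.1 h2).2
  have h5 := (abs_le.1 h3).2
  simp only [smul_eq_mul] at h1
  have h6 : (μ * γ) * γ ≤ (2 * M) * γ := by nlinarith
  exact le_of_mul_le_mul_right h6 hγ

theorem isRegularOn_smoothF (hn : 1 ≤ n) (hd : 1 ≤ d) {γ M μ : ℝ} (hγ : 0 < γ) (hM : 0 < M)
    (hμ : 0 ≤ μ) {F : Stack n d → ℝ} (hF : StrongConvexOn Set.univ μ F) {S : Set (Stack n d)}
    (hS : Convex ℝ S) (hL : ∀ x ∈ neigh S γ, ∀ y ∈ neigh S γ, |F y - F x| ≤ M * ‖y - x‖) :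
    IsRegularOn (smoothF γ F) S μ (√((n * d : ℕ) : ℝ) * M / γ) := by
  have hconv : ConvexOn ℝ Set.univ F := strongConvexOn_zero.1 (hF.mono hμ)
  have hc := continuous_of_convexOn hconv
  refine ⟨fun u v => ?_, fun u hu v hv => ?_, fun u hu v hv => ?_⟩
  · refine (uniformConvexOn_smoothF hc hF).le_of_hasGradientAt ?_ u
    exact (hasGradientAt_smoothF hn hd hγ hc v).differentiableAt.hasGradientAt
  · exact (smoothF_regularity hn hd hγ hM hc hconv hS hL hu hv).1
  · exact (smoothF_regularity hn hd hγ hM hc hconv hS hL hu hv).2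

end Mean

/-! ### Second moments of independent centred vectors -/

section Moments

variable {Ω E : Type*} [MeasurableSpace Ω] {P : Measure Ω} [NormedAddCommGroup E]

theorem memLp_two_of_lintegral_le {u : Ω → E} (hu : AEStronglyMeasurable u P) {c : ℝ} (hc : 0 ≤ c)
    (h : ∫⁻ ω, ENNReal.ofReal (‖u ω‖ ^ 2) ∂P ≤ ENNReal.ofReal c) :
    MemLp u 2 P ∧ ∫ ω, ‖u ω‖ ^ 2 ∂P ≤ c := by
  refine ⟨(memLp_two_iff_integrable_sq_norm hu).2 ⟨hu.norm.pow 2, ?_⟩, ?_⟩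
  · rw [hasFiniteIntegral_iff_ofReal (Filter.Eventually.of_forall fun _ => sq_nonneg _)]
    exact h.trans_lt ENNReal.ofReal_lt_top
  · rw [integral_eq_lintegral_of_nonneg_ae (Filter.Eventually.of_forall fun _ => sq_nonneg _)
      (hu.norm.pow 2)]
    exact ENNReal.toReal_le_of_le_ofReal hc h

variable [InnerProductSpace ℝ E]

theorem integrable_inner_of_memLp_two {u v : Ω → E} (hu : MemLp u 2 P) (hv : MemLp v 2 P) :
    Integrable (fun ω => inner ℝ (u ω) (v ω)) P := by
  refine Integrable.mono' (hu.integrable_norm_pow two_ne_zero |>.add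
    (hv.integrable_norm_pow two_ne_zero)) (hu.1.inner hv.1) (Filter.Eventually.of_forall fun ω => ?_)
  have := norm_inner_le_norm (𝕜 := ℝ) (u ω) (v ω)
  simp only [Pi.add_apply]
  nlinarith [sq_nonneg (‖u ω‖ - ‖v ω‖), sq_nonneg (‖u ω‖ + ‖v ω‖)]

variable [CompleteSpace E] [MeasurableSpace E] [BorelSpace E] [SecondCountableTopology E]

/-- Fubini for the product law: the inner integral over u vanishes for each frozen value of v. -/
theorem IndepFun.integral_inner_eq_zero [IsProbabilityMeasure P] {u v : Ω → E}
    (h : IndepFun u v P) (hum : Measurable u) (hvm : Measurable v)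
    (hu : MemLp u 2 P) (hv : MemLp v 2 P) (h0 : ∫ ω, u ω ∂P = 0) :
    ∫ ω, inner ℝ (u ω) (v ω) ∂P = 0 := by
  have hi := integrable_inner_of_memLp_two hu hv
  have hm := h.map_prod_eq_prod_map_map hum.aemeasurable hvm.aemeasurable
  have hmp : AEMeasurable (fun ω => (u ω, v ω)) P := (hum.prodMk hvm).aemeasurable
  have hc : AEStronglyMeasurable (fun p : E × E => (inner ℝ p.1 p.2 : ℝ))
      (P.map fun ω => (u ω, v ω)) := by
    apply Continuous.aestronglyMeasurable; fun_prop
  have hi2 := (integrable_map_measure hc hmp).2 hi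
  have h1 := integral_map hmp hc
  simp only at h1
  have : IsProbabilityMeasure (P.map u) := Measure.isProbabilityMeasure_map hum.aemeasurable
  have : IsProbabilityMeasure (P.map v) := Measure.isProbabilityMeasure_map hvm.aemeasurable
  rw [hm] at hi2 h1
  rw [← h1, integral_prod_symm _ hi2]
  have hui : Integrable (fun x : E => x) (P.map u) := by
    rw [integrable_map_measure (by fun_prop) hum.aemeasurable]
    exact hu.integrable one_le_two
  refine integral_eq_zero_of_ae (Filter.Eventually.of_forall fun y => ?_)
  have h2 : ∫ x, inner ℝ y x ∂(P.map u) = inner ℝ y (∫ x, x ∂(P.map u)) :=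
    integral_inner hui y
  have h3 : ∫ x, x ∂(P.map u) = ∫ ω, u ω ∂P :=
    integral_map hum.aemeasurable aestronglyMeasurable_id
  rw [h3, h0, inner_zero_right] at h2
  simpa only [real_inner_comm, Pi.zero_apply] using h2

/-- The second moment of an average of independent centred vectors. -/
theorem integral_norm_sq_average_le [IsProbabilityMeasure P] {B : ℕ} (hB : 1 ≤ B)
    {u : Fin B → Ω → E} (hum : ∀ j, Measurable (u j)) (hu : ∀ j, MemLp (u j) 2 P)
    (h0 : ∀ j, ∫ ω, u j ω ∂P = 0) (hind : Pairwise fun i j => IndepFun (u i) (u j) P) {s : ℝ}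
    (hs : ∀ j, ∫ ω, ‖u j ω‖ ^ 2 ∂P ≤ s) :
    ∫ ω, ‖(B : ℝ)⁻¹ • ∑ j, u j ω‖ ^ 2 ∂P ≤ s / B := by
  have hB0 : (0 : ℝ) < B := by exact_mod_cast hB
  have e : ∀ ω, ‖(B : ℝ)⁻¹ • ∑ j, u j ω‖ ^ 2
      = ((B : ℝ)⁻¹) ^ 2 * ∑ i, ∑ j, inner ℝ (u i ω) (u j ω) := fun ω => by
    rw [norm_smul, mul_pow, ← real_inner_self_eq_norm_sq (∑ j, u j ω), sum_inner, Real.norm_eq_abs,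
      sq_abs]
    simp only [inner_sum]
  simp only [e]
  rw [integral_const_mul, integral_finsetSum _ fun i _ => integrable_finsetSum _ fun j _ =>
    integrable_inner_of_memLp_two (hu i) (hu j)]
  have h1 : ∀ i, ∫ ω, ∑ j, inner ℝ (u i ω) (u j ω) ∂P ≤ s := fun i => by
    rw [integral_finsetSum _ fun j _ => integrable_inner_of_memLp_two (hu i) (hu j),
      Finset.sum_eq_single i]
    · simpa only [real_inner_self_eq_norm_sq] using hs i
    · intro j _ hj
      exact IndepFun.integral_inner_eq_zero (hind hj.symm) (hum i) (hum j) (hu i) (hu j) (h0 i)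
    · simp
  calc _ ≤ ((B : ℝ)⁻¹) ^ 2 * ∑ _i : Fin B, s := by
        gcongr with i; exact h1 i
    _ = s / B := by simp; field_simp

theorem integral_norm_sq_sub_integral_le [IsProbabilityMeasure P] {u : Ω → E} (hu : MemLp u 2 P) :
    ∫ ω, ‖u ω - ∫ ω, u ω ∂P‖ ^ 2 ∂P ≤ ∫ ω, ‖u ω‖ ^ 2 ∂P := by
  set c := ∫ ω, u ω ∂P with hc
  have hi : Integrable u P := hu.integrable one_le_two
  have h1 : ∫ ω, inner ℝ c (u ω) ∂P = inner ℝ c c := integral_inner hi c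
  have i1 : Integrable (fun ω => ‖u ω‖ ^ 2) P := by
    simpa using hu.integrable_norm_pow two_ne_zero
  have i2 : Integrable (fun ω => inner ℝ c (u ω)) P := hi.const_inner c
  have e : ∀ ω, ‖u ω - c‖ ^ 2 = ‖u ω‖ ^ 2 - 2 * inner ℝ c (u ω) + ‖c‖ ^ 2 := fun ω => by
    rw [norm_sub_sq_real, real_inner_comm]
  simp only [e]
  have h2 := integral_add (i1.sub (i2.const_mul 2)) (integrable_const (‖c‖ ^ 2))
  have h3 := integral_sub i1 (i2.const_mul 2)
  simp only [Pi.sub_apply] at h2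
  rw [h2, h3, integral_const_mul, h1]
  simp only [integral_const, probReal_univ, one_smul, real_inner_self_eq_norm_sq]
  nlinarith [sq_nonneg ‖c‖]

end Moments

/-! ### The one-point estimator: second moment and bias -/

section Estimator

variable {n d : ℕ} {Ξ : Type*} [MeasurableSpace Ξ] {𝒟 : Measure Ξ} [IsProbabilityMeasure 𝒟]
  {f : Fin n → EuclideanSpace ℝ (Fin d) → Ξ → ℝ} {δ : Stack n d → Ξ → ℝ} {γ : ℝ}
  {S : Set (Stack n d)} {G Δ : ℝ}

theorem measurable_stochF
    (hf : ∀ i, Measurable fun p : EuclideanSpace ℝ (Fin d) × Ξ => f i p.1 p.2) :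
    Measurable fun p : Stack n d × Ξ => stochF f p.1 p.2 := by
  refine Finset.measurable_fun_sum _ fun i _ => ?_
  have h : Measurable fun p : Stack n d × Ξ => (p.1 i, p.2) :=
    ((PiLp.continuous_apply 2 (fun _ : Fin n => EuclideanSpace ℝ (Fin d)) i).measurable.comp
      measurable_fst).prodMk measurable_snd
  exact (hf i).comp h

theorem measurable_opf
    (hf : ∀ i, Measurable fun p : EuclideanSpace ℝ (Fin d) × Ξ => f i p.1 p.2)
    (hδ : Measurable fun p : Stack n d × Ξ => δ p.1 p.2) :
    Measurable fun p : Stack n d × Ξ × Stack n d => opf γ f δ p.1 p.2.1 p.2.2 := by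
  have h : Measurable fun p : Stack n d × Ξ × Stack n d => (p.1 + γ • p.2.2, p.2.1) := by
    fun_prop
  have h1 : Measurable fun p : Stack n d × Ξ × Stack n d => stochF f (p.1 + γ • p.2.2) p.2.1 :=
    (measurable_stochF hf).comp h
  have h2 : Measurable fun p : Stack n d × Ξ × Stack n d => δ (p.1 + γ • p.2.2) p.2.1 :=
    hδ.comp h
  unfold opf
  exact ((h1.add h2).const_mul _).smul (by fun_prop)

theorem measurable_opfBatch {B : ℕ}
    (hf : ∀ i, Measurable fun p : EuclideanSpace ℝ (Fin d) × Ξ => f i p.1 p.2)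
    (hδ : Measurable fun p : Stack n d × Ξ => δ p.1 p.2) :
    Measurable fun p : Stack n d × (Fin B → Ξ × Stack n d) =>
      opfBatch γ f δ p.1 (fun j => (p.2 j).1) fun j => (p.2 j).2 := by
  have h : ∀ j, Measurable fun p : Stack n d × (Fin B → Ξ × Stack n d) =>
      opf γ f δ p.1 (p.2 j).1 (p.2 j).2 := fun j => by
    have h1 : Measurable fun p : Stack n d × (Fin B → Ξ × Stack n d) => (p.1, p.2 j) := by fun_prop
    have h2 := (measurable_opf (γ := γ) hf hδ).comp h1
    simpa only [Function.comp_def] using h2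
  unfold opfBatch
  exact (Finset.measurable_fun_sum _ fun j _ => h j).const_smul (B : ℝ)⁻¹

theorem ae_norm_prod_uniformSphere (hn : 1 ≤ n) (hd : 1 ≤ d) :
    ∀ᵐ p ∂𝒟.prod (uniformSphere n d), ‖p.2‖ = 1 := by
  have := isProbabilityMeasure_uniformSphere hn hd
  exact Measure.quasiMeasurePreserving_snd.ae ae_norm_uniformSphere

/-- The moment assumption is pointwise in the evaluation point, so e is frozen first by Tonelli.
Lower integrals give square integrability and the bound together. -/
theorem opf_memLp (hn : 1 ≤ n) (hd : 1 ≤ d) (hγ : 0 ≤ γ)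
    (hf : ∀ i, Measurable fun p : EuclideanSpace ℝ (Fin d) × Ξ => f i p.1 p.2)
    (hδ : Measurable fun p : Stack n d × Ξ => δ p.1 p.2) (hΔ : ∀ x ξ, |δ x ξ| ≤ Δ)
    (hG : SecondMomentBound 𝒟 f (neigh S γ) G) {x : Stack n d} (hx : x ∈ S) :
    MemLp (fun p : Ξ × Stack n d => opf γ f δ x p.1 p.2) 2 (𝒟.prod (uniformSphere n d)) ∧
    ∫ p, ‖opf γ f δ x p.1 p.2‖ ^ 2 ∂(𝒟.prod (uniformSphere n d))
      ≤ 2 * (((n * d : ℕ) : ℝ) / γ) ^ 2 * (G ^ 2 + Δ ^ 2) := by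
  have := isProbabilityMeasure_uniformSphere hn hd
  have hm : Measurable fun p : Ξ × Stack n d => opf γ f δ x p.1 p.2 := by
    have h1 : Measurable fun p : Ξ × Stack n d => (x, p) := measurable_prodMk_left
    have h2 := (measurable_opf (γ := γ) hf hδ).comp h1
    simpa only [Function.comp_def] using h2
  set c := 2 * (((n * d : ℕ) : ℝ) / γ) ^ 2 with hc
  have hc0 : 0 ≤ c := by positivity
  have hK : 0 ≤ c * (G ^ 2 + Δ ^ 2) := by positivity
  refine memLp_two_of_lintegral_le hm.aestronglyMeasurable hK ?_
  have hm1 : Measurable fun p : Ξ × Stack n d => (x + γ • p.2, p.1) := by fun_prop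
  have hm2 : Measurable fun p : Ξ × Stack n d => stochF f (x + γ • p.2) p.1 :=
    (measurable_stochF hf).comp hm1
  calc _ ≤ ∫⁻ p, ENNReal.ofReal (c * (stochF f (x + γ • p.2) p.1 ^ 2 + Δ ^ 2))
        ∂(𝒟.prod (uniformSphere n d)) := by
        refine lintegral_mono_ae ?_
        filter_upwards [ae_norm_prod_uniformSphere hn hd] with p hp
        refine ENNReal.ofReal_le_ofReal ?_
        rw [opf, norm_smul, hp, mul_one, Real.norm_eq_abs, sq_abs, mul_pow, hc]
        have h1 : δ (x + γ • p.2) p.1 ^ 2 ≤ Δ ^ 2 := by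
          rw [← sq_abs]
          exact pow_le_pow_left₀ (abs_nonneg _) (hΔ _ _) 2
        have h2 := sq_nonneg (stochF f (x + γ • p.2) p.1 - δ (x + γ • p.2) p.1)
        rw [mul_comm (2 : ℝ), mul_assoc]
        refine mul_le_mul_of_nonneg_left ?_ (sq_nonneg _)
        linarith
    _ = ∫⁻ e, ∫⁻ ξ, ENNReal.ofReal (c * (stochF f (x + γ • e) ξ ^ 2 + Δ ^ 2)) ∂𝒟
        ∂(uniformSphere n d) := by
        rw [lintegral_prod_symm']
        exact ((hm2.pow_const 2).add_const _ |>.const_mul c).ennreal_ofReal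
    _ ≤ ∫⁻ _e, ENNReal.ofReal (c * (G ^ 2 + Δ ^ 2)) ∂(uniformSphere n d) := by
        refine lintegral_mono_ae ?_
        filter_upwards [ae_norm_uniformSphere] with e he
        obtain ⟨h1, h2⟩ := hG _ (add_smul_mem_neigh hγ hx he.le)
        have i1 : Integrable (fun ξ => stochF f (x + γ • e) ξ ^ 2) 𝒟 := h1.integrable_sq
        have i2 : Integrable (fun ξ => c * (stochF f (x + γ • e) ξ ^ 2 + Δ ^ 2)) 𝒟 :=
          (i1.add (integrable_const _)).const_mul c
        rw [← ofReal_integral_eq_lintegral_ofReal i2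
          (Filter.Eventually.of_forall fun ξ => by simp only [Pi.zero_apply]; positivity)]
        refine ENNReal.ofReal_le_ofReal ?_
        rw [integral_const_mul]
        refine mul_le_mul_of_nonneg_left ?_ hc0
        have := integral_add i1 (integrable_const (Δ ^ 2))
        simp only [integral_const, probReal_univ, one_smul] at this
        rw [this]
        linarith
    _ = _ := by simp

/-- The mean of the one-point feedback. -/
noncomputable def opfMean (𝒟 : Measure Ξ) (γ : ℝ) (f : Fin n → EuclideanSpace ℝ (Fin d) → Ξ → ℝ)
    (δ : Stack n d → Ξ → ℝ) (x : Stack n d) : Stack n d :=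
  ∫ p, opf γ f δ x p.1 p.2 ∂(𝒟.prod (uniformSphere n d))

theorem measurable_opfMean (hn : 1 ≤ n) (hd : 1 ≤ d)
    (hf : ∀ i, Measurable fun p : EuclideanSpace ℝ (Fin d) × Ξ => f i p.1 p.2)
    (hδ : Measurable fun p : Stack n d × Ξ => δ p.1 p.2) : Measurable (opfMean 𝒟 γ f δ) := by
  have := isProbabilityMeasure_uniformSphere hn hd
  exact ((measurable_opf hf hδ).stronglyMeasurable.integral_prod_right
    (ν := 𝒟.prod (uniformSphere n d))).measurable

/-- Averaging the noise-free part over ξ gives the sphere gradient, so only the adversarial part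
remains. Pairing the bias with itself and using E|⟨e, b⟩| ≤ ‖b‖/√D improves the trivial DΔ/γ by √D.
-/
theorem norm_opfMean_sub_le (hn : 1 ≤ n) (hd : 1 ≤ d) (hγ : 0 < γ)
    (hf : ∀ i, Measurable fun p : EuclideanSpace ℝ (Fin d) × Ξ => f i p.1 p.2)
    (hδ : Measurable fun p : Stack n d × Ξ => δ p.1 p.2) (hΔ : ∀ x ξ, |δ x ξ| ≤ Δ) (hΔ0 : 0 ≤ Δ)
    (hG : SecondMomentBound 𝒟 f (neigh S γ) G) {x : Stack n d} (hx : x ∈ S) :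
    ‖opfMean 𝒟 γ f δ x - sphereGrad γ (meanF 𝒟 f) x‖ ≤ √((n * d : ℕ) : ℝ) * Δ / γ := by
  have := isProbabilityMeasure_uniformSphere hn hd
  have hnd : (0 : ℝ) < ((n * d : ℕ) : ℝ) := by
    have : 0 < n * d := by positivity
    exact_mod_cast this
  have i1 := (opf_memLp hn hd hγ.le hf hδ hΔ hG hx).1.integrable one_le_two
  have i2 : Integrable (fun p : Ξ × Stack n d =>
      (((n * d : ℕ) : ℝ) / γ * δ (x + γ • p.2) p.1) • p.2) (𝒟.prod (uniformSphere n d)) := by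
    have hm : Measurable fun p : Ξ × Stack n d => δ (x + γ • p.2) p.1 :=
      hδ.comp (by fun_prop : Measurable fun p : Ξ × Stack n d => (x + γ • p.2, p.1))
    refine Integrable.mono' (integrable_const (((n * d : ℕ) : ℝ) / γ * Δ))
      ((hm.const_mul _).smul measurable_snd).aestronglyMeasurable ?_
    filter_upwards [ae_norm_prod_uniformSphere hn hd] with p hp
    rw [norm_smul, hp, mul_one, Real.norm_eq_abs, abs_mul, abs_of_pos (by positivity)]
    gcongr
    exact hΔ _ _
  have i3 : Integrable (fun p : Ξ × Stack n d =>
      (((n * d : ℕ) : ℝ) / γ * stochF f (x + γ • p.2) p.1) • p.2)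
      (𝒟.prod (uniformSphere n d)) := by
    refine (i1.sub i2).congr (Filter.Eventually.of_forall fun p => ?_)
    simp only [Pi.sub_apply, opf]
    module
  have h1 : ∫ p : Ξ × Stack n d, (((n * d : ℕ) : ℝ) / γ * stochF f (x + γ • p.2) p.1) • p.2
      ∂(𝒟.prod (uniformSphere n d)) = sphereGrad γ (meanF 𝒟 f) x := by
    rw [integral_prod_symm _ i3, sphereGrad, ← integral_smul]
    refine integral_congr_ae (Filter.Eventually.of_forall fun e => ?_)
    simp only
    rw [integral_smul_const, integral_const_mul, mul_smul]
    rfl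
  have h2 : opfMean 𝒟 γ f δ x - sphereGrad γ (meanF 𝒟 f) x
      = ∫ p : Ξ × Stack n d, (((n * d : ℕ) : ℝ) / γ * δ (x + γ • p.2) p.1) • p.2
        ∂(𝒟.prod (uniformSphere n d)) := by
    rw [← h1, opfMean, ← integral_sub i1 i3]
    refine integral_congr_ae (Filter.Eventually.of_forall fun p => ?_)
    simp only [opf]
    module
  set b := opfMean 𝒟 γ f δ x - sphereGrad γ (meanF 𝒟 f) x with hb
  have h3 : ‖b‖ ^ 2 = ∫ p : Ξ × Stack n d, inner ℝ b
      ((((n * d : ℕ) : ℝ) / γ * δ (x + γ • p.2) p.1) • p.2) ∂(𝒟.prod (uniformSphere n d)) := by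
    rw [integral_inner i2, ← h2, real_inner_self_eq_norm_sq]
  have hint : Integrable (fun e : Stack n d => |inner ℝ e b|) (uniformSphere n d) :=
    integrable_uniformSphere hn hd (by fun_prop)
  have h4 : ‖b‖ ^ 2 ≤ ((n * d : ℕ) : ℝ) / γ * Δ * (‖b‖ / √((n * d : ℕ) : ℝ)) := by
    rw [h3]
    calc _ ≤ ∫ p : Ξ × Stack n d, ((n * d : ℕ) : ℝ) / γ * Δ * |inner ℝ p.2 b|
          ∂(𝒟.prod (uniformSphere n d)) := by
          refine integral_mono (i2.const_inner b) ((hint.comp_snd 𝒟).const_mul _) fun p => ?_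
          simp only [inner_smul_right]
          rw [real_inner_comm]
          refine (le_abs_self _).trans ?_
          rw [abs_mul, abs_mul, abs_of_pos (show 0 < ((n * d : ℕ) : ℝ) / γ by positivity)]
          gcongr
          exact hΔ _ _
      _ = ((n * d : ℕ) : ℝ) / γ * Δ * ∫ e, |inner ℝ e b| ∂(uniformSphere n d) := by
          rw [integral_const_mul, integral_fun_snd (μ := 𝒟) (f := fun e => |inner ℝ e b|)]
          simp
      _ ≤ _ := by gcongr; exact integral_abs_inner_uniformSphere_le hn hd b
  have h5 : ((n * d : ℕ) : ℝ) / γ * Δ * (‖b‖ / √((n * d : ℕ) : ℝ))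
      = √((n * d : ℕ) : ℝ) * Δ / γ * ‖b‖ := by
    have hs := Real.sqrt_pos.2 hnd
    have e := Real.sq_sqrt hnd.le
    field_simp
    rw [e]
    ring
  rw [h5, sq] at h4
  rcases (norm_nonneg b).eq_or_lt with h | h
  · rw [← h]; positivity
  · exact le_of_mul_le_mul_right h4 h

end Estimator

/-! ### The batched estimator at a deterministic and at a random point -/

section Batch

variable {n d B : ℕ} {Ω Ξ : Type*} [MeasurableSpace Ω] {P : Measure Ω} [IsProbabilityMeasure P]
  [MeasurableSpace Ξ] {𝒟 : Measure Ξ} [IsProbabilityMeasure 𝒟]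
  {f : Fin n → EuclideanSpace ℝ (Fin d) → Ξ → ℝ} {δ : Stack n d → Ξ → ℝ} {γ : ℝ}
  {S : Set (Stack n d)} {G Δ : ℝ} {Z : Fin B → Ω → Ξ × Stack n d}

/-- The deviation of the batched one-point estimator from its mean. -/
noncomputable def batchNoise (𝒟 : Measure Ξ) (γ : ℝ)
    (f : Fin n → EuclideanSpace ℝ (Fin d) → Ξ → ℝ) (δ : Stack n d → Ξ → ℝ) (x : Stack n d)
    (z : Fin B → Ξ × Stack n d) : Stack n d :=
  opfBatch γ f δ x (fun j => (z j).1) (fun j => (z j).2) - opfMean 𝒟 γ f δ x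

/-- The bound on the variance of the batched one-point estimator. -/
noncomputable def batchVariance (n d B : ℕ) (γ G Δ : ℝ) : ℝ :=
  2 * (((n * d : ℕ) : ℝ) / γ) ^ 2 * (G ^ 2 + Δ ^ 2) / B

theorem batchVariance_nonneg (n d B : ℕ) (γ G Δ : ℝ) : 0 ≤ batchVariance n d B γ G Δ := by
  unfold batchVariance; positivity

theorem measurable_batchNoise (hn : 1 ≤ n) (hd : 1 ≤ d)
    (hf : ∀ i, Measurable fun p : EuclideanSpace ℝ (Fin d) × Ξ => f i p.1 p.2)
    (hδ : Measurable fun p : Stack n d × Ξ => δ p.1 p.2) :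
    Measurable fun p : Stack n d × (Fin B → Ξ × Stack n d) => batchNoise 𝒟 γ f δ p.1 p.2 :=
  (measurable_opfBatch hf hδ).sub ((measurable_opfMean hn hd hf hδ).comp measurable_fst)

/-- The noise is an average of centred, pairwise independent copies; cross terms vanish and the
second moment gains 1/B. -/
theorem batchNoise_moments (hn : 1 ≤ n) (hd : 1 ≤ d) (hB : 1 ≤ B) (hγ : 0 ≤ γ)
    (hf : ∀ i, Measurable fun p : EuclideanSpace ℝ (Fin d) × Ξ => f i p.1 p.2)
    (hδ : Measurable fun p : Stack n d × Ξ => δ p.1 p.2) (hΔ : ∀ x ξ, |δ x ξ| ≤ Δ)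
    (hG : SecondMomentBound 𝒟 f (neigh S γ) G) (hZ : ∀ j, Measurable (Z j))
    (hlaw : ∀ j, P.map (Z j) = 𝒟.prod (uniformSphere n d))
    (hind : Pairwise fun i j => IndepFun (Z i) (Z j) P) {x : Stack n d} (hx : x ∈ S) :
    MemLp (fun ω => batchNoise 𝒟 γ f δ x fun j => Z j ω) 2 P ∧
    ∫ ω, ‖batchNoise 𝒟 γ f δ x fun j => Z j ω‖ ^ 2 ∂P ≤ batchVariance n d B γ G Δ ∧
    ∫ ω, batchNoise 𝒟 γ f δ x (fun j => Z j ω) ∂P = 0 := by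
  have hB0 : (B : ℝ) ≠ 0 := by positivity
  have := isProbabilityMeasure_uniformSphere hn hd
  obtain ⟨h1, h2⟩ := opf_memLp hn hd hγ hf hδ hΔ hG hx
  set c := opfMean 𝒟 γ f δ x with hc
  set w : Ξ × Stack n d → Stack n d := fun p => opf γ f δ x p.1 p.2 - c with hw
  have hwm : Measurable w := by
    have h1 : Measurable fun p : Ξ × Stack n d => (x, p) := measurable_prodMk_left
    have h2 := (measurable_opf (γ := γ) hf hδ).comp h1
    exact (by simpa only [Function.comp_def] using h2 :
      Measurable fun p : Ξ × Stack n d => opf γ f δ x p.1 p.2).sub_const c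
  have hwL : MemLp w 2 (𝒟.prod (uniformSphere n d)) := h1.sub (memLp_const c)
  have hw0 : ∫ p, w p ∂(𝒟.prod (uniformSphere n d)) = 0 := by
    rw [hw, integral_sub (h1.integrable one_le_two) (integrable_const c)]
    simp [hc, opfMean]
  have hw2 : ∫ p, ‖w p‖ ^ 2 ∂(𝒟.prod (uniformSphere n d))
      ≤ 2 * (((n * d : ℕ) : ℝ) / γ) ^ 2 * (G ^ 2 + Δ ^ 2) :=
    (integral_norm_sq_sub_integral_le h1).trans h2
  have e : ∀ ω, batchNoise 𝒟 γ f δ x (fun j => Z j ω) = (B : ℝ)⁻¹ • ∑ j, w (Z j ω) := fun ω => by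
    simp only [batchNoise, opfBatch, hw, Finset.sum_sub_distrib, smul_sub, ← hc]
    simp [← Nat.cast_smul_eq_nsmul ℝ, smul_smul, hB0]
  simp only [e]
  have hL : ∀ j, MemLp (fun ω => w (Z j ω)) 2 P := fun j => by
    have h3 : MemLp w 2 (P.map (Z j)) := by rw [hlaw]; exact hwL
    exact (memLp_map_measure_iff h3.1 (hZ j).aemeasurable).1 h3
  have h0 : ∀ j, ∫ ω, w (Z j ω) ∂P = 0 := fun j => by
    rw [← integral_map (hZ j).aemeasurable (by rw [hlaw]; exact hwL.1), hlaw, hw0]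
  refine ⟨?_, ?_, ?_⟩
  · exact (memLp_finsetSum _ fun j _ => hL j).const_smul (B : ℝ)⁻¹
  · refine integral_norm_sq_average_le hB (fun j => hwm.comp (hZ j)) hL h0
      (fun i j hij => (hind hij).comp hwm hwm) fun j => ?_
    have h3 : ∫ ω, ‖w (Z j ω)‖ ^ 2 ∂P = ∫ p, ‖w p‖ ^ 2 ∂(P.map (Z j)) :=
      (integral_map (hZ j).aemeasurable (hwm.norm.pow_const 2).aestronglyMeasurable).symm
    rw [hlaw] at h3
    exact h3.trans_le hw2
  · rw [integral_smul, integral_finsetSum _ fun j _ => (hL j).integrable one_le_two]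
    simp [h0]

/-- Independence makes the joint law of (X, A) and the samples a product, so X and A can be frozen
and the deterministic case integrated. This takes the place of a conditional expectation. -/
theorem batchNoise_moments_of_indep (hn : 1 ≤ n) (hd : 1 ≤ d) (hB : 1 ≤ B) (hγ : 0 ≤ γ)
    (hf : ∀ i, Measurable fun p : EuclideanSpace ℝ (Fin d) × Ξ => f i p.1 p.2)
    (hδ : Measurable fun p : Stack n d × Ξ => δ p.1 p.2) (hΔ : ∀ x ξ, |δ x ξ| ≤ Δ)
    (hG : SecondMomentBound 𝒟 f (neigh S γ) G) (hS : MeasurableSet S)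
    (hZ : ∀ j, Measurable (Z j)) (hlaw : ∀ j, P.map (Z j) = 𝒟.prod (uniformSphere n d))
    (hind : Pairwise fun i j => IndepFun (Z i) (Z j) P) {X A : Ω → Stack n d}
    (hX : Measurable X) (hA : Measurable A) (hXS : ∀ ω, X ω ∈ S) (hA2 : MemLp A 2 P)
    (hXZ : IndepFun (fun ω => (X ω, A ω)) (fun ω j => Z j ω) P) :
    MemLp (fun ω => batchNoise 𝒟 γ f δ (X ω) fun j => Z j ω) 2 P ∧
    ∫ ω, ‖batchNoise 𝒟 γ f δ (X ω) fun j => Z j ω‖ ^ 2 ∂P ≤ batchVariance n d B γ G Δ ∧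
    ∫ ω, inner ℝ (batchNoise 𝒟 γ f δ (X ω) fun j => Z j ω) (A ω) ∂P = 0 := by
  have hZb : Measurable fun ω j => Z j ω := measurable_pi_lambda _ hZ
  have hXA : Measurable fun ω => (X ω, A ω) := hX.prodMk hA
  have hall : AEMeasurable (fun ω => ((X ω, A ω), fun j => Z j ω)) P := (hXA.prodMk hZb).aemeasurable
  have hmap := hXZ.map_prod_eq_prod_map_map hXA.aemeasurable hZb.aemeasurable
  have : IsProbabilityMeasure (P.map fun ω => (X ω, A ω)) :=
    Measure.isProbabilityMeasure_map hXA.aemeasurable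
  have : IsProbabilityMeasure (P.map fun ω j => Z j ω) :=
    Measure.isProbabilityMeasure_map hZb.aemeasurable
  have hS' : ∀ᵐ q ∂(P.map fun ω => (X ω, A ω)), q.1 ∈ S := by
    rw [ae_map_iff hXA.aemeasurable (measurable_fst hS)]
    exact Filter.Eventually.of_forall hXS
  have hq : Measurable fun q : (Stack n d × Stack n d) × (Fin B → Ξ × Stack n d) =>
      batchNoise 𝒟 γ f δ q.1.1 q.2 := by
    have h1 : Measurable fun q : (Stack n d × Stack n d) × (Fin B → Ξ × Stack n d) =>
      (q.1.1, q.2) := by fun_prop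
    have h2 := (measurable_batchNoise (𝒟 := 𝒟) (γ := γ) (B := B) hn hd hf hδ).comp h1
    simpa only [Function.comp_def] using h2
  have hx : ∀ x, Measurable fun z : Fin B → Ξ × Stack n d => batchNoise 𝒟 γ f δ x z := fun x => by
    have h1 : Measurable fun z : Fin B → Ξ × Stack n d => (x, z) := measurable_prodMk_left
    have h2 := (measurable_batchNoise (𝒟 := 𝒟) (γ := γ) (B := B) hn hd hf hδ).comp h1
    simpa only [Function.comp_def] using h2
  have hmN : Measurable fun ω => batchNoise 𝒟 γ f δ (X ω) fun j => Z j ω := by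
    have h2 := hq.comp (hXA.prodMk hZb)
    simpa only [Function.comp_def] using h2
  have hfix := fun (x : Stack n d) (hxS : x ∈ S) =>
    batchNoise_moments (𝒟 := 𝒟) (P := P) hn hd hB hγ hf hδ hΔ hG hZ hlaw hind hxS
  have key : MemLp (fun ω => batchNoise 𝒟 γ f δ (X ω) fun j => Z j ω) 2 P ∧
      ∫ ω, ‖batchNoise 𝒟 γ f δ (X ω) fun j => Z j ω‖ ^ 2 ∂P ≤ batchVariance n d B γ G Δ := by
    refine memLp_two_of_lintegral_le hmN.aestronglyMeasurable (batchVariance_nonneg _ _ _ _ _ _) ?_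
    have e1 := lintegral_map' (μ := P)
      (f := fun q : (Stack n d × Stack n d) × (Fin B → Ξ × Stack n d) =>
        ENNReal.ofReal (‖batchNoise 𝒟 γ f δ q.1.1 q.2‖ ^ 2))
      (hq.norm.pow_const 2).ennreal_ofReal.aemeasurable hall
    simp only at e1
    rw [← e1, hmap, lintegral_prod _ (hq.norm.pow_const 2).ennreal_ofReal.aemeasurable]
    calc _ ≤ ∫⁻ _q, ENNReal.ofReal (batchVariance n d B γ G Δ) ∂(P.map fun ω => (X ω, A ω)) := by
          refine lintegral_mono_ae ?_
          filter_upwards [hS'] with q hqS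
          obtain ⟨m1, m2, -⟩ := hfix q.1 hqS
          have e2 := lintegral_map (μ := P)
            (f := fun z : Fin B → Ξ × Stack n d => ENNReal.ofReal (‖batchNoise 𝒟 γ f δ q.1 z‖ ^ 2))
            ((hx q.1).norm.pow_const 2).ennreal_ofReal hZb
          have i2 : Integrable (fun ω => ‖batchNoise 𝒟 γ f δ q.1 fun j => Z j ω‖ ^ 2) P := by
            simpa using m1.integrable_norm_pow two_ne_zero
          rw [e2, ← ofReal_integral_eq_lintegral_ofReal i2
            (Filter.Eventually.of_forall fun ω => sq_nonneg _)]
          exact ENNReal.ofReal_le_ofReal m2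
      _ = _ := by simp
  refine ⟨key.1, key.2, ?_⟩
  have hi := integrable_inner_of_memLp_two key.1 hA2
  have hqi : Measurable fun q : (Stack n d × Stack n d) × (Fin B → Ξ × Stack n d) =>
      (inner ℝ (batchNoise 𝒟 γ f δ q.1.1 q.2) q.1.2 : ℝ) := hq.inner (by fun_prop)
  have hi2 := (integrable_map_measure hqi.aestronglyMeasurable hall).2 hi
  have e1 := integral_map hall hqi.aestronglyMeasurable
  simp only at e1
  rw [hmap] at hi2 e1
  rw [← e1, integral_prod _ hi2]
  refine integral_eq_zero_of_ae ?_
  filter_upwards [hS'] with q hqS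
  obtain ⟨m1, -, m3⟩ := hfix q.1 hqS
  have hi3 : Integrable (fun z => batchNoise 𝒟 γ f δ q.1 z) (P.map fun ω j => Z j ω) :=
    (integrable_map_measure (hx q.1).aestronglyMeasurable hZb.aemeasurable).2
      (m1.integrable one_le_two)
  have h2 : ∫ z, inner ℝ q.2 (batchNoise 𝒟 γ f δ q.1 z) ∂(P.map fun ω j => Z j ω)
      = inner ℝ q.2 (∫ z, batchNoise 𝒟 γ f δ q.1 z ∂(P.map fun ω j => Z j ω)) :=
    integral_inner hi3 q.2
  have h3 := integral_map (μ := P) hZb.aemeasurable (hx q.1).aestronglyMeasurable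
  rw [h3, m3, inner_zero_right] at h2
  simpa only [real_inner_comm, Pi.zero_apply] using h2

end Batch

/-! ### Recursion on shrinking events -/

section Recursion

/-- E and E' are successive stay-in-S events, and Q between them is decided by the past.
Nonnegativity of the bound on Q and of J off Q lets the integral over E' be extended to all of Ω,
where the mean of J is known. -/
theorem setIntegral_le_of_step {Ω : Type*} [MeasurableSpace Ω] {P : Measure Ω}
    {E E' Q : Set Ω} {V V' J : Ω → ℝ} {q c : ℝ} (hE' : MeasurableSet E')
    (hQ : MeasurableSet Q) (hEQ : E' ⊆ Q) (hQE : Q ⊆ E) (hV : IntegrableOn V E P)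
    (hV0 : ∀ ω, 0 ≤ V ω) (hVm : Measurable V') (hV0' : ∀ ω, 0 ≤ V' ω) (hJ : Integrable J P)
    (hJc : ∫ ω, J ω ∂P ≤ c) (hq : 0 ≤ q) (h1 : ∀ ω ∈ E', V' ω ≤ q * V ω + J ω)
    (h2 : ∀ ω ∈ Q, 0 ≤ q * V ω + J ω) (h3 : ∀ ω ∉ Q, 0 ≤ J ω) :
    IntegrableOn V' E' P ∧ ∫ ω in E', V' ω ∂P ≤ q * ∫ ω in E, V ω ∂P + c := by
  have hVQ : Integrable (Q.indicator V) P := (hV.mono_set hQE).integrable_indicator hQ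
  have hR : Integrable (fun ω => q * Q.indicator V ω + J ω) P := (hVQ.const_mul q).add hJ
  have hle : ∀ ω, E'.indicator V' ω ≤ q * Q.indicator V ω + J ω := fun ω => by
    by_cases hω' : ω ∈ E'
    · rw [Set.indicator_of_mem hω', Set.indicator_of_mem (hEQ hω')]
      exact h1 ω hω'
    · rw [Set.indicator_of_notMem hω']
      by_cases hω : ω ∈ Q
      · rw [Set.indicator_of_mem hω]; exact h2 ω hω
      · rw [Set.indicator_of_notMem hω]; simpa using h3 ω hω
  have hi : Integrable (E'.indicator V') P := by
    refine hR.mono' (hVm.indicator hE').aestronglyMeasurable (Filter.Eventually.of_forall fun ω => ?_)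
    rw [Real.norm_eq_abs, abs_of_nonneg (Set.indicator_nonneg (fun ω _ => hV0' ω) ω)]
    exact hle ω
  refine ⟨(integrable_indicator_iff hE').1 hi, ?_⟩
  rw [← integral_indicator hE']
  have h4 : ∫ ω in Q, V ω ∂P ≤ ∫ ω in E, V ω ∂P :=
    setIntegral_mono_set hV (Filter.Eventually.of_forall hV0) (Filter.Eventually.of_forall hQE)
  calc _ ≤ ∫ ω, (q * Q.indicator V ω + J ω) ∂P := integral_mono hi hR hle
    _ = q * ∫ ω in Q, V ω ∂P + ∫ ω, J ω ∂P := by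
        rw [integral_add (hVQ.const_mul q) hJ, integral_const_mul, integral_indicator hQ]
    _ ≤ _ := by gcongr

/-- c/ρ is the fixed point of the recursion, and the distance above it contracts. -/
theorem le_pow_mul_add_div {a : ℕ → ℝ} {ρ c : ℝ} (hρ : 0 < ρ) (hρ1 : ρ ≤ 1)
    (N : ℕ) (h : ∀ k < N, a (k + 1) ≤ (1 - ρ) * a k + c) :
    a N - c / ρ ≤ (1 - ρ) ^ N * (a 0 - c / ρ) := by
  induction N with
  | zero => simp
  | succ N ih =>
    have h1 := ih fun k hk => h k (hk.trans N.lt_succ_self)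
    have h2 := h N N.lt_succ_self
    have h3 := mul_le_mul_of_nonneg_left h1 (sub_nonneg.2 hρ1)
    have e : (1 - ρ) * (c / ρ) = c / ρ - c := by field_simp
    rw [pow_succ]
    linarith

end Recursion

/-! ### Measurability of the iterates -/

section Measurability

variable {n d B : ℕ}

theorem continuous_gossipMul (W : Matrix (Fin n) (Fin n) ℝ) :
    Continuous (gossipMul W : Stack n d → Stack n d) := by
  unfold gossipMul
  refine (PiLp.continuous_toLp 2 _).comp (continuous_pi fun i => ?_)
  refine continuous_finsetSum _ fun j _ => ?_
  have h : Continuous fun x : Stack n d => x j :=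
    PiLp.continuous_apply 2 (fun _ : Fin n => EuclideanSpace ℝ (Fin d)) j
  exact (continuous_const (y := W i j)).smul h

/-- The linear system for the two coupled iterates, solved. -/
theorem IsSADOM.coupled_solution {p : Params} {W : ℕ → Matrix (Fin n) (Fin n) ℝ}
    {g : ℕ → Stack n d → Stack n d} {x0 y0 z0 m0 : Stack n d} {T : Iterates n d}
    (h : IsSADOM p W g x0 y0 z0 m0 T) (hη : 0 ≤ p.η) (hα : 0 ≤ p.α) (hβ : 0 ≤ p.β) (hθ : 0 ≤ p.θ)
    (k : ℕ) :
    T.x (k + 1) = ((1 + p.η * p.α) * (1 + p.θ * p.β) + p.η * p.θ)⁻¹ •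
      ((1 + p.θ * p.β) • (T.x k + (p.η * p.α) • T.xg k - p.η • (g k (T.xg k) - p.ν • T.xg k))
        + p.η • (T.y k + (p.θ * p.β) • (g k (T.xg k) - p.ν • T.xg k)
          - (p.θ * p.ν⁻¹) • (T.yg k + T.zg k))) ∧
    T.y (k + 1) = (1 + p.θ * p.β)⁻¹ •
      (T.y k + (p.θ * p.β) • (g k (T.xg k) - p.ν • T.xg k)
          - (p.θ * p.ν⁻¹) • (T.yg k + T.zg k) - p.θ • T.x (k + 1)) := by
  have hx := h.x_succ k
  have hy := h.y_succ k
  generalize T.x (k + 1) = x' at *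
  generalize T.y (k + 1) = y' at *
  have h1 : 0 < (1 + p.η * p.α) * (1 + p.θ * p.β) + p.η * p.θ := by positivity
  have h2 : 0 < 1 + p.θ * p.β := by positivity
  constructor
  · rw [eq_inv_smul_iff₀ h1.ne']
    linear_combination (norm := module) (1 + p.θ * p.β) • hx + p.η • hy
  · rw [eq_inv_smul_iff₀ h2.ne']
    linear_combination (norm := module) hy

variable {Ω : Type*}

/-- All the sequences are measurable at time `k`. -/
structure MeasurableIterates [MeasurableSpace Ω] (T : Ω → Iterates n d) (k : ℕ) : Prop where
  x : Measurable fun ω => (T ω).x k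
  xf : Measurable fun ω => (T ω).xf k
  y : Measurable fun ω => (T ω).y k
  yf : Measurable fun ω => (T ω).yf k
  z : Measurable fun ω => (T ω).z k
  zf : Measurable fun ω => (T ω).zf k
  m : Measurable fun ω => (T ω).m k

variable {p : Params} {W : ℕ → Matrix (Fin n) (Fin n) ℝ} {g : Ω → ℕ → Stack n d → Stack n d}
  {x0 y0 z0 m0 : Stack n d} {T : Ω → Iterates n d}

theorem MeasurableIterates.zero [MeasurableSpace Ω]
    (h : ∀ ω, IsSADOM p W (g ω) x0 y0 z0 m0 (T ω)) : MeasurableIterates T 0 where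
  x := by simp only [(h _).x_zero, measurable_const]
  xf := by simp only [(h _).xf_zero, measurable_const]
  y := by simp only [(h _).y_zero, measurable_const]
  yf := by simp only [(h _).yf_zero, measurable_const]
  z := by simp only [(h _).z_zero, measurable_const]
  zf := by simp only [(h _).zf_zero, measurable_const]
  m := by simp only [(h _).m_zero, measurable_const]

theorem MeasurableIterates.xg [MeasurableSpace Ω]
    (h : ∀ ω, IsSADOM p W (g ω) x0 y0 z0 m0 (T ω)) {k : ℕ} (hk : MeasurableIterates T k) :
    Measurable fun ω => (T ω).xg k := by
  simp only [(h _).xg_eq]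
  exact (hk.x.const_smul p.τ₁).add (hk.xf.const_smul (1 - p.τ₁))

theorem MeasurableIterates.succ [MeasurableSpace Ω]
    (h : ∀ ω, IsSADOM p W (g ω) x0 y0 z0 m0 (T ω)) (hη : 0 ≤ p.η) (hα : 0 ≤ p.α) (hβ : 0 ≤ p.β)
    (hθ : 0 ≤ p.θ) {k : ℕ} (hk : MeasurableIterates T k)
    (hg : Measurable fun ω => g ω k ((T ω).xg k)) : MeasurableIterates T (k + 1) := by
  have hxg := hk.xg h
  have hyg : Measurable fun ω => (T ω).yg k := by
    simp only [(h _).yg_eq]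
    exact (hk.y.const_smul p.ϑ₁).add (hk.yf.const_smul (1 - p.ϑ₁))
  have hzg : Measurable fun ω => (T ω).zg k := by
    simp only [(h _).zg_eq]
    exact (hk.z.const_smul p.ϑ₁).add (hk.zf.const_smul (1 - p.ϑ₁))
  have hG := hg.sub (hxg.const_smul p.ν)
  have hyz := hyg.add hzg
  have hbv := (hk.y.add (hG.const_smul (p.θ * p.β))).sub (hyz.const_smul (p.θ * p.ν⁻¹))
  have hx : Measurable fun ω => (T ω).x (k + 1) := by
    simp only [((h _).coupled_solution hη hα hβ hθ k).1]
    exact ((((hk.x.add (hxg.const_smul (p.η * p.α))).sub (hG.const_smul p.η)).const_smul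
      (1 + p.θ * p.β)).add (hbv.const_smul p.η)).const_smul
      ((1 + p.η * p.α) * (1 + p.θ * p.β) + p.η * p.θ)⁻¹
  have hy : Measurable fun ω => (T ω).y (k + 1) := by
    simp only [((h _).coupled_solution hη hα hβ hθ k).2]
    exact (hbv.sub (hx.const_smul p.θ)).const_smul (1 + p.θ * p.β)⁻¹
  have hq := (hyz.const_smul (p.ϰ * p.ν⁻¹)).add hk.m
  have hWq := (continuous_gossipMul (W k)).measurable.comp hq
  have hWz := (continuous_gossipMul (W k)).measurable.comp hyz
  refine ⟨hx, ?_, hy, ?_, ?_, ?_, ?_⟩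
  · simp only [(h _).xf_succ]
    exact hxg.add ((hx.sub hk.x).const_smul p.τ₂)
  · simp only [(h _).yf_succ]
    exact hyg.add ((hy.sub hk.y).const_smul p.ϑ₂)
  · simp only [(h _).z_succ]
    exact (hk.z.add ((hzg.sub hk.z).const_smul (p.ϰ * p.ϖ))).sub hWq
  · simp only [(h _).zf_succ]
    exact hzg.sub (hWz.const_smul p.ζ)
  · simp only [(h _).m_succ]
    exact hq.sub hWq

theorem MeasurableIterates.mono {m₁ m₂ : MeasurableSpace Ω} (hm : m₁ ≤ m₂) {k : ℕ}
    (h : @MeasurableIterates n d Ω m₁ T k) : @MeasurableIterates n d Ω m₂ T k :=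
  ⟨(@MeasurableIterates.x n d Ω m₁ T k h).mono hm le_rfl,
    (@MeasurableIterates.xf n d Ω m₁ T k h).mono hm le_rfl,
    (@MeasurableIterates.y n d Ω m₁ T k h).mono hm le_rfl,
    (@MeasurableIterates.yf n d Ω m₁ T k h).mono hm le_rfl,
    (@MeasurableIterates.z n d Ω m₁ T k h).mono hm le_rfl,
    (@MeasurableIterates.zf n d Ω m₁ T k h).mono hm le_rfl,
    (@MeasurableIterates.m n d Ω m₁ T k h).mono hm le_rfl⟩

end Measurability

/-! ### The past of the run and its independence of the current batch -/

section History

variable {B : ℕ} {Ω 𝒵 : Type*} [MeasurableSpace Ω] [MeasurableSpace 𝒵] {P : Measure Ω}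
  {Z : ℕ × Fin B → Ω → 𝒵}

/-- The information contained in the samples of the iterations before `k`. -/
@[reducible] def history (Z : ℕ × Fin B → Ω → 𝒵) (k : ℕ) : MeasurableSpace Ω :=
  ⨆ s ∈ {s : ℕ × Fin B | s.1 < k}, MeasurableSpace.comap (Z s) inferInstance

theorem history_mono (Z : ℕ × Fin B → Ω → 𝒵) {k l : ℕ} (hkl : k ≤ l) :
    history Z k ≤ history Z l :=
  biSup_mono fun _ hs => lt_of_lt_of_le hs hkl

theorem history_le (hZ : ∀ s, Measurable (Z s)) (k : ℕ) : history Z k ≤ ‹MeasurableSpace Ω› :=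
  iSup₂_le fun s _ => (hZ s).comap_le

theorem measurable_history_batch (Z : ℕ × Fin B → Ω → 𝒵) {k l : ℕ} (hkl : k < l) :
    Measurable[history Z l] fun ω j => Z (k, j) ω := by
  refine @measurable_pi_lambda _ _ _ (history Z l) _ _ fun j => ?_
  refine Measurable.of_comap_le ?_
  exact le_iSup₂_of_le (f := fun (s : ℕ × Fin B) (_ : s ∈ {s : ℕ × Fin B | s.1 < l}) =>
    MeasurableSpace.comap (Z s) inferInstance) (k, j) hkl le_rfl

/-- The past and the current batch are generated by samples with disjoint index sets. -/
theorem indepFun_history_batch (hZ : ∀ s, Measurable (Z s)) (hind : iIndepFun Z P) {𝒳 : Type*}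
    [MeasurableSpace 𝒳] {k : ℕ} {X : Ω → 𝒳} (hX : Measurable[history Z k] X) :
    IndepFun X (fun ω j => Z (k, j) ω) P := by
  have h := indep_iSup_of_disjoint (fun s => (hZ s).comap_le) hind
    (S := {s : ℕ × Fin B | s.1 < k}) (T := {s | s.1 = k})
    (Set.disjoint_left.2 fun s hs hs' => (lt_irrefl k) (by
      have h1 : s.1 < k := hs
      have h2 : s.1 = k := hs'
      omega))
  refine indep_of_indep_of_le_left (indep_of_indep_of_le_right h ?_) hX.comap_le
  have hm : Measurable[⨆ s ∈ {s : ℕ × Fin B | s.1 = k}, MeasurableSpace.comap (Z s) inferInstance]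
      fun ω j => Z (k, j) ω := by
    refine @measurable_pi_lambda _ _ _ (_) _ _ fun j => ?_
    refine Measurable.of_comap_le ?_
    exact le_iSup₂_of_le (f := fun (s : ℕ × Fin B) (_ : s ∈ {s : ℕ × Fin B | s.1 = k}) =>
      MeasurableSpace.comap (Z s) inferInstance) (k, j) rfl le_rfl
  exact hm.comap_le

end History

/-! ### Decrease of the potential in expectation -/

section Expectation

variable {n d B : ℕ} {Ω Ξ : Type*} [MeasurableSpace Ω] {P : Measure Ω} [IsProbabilityMeasure P]
  [MeasurableSpace Ξ] {𝒟 : Measure Ξ} [IsProbabilityMeasure 𝒟]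
  {f : Fin n → EuclideanSpace ℝ (Fin d) → Ξ → ℝ} {δ : Stack n d → Ξ → ℝ} {γ : ℝ}
  {S : Set (Stack n d)} {G Δ : ℝ} {Z : ℕ × Fin B → Ω → Ξ × Stack n d}
  {W : ℕ → Matrix (Fin n) (Fin n) ℝ} {x0 y0 z0 m0 : Stack n d} {T : Ω → Iterates n d}

theorem measurableIterates_history {p : Params}
    (hf : ∀ i, Measurable fun p : EuclideanSpace ℝ (Fin d) × Ξ => f i p.1 p.2)
    (hδ : Measurable fun p : Stack n d × Ξ => δ p.1 p.2)
    (h : ∀ ω, IsSADOM p W (fun k x => opfBatch γ f δ x (fun j => (Z (k, j) ω).1)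
      fun j => (Z (k, j) ω).2) x0 y0 z0 m0 (T ω))
    (hη : 0 ≤ p.η) (hα : 0 ≤ p.α) (hβ : 0 ≤ p.β) (hθ : 0 ≤ p.θ) (k : ℕ) :
    @MeasurableIterates n d Ω (history Z k) T k := by
  induction k with
  | zero => exact @MeasurableIterates.zero n d Ω p W _ x0 y0 z0 m0 T (history Z 0) h
  | succ k ih =>
    have hm := ih.mono (history_mono Z k.le_succ)
    have hxg := @MeasurableIterates.xg n d Ω p W _ x0 y0 z0 m0 T (history Z (k + 1)) h k hm
    refine @MeasurableIterates.succ n d Ω p W _ x0 y0 z0 m0 T (history Z (k + 1)) h hη hα hβ hθ k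
      hm ?_
    have h1 := hxg.prodMk (measurable_history_batch Z k.lt_succ_self)
    have h2 := (measurable_opfBatch (γ := γ) (B := B) hf hδ).comp h1
    simpa only [Function.comp_def] using h2

theorem measurableSet_staysIn {p : Params} {g : Ω → ℕ → Stack n d → Stack n d}
    (h : ∀ ω, IsSADOM p W (g ω) x0 y0 z0 m0 (T ω)) (hS : MeasurableSet S)
    (hT : ∀ k, @MeasurableIterates n d Ω (history Z k) T k) (k : ℕ) :
    MeasurableSet[history Z k] {ω | StaysIn S k (T ω)} := by
  have e : {ω | StaysIn S k (T ω)} = (⋂ j ∈ {j | j < k}, (fun ω => (T ω).xg j) ⁻¹' S)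
      ∩ ⋂ j ∈ {j | j ≤ k}, (fun ω => (T ω).xf j) ⁻¹' S := by
    ext ω; simp [StaysIn]
  rw [e]
  refine MeasurableSet.inter ?_ ?_
  · refine MeasurableSet.biInter (Set.to_countable _) fun j hj => ?_
    have h1 := @MeasurableIterates.xg n d Ω p W _ x0 y0 z0 m0 T (history Z j) h j (hT j)
    exact history_mono Z (le_of_lt hj) _ (h1 hS)
  · refine MeasurableSet.biInter (Set.to_countable _) fun j hj => ?_
    have h1 := @MeasurableIterates.xf n d Ω (history Z j) T j (hT j)
    exact history_mono Z hj _ (h1 hS)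

theorem MeasurableIterates.potential {μ χ t τ : ℝ} {H : Stack n d → ℝ} (hH : Measurable H)
    (xs : Stack n d) {k : ℕ} (hk : MeasurableIterates T k) :
    Measurable fun ω => potential μ χ t τ H xs (T ω) k := by
  have hP : Measurable fun ω => (perpSubmodule n d).starProjection ((T ω).m k) :=
    (perpSubmodule n d).starProjection.continuous.measurable.comp hk.m
  have h1 := hk.x
  have h2 := hk.xf
  have h3 := hk.y
  have h4 := hk.yf
  have h5 := hk.z
  have h6 := hk.zf
  have hi : Measurable fun ω => (inner ℝ (gradient H xs) ((T ω).xf k - xs) : ℝ) :=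
    measurable_const.inner (h2.sub_const xs)
  have hHx : Measurable fun ω => H ((T ω).xf k) := hH.comp h2
  unfold _root_.potential reducedBregman bregman
  fun_prop

variable {𝒢 : ℕ → SimpleGraph (Fin n)} {μ χ t τ ℓ : ℝ} {H : Stack n d → ℝ} {xs : Stack n d}

theorem setIntegral_potential_succ_le (hn : 1 ≤ n) (hd : 1 ≤ d) (hB : 1 ≤ B) (hγ : 0 < γ)
    (hf : ∀ i, Measurable fun p : EuclideanSpace ℝ (Fin d) × Ξ => f i p.1 p.2)
    (hδ : Measurable fun p : Stack n d × Ξ => δ p.1 p.2) (hΔ : ∀ x ξ, |δ x ξ| ≤ Δ) (hΔ0 : 0 ≤ Δ)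
    (hG : SecondMomentBound 𝒟 f (neigh S γ) G) (hS : MeasurableSet S)
    (hZ : ∀ s, Measurable (Z s)) (hlaw : ∀ s, P.map (Z s) = 𝒟.prod (uniformSphere n d))
    (hind : iIndepFun Z P)
    (h : ∀ ω, IsSADOM (sadomParams μ χ (μ / τ ^ 2) (t ^ 2 / μ)) W
      (fun k x => opfBatch γ f δ x (fun j => (Z (k, j) ω).1) fun j => (Z (k, j) ω).2)
      x0 y0 z0 m0 (T ω))
    (hT : ∀ k, @MeasurableIterates n d Ω (history Z k) T k)
    (hW : IsGossip 𝒢 W χ) (hz : z0 ∈ consensusPerp n d)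
    (hμ : 0 < μ) (hχ : 1 ≤ χ) (ht : 0 < t) (ht1 : t ≤ 1 / 2) (hτ : 0 < τ)
    (hτt : τ ^ 2 = 2 * t ^ 2) (hℓ0 : 0 ≤ ℓ) (hℓ : 8 * (t ^ 2 / μ) * ℓ ≤ 1)
    (hreg : IsRegularOn H S μ ℓ) (hHm : Measurable H)
    (hgrad : ∀ x, gradient H x = sphereGrad γ (meanF 𝒟 f) x)
    (hxs : xs ∈ S) (hxc : xs ∈ consensus n d)
    (hgr : gradient H xs ∈ perpSubmodule n d) (k : ℕ)
    (hV : IntegrableOn (fun ω => potential μ χ t τ H xs (T ω) k) {ω | StaysIn S k (T ω)} P) :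
    IntegrableOn (fun ω => potential μ χ t τ H xs (T ω) (k + 1))
      {ω | StaysIn S (k + 1) (T ω)} P ∧
    ∫ ω in {ω | StaysIn S (k + 1) (T ω)}, potential μ χ t τ H xs (T ω) (k + 1) ∂P
      ≤ (1 - t / (100 * χ)) * ∫ ω in {ω | StaysIn S k (T ω)}, potential μ χ t τ H xs (T ω) k ∂P
        + (5 * (t ^ 2 / μ) / τ * batchVariance n d B γ G Δ
          + 12 / μ * (√((n * d : ℕ) : ℝ) * Δ / γ) ^ 2) := by
  have hρ : t / (100 * χ) ≤ 1 := by
    rw [div_le_iff₀ (by positivity)]; linarith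
  have hhist := history_le hZ
  have hEm := measurableSet_staysIn h hS hT
  have hxg := @MeasurableIterates.xg n d Ω _ W _ x0 y0 z0 m0 T (history Z k) h k (hT k)
  have hxk := @MeasurableIterates.x n d Ω (history Z k) T k (hT k)
  -- Membership of x_g^k in S is known before the samples of step k are drawn, membership of
  -- x_f^{k+1} is not.
  set Q : Set Ω := {ω | StaysIn S k (T ω)} ∩ (fun ω => (T ω).xg k) ⁻¹' S with hQ
  have hQm : MeasurableSet[history Z k] Q := (hEm k).inter (hxg hS)
  have hQE : Q ⊆ {ω | StaysIn S k (T ω)} := Set.inter_subset_left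
  have hEQ : {ω | StaysIn S (k + 1) (T ω)} ⊆ Q := fun ω hω =>
    ⟨⟨fun j hj => hω.1 j (by omega), fun j hj => hω.2 j (by omega)⟩, hω.1 k (by omega)⟩
  classical
  -- Off Q the query point is replaced by xs ∈ S and the weight A by 0. The moment bounds then hold
  -- on all of Ω, and both variables still depend only on the past.
  set X : Ω → Stack n d := Q.piecewise (fun ω => (T ω).xg k) (fun _ => xs) with hX
  set A : Ω → Stack n d := Q.indicator (fun ω => (T ω).x k - xs) with hA
  have hXm : Measurable[history Z k] X := Measurable.piecewise hQm hxg measurable_const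
  have hAm : Measurable[history Z k] A := (hxk.sub_const xs).indicator hQm
  have hXS : ∀ ω, X ω ∈ S := fun ω => by
    by_cases hω : ω ∈ Q
    · rw [hX, Set.piecewise_eq_of_mem _ _ _ hω]; exact hω.2
    · rw [hX, Set.piecewise_eq_of_notMem _ _ _ hω]; exact hxs
  have hA2 : MemLp A 2 P := by
    have hAs : AEStronglyMeasurable A P := (hAm.mono (hhist k) le_rfl).aestronglyMeasurable
    rw [memLp_two_iff_integrable_sq_norm hAs]
    have hVQ := ((hV.mono_set hQE).integrable_indicator (hhist k _ hQm)).const_mul (τ / (3 * μ))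
    refine hVQ.mono' (hAs.norm.pow 2) (Filter.Eventually.of_forall fun ω => ?_)
    rw [Real.norm_eq_abs, abs_of_nonneg (sq_nonneg _)]
    by_cases hω : ω ∈ Q
    · simp only [hA, Set.indicator_of_mem hω]
      have h1 := potential_ge (H := H) (τ := τ) hμ hχ ht xs (T ω) k
      have h0 : 0 ≤ 2 / τ * reducedBregman μ H xs ((T ω).xf k) :=
        mul_nonneg (by positivity) (le_trans (by positivity) (hreg.reducedBregman_ge xs _))
      have h2 := mul_le_mul_of_nonneg_left (by linarith : 3 * μ / τ * ‖(T ω).x k - xs‖ ^ 2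
        ≤ potential μ χ t τ H xs (T ω) k) (by positivity : 0 ≤ τ / (3 * μ))
      refine le_trans (le_of_eq ?_) h2
      field_simp
    · simp [hA, Set.indicator_of_notMem hω]
  obtain ⟨m1, m2, m3⟩ := batchNoise_moments_of_indep (𝒟 := 𝒟) (P := P) hn hd hB hγ.le hf hδ hΔ hG hS
    (fun j => hZ (k, j)) (fun j => hlaw (k, j))
    (fun i j hij => hind.indepFun (fun he => hij (Prod.mk.inj he).2))
    (hXm.mono (hhist k) le_rfl) (hAm.mono (hhist k) le_rfl) hXS hA2
    (indepFun_history_batch hZ hind (hXm.prodMk hAm))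
  set v : Ω → Stack n d := fun ω => batchNoise 𝒟 γ f δ (X ω) fun j => Z (k, j) ω with hv
  set b : Ω → Stack n d := fun ω => opfMean 𝒟 γ f δ (X ω) - gradient H (X ω) with hb
  set r := √((n * d : ℕ) : ℝ) * Δ / γ with hr
  have hbr : ∀ ω, 12 / μ * ‖b ω‖ ^ 2 ≤ 12 / μ * r ^ 2 := fun ω => by
    have h1 := norm_opfMean_sub_le hn hd hγ hf hδ hΔ hΔ0 hG (hXS ω)
    rw [← hgrad] at h1
    have h2 : ‖b ω‖ ^ 2 ≤ r ^ 2 := pow_le_pow_left₀ (norm_nonneg _) h1 2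
    exact mul_le_mul_of_nonneg_left h2 (by positivity)
  have i1 : Integrable (fun ω => inner ℝ (v ω) (A ω)) P := integrable_inner_of_memLp_two m1 hA2
  have i2 : Integrable (fun ω => ‖v ω‖ ^ 2) P := by
    simpa using m1.integrable_norm_pow two_ne_zero
  set c1 := 5 * (t ^ 2 / μ) / τ with hc1
  have hc1' : 0 ≤ c1 := by positivity
  have i3 : Integrable (fun ω => -2 * inner ℝ (v ω) (A ω) + c1 * ‖v ω‖ ^ 2) P :=
    (i1.const_mul _).add (i2.const_mul _)
  refine setIntegral_le_of_step (Q := Q)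
    (J := fun ω => -2 * inner ℝ (v ω) (A ω) + c1 * ‖v ω‖ ^ 2 + 12 / μ * r ^ 2)
    (hhist _ _ (hEm (k + 1))) (hhist _ _ hQm) hEQ hQE hV
    (fun ω => hreg.potential_nonneg hμ hχ ht hτ xs (T ω) k)
    (((hT (k + 1)).mono (hhist (k + 1))).potential hHm xs)
    (fun ω => hreg.potential_nonneg hμ hχ ht hτ xs (T ω) (k + 1))
    (i3.add (integrable_const _)) ?_ (by linarith) ?_ ?_ ?_
  · rw [integral_add i3 (integrable_const _), integral_add (i1.const_mul _) (i2.const_mul _),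
      integral_const_mul, integral_const_mul, m3]
    simp only [integral_const, probReal_univ, one_smul, mul_zero, zero_add]
    gcongr
  · intro ω hω
    have hωQ := hEQ hω
    have hXω : X ω = (T ω).xg k := by rw [hX, Set.piecewise_eq_of_mem _ _ _ hωQ]
    have hAω : A ω = (T ω).x k - xs := by rw [hA, Set.indicator_of_mem hωQ]
    have h1 := (h ω).potential_succ_le hW hz hμ hχ ht ht1 hτ hτt hℓ0 hℓ hreg hxs hxc hgr k
      hωQ.2 (hω.2 (k + 1) le_rfl) (b := b ω) (v := v ω) (by
        simp only [hb, hv, batchNoise, hXω]; abel)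
    have h2 := hbr ω
    rw [hAω]
    linarith
  · intro ω hω
    have hAω : A ω = (T ω).x k - xs := by rw [hA, Set.indicator_of_mem hω]
    have h1 := hreg.contracted_potential_nonneg hμ hχ ht ht1 hτ hτt xs (b ω) (v ω) (T ω) k
    have h2 := hbr ω
    rw [hAω]
    linarith
  · intro ω hω
    have hAω : A ω = 0 := by rw [hA, Set.indicator_of_notMem hω]
    simp only [hAω, inner_zero_right]
    positivity

/-- The potential decreases linearly in expectation, up to the level of the noise. -/
theorem setIntegral_potential_le (hn : 1 ≤ n) (hd : 1 ≤ d) (hB : 1 ≤ B) (hγ : 0 < γ)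
    (hf : ∀ i, Measurable fun p : EuclideanSpace ℝ (Fin d) × Ξ => f i p.1 p.2)
    (hδ : Measurable fun p : Stack n d × Ξ => δ p.1 p.2) (hΔ : ∀ x ξ, |δ x ξ| ≤ Δ) (hΔ0 : 0 ≤ Δ)
    (hG : SecondMomentBound 𝒟 f (neigh S γ) G) (hS : MeasurableSet S)
    (hZ : ∀ s, Measurable (Z s)) (hlaw : ∀ s, P.map (Z s) = 𝒟.prod (uniformSphere n d))
    (hind : iIndepFun Z P)
    (h : ∀ ω, IsSADOM (sadomParams μ χ (μ / τ ^ 2) (t ^ 2 / μ)) W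
      (fun k x => opfBatch γ f δ x (fun j => (Z (k, j) ω).1) fun j => (Z (k, j) ω).2)
      x0 y0 z0 m0 (T ω))
    (hT : ∀ k, @MeasurableIterates n d Ω (history Z k) T k)
    (hW : IsGossip 𝒢 W χ) (hz : z0 ∈ consensusPerp n d)
    (hμ : 0 < μ) (hχ : 1 ≤ χ) (ht : 0 < t) (ht1 : t ≤ 1 / 2) (hτ : 0 < τ)
    (hτt : τ ^ 2 = 2 * t ^ 2) (hℓ0 : 0 ≤ ℓ) (hℓ : 8 * (t ^ 2 / μ) * ℓ ≤ 1)
    (hreg : IsRegularOn H S μ ℓ) (hHm : Measurable H)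
    (hgrad : ∀ x, gradient H x = sphereGrad γ (meanF 𝒟 f) x)
    (hxs : xs ∈ S) (hxc : xs ∈ consensus n d)
    (hgr : gradient H xs ∈ perpSubmodule n d) (N : ℕ) :
    IntegrableOn (fun ω => potential μ χ t τ H xs (T ω) N) {ω | StaysIn S N (T ω)} P ∧
    τ / 2 * ∫ ω in {ω | StaysIn S N (T ω)}, potential μ χ t τ H xs (T ω) N ∂P
      ≤ 51 * (1 - t / (100 * χ)) ^ N * initialError μ χ H xs x0 y0 z0 m0
        + τ / 2 * ((5 * (t ^ 2 / μ) / τ * batchVariance n d B γ G Δ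
          + 12 / μ * (√((n * d : ℕ) : ℝ) * Δ / γ) ^ 2) / (t / (100 * χ))) := by
  have hρ0 : 0 < t / (100 * χ) := by positivity
  have hρ : t / (100 * χ) ≤ 1 := by
    rw [div_le_iff₀ (by positivity)]; linarith
  have hhist := history_le hZ
  have hEm := measurableSet_staysIn h hS hT
  have hstep := setIntegral_potential_succ_le hn hd hB hγ hf hδ hΔ hΔ0 hG hS hZ hlaw hind h hT hW hz
    hμ hχ ht ht1 hτ hτt hℓ0 hℓ hreg hHm hgrad hxs hxc hgr
  have hbr : 0 ≤ bregman H x0 xs := by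
    have h1 := hreg.strong x0 xs
    have h2 : 0 ≤ μ / 2 * ‖x0 - xs‖ ^ 2 := by positivity
    unfold bregman
    linarith
  have h0 : ∀ ω, potential μ χ t τ H xs (T ω) 0
      ≤ 2 / τ * (51 * initialError μ χ H xs x0 y0 z0 m0) := fun ω => by
    have h1 := mul_le_mul_of_nonneg_left
      ((h ω).potential_zero_le hμ hχ ht ht1 hτ hτt xs hbr) (by positivity : 0 ≤ 2 / τ)
    rw [← mul_assoc] at h1
    rwa [show 2 / τ * (τ / 2) = 1 by field_simp, one_mul] at h1
  have hnn : ∀ ω k, 0 ≤ potential μ χ t τ H xs (T ω) k := fun ω k =>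
    hreg.potential_nonneg hμ hχ ht hτ xs (T ω) k
  have hI0 : Integrable (fun ω => potential μ χ t τ H xs (T ω) 0) P := by
    refine Integrable.mono' (integrable_const (2 / τ * (51 * initialError μ χ H xs x0 y0 z0 m0)))
      (((hT 0).mono (hhist 0)).potential hHm xs).aestronglyMeasurable
      (Filter.Eventually.of_forall fun ω => ?_)
    rw [Real.norm_eq_abs, abs_of_nonneg (hnn ω 0)]
    exact h0 ω
  have hI : ∀ k, IntegrableOn (fun ω => potential μ χ t τ H xs (T ω) k)
      {ω | StaysIn S k (T ω)} P := by
    intro k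
    induction k with
    | zero => exact hI0.integrableOn
    | succ k ih => exact (hstep k ih).1
  refine ⟨hI N, ?_⟩
  set c := 5 * (t ^ 2 / μ) / τ * batchVariance n d B γ G Δ
          + 12 / μ * (√((n * d : ℕ) : ℝ) * Δ / γ) ^ 2 with hc
  have hc0 : 0 ≤ c := by
    have := batchVariance_nonneg n d B γ G Δ
    positivity
  have h1 := le_pow_mul_add_div (a := fun k => ∫ ω in {ω | StaysIn S k (T ω)},
    potential μ χ t τ H xs (T ω) k ∂P) hρ0 hρ N fun k _ => (hstep k (hI k)).2
  have h2 : ∫ ω in {ω | StaysIn S 0 (T ω)}, potential μ χ t τ H xs (T ω) 0 ∂P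
      ≤ 2 / τ * (51 * initialError μ χ H xs x0 y0 z0 m0) := by
    refine (setIntegral_le_integral hI0 (Filter.Eventually.of_forall fun ω => hnn ω 0)).trans ?_
    refine (integral_mono hI0 (integrable_const _) h0).trans (le_of_eq (by simp))
  have hp : 0 ≤ (1 - t / (100 * χ)) ^ N := pow_nonneg (by linarith) N
  have hcρ : 0 ≤ c / (t / (100 * χ)) := by positivity
  have h3 := mul_le_mul_of_nonneg_left (show _ ≤ _ from h1) (by positivity : 0 ≤ τ / 2)
  have h4 := mul_le_mul_of_nonneg_left (mul_le_mul_of_nonneg_left h2 hp) (by positivity : 0 ≤ τ / 2)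
  have e : τ / 2 * ((1 - t / (100 * χ)) ^ N
      * (2 / τ * (51 * initialError μ χ H xs x0 y0 z0 m0)))
      = 51 * (1 - t / (100 * χ)) ^ N * initialError μ χ H xs x0 y0 z0 m0 := by field_simp
  rw [e] at h4
  have h5 : 0 ≤ τ / 2 * ((1 - t / (100 * χ)) ^ N * (c / (t / (100 * χ)))) := by positivity
  nlinarith

end Expectation

/-! ### Choice of constants -/

section Rates

/-- The power is at most exp(-ρN) ≤ (2 + s)⁻¹³. One factor pays for s, and the other twelve give
2⁻¹², with 51/4096 ≤ 1/42. -/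
theorem pow_mul_le_of_log_le {ρ s p : ℝ} (hρ1 : ρ ≤ 1) (hs : 0 ≤ s) {N : ℕ}
    (h : 13 * Real.log (2 + s) ≤ ρ * N) (hp : p = (1 - ρ) ^ N) : 51 * p * s ≤ 1 / 42 := by
  have h2 : 0 < 2 + s := by linarith
  have h1 : p ≤ Real.exp (-(13 * Real.log (2 + s))) := by
    calc p = (1 - ρ) ^ N := hp
      _ ≤ Real.exp (-ρ) ^ N := by
          have := Real.add_one_le_exp (-ρ)
          exact pow_le_pow_left₀ (by linarith) (by linarith) N
      _ = Real.exp (-(ρ * N)) := by rw [← Real.exp_nat_mul]; congr 1; ring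
      _ ≤ _ := Real.exp_le_exp.2 (by linarith)
  have h3 : Real.exp (-(13 * Real.log (2 + s))) = ((2 + s) ^ 13)⁻¹ := by
    rw [Real.exp_neg, show (13 : ℝ) * Real.log (2 + s) = ((13 : ℕ) : ℝ) * Real.log (2 + s) by norm_num,
      Real.exp_nat_mul, Real.exp_log h2]
  rw [h3] at h1
  have h4 : (2 : ℝ) ^ 12 ≤ (2 + s) ^ 12 := pow_le_pow_left₀ (by norm_num) (by linarith) 12
  have h5 : p * (2 + s) ^ 13 ≤ 1 := by
    have := mul_le_mul_of_nonneg_right h1 (by positivity : 0 ≤ (2 + s) ^ 13)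
    rwa [inv_mul_cancel₀ (by positivity)] at this
  have hp0 : 0 ≤ p := hp ▸ pow_nonneg (by linarith) N
  have h6 : p * s * 2 ^ 12 ≤ p * (2 + s) ^ 13 := by
    rw [pow_succ (2 + s) 12, mul_comm ((2 + s) ^ 12), ← mul_assoc]
    gcongr
    linarith
  norm_num at h6
  linarith

/-- The contribution of the noise to the final error, for `D = q ^ 4`, `ε = e ^ 2`, `μ = w ^ 2`. -/
theorem noise_le {q e w M χ K t τ N B Δ G : ℝ} (hq : 1 ≤ q) (he : 0 < e) (hw : 0 < w) (hM : 0 < M)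
    (hχ : 1 ≤ χ) (hB : 1 ≤ B) (hK : 0 < K) (hτ : 0 < τ) (ht : t = χ / (168000 * K))
    (hτt : τ ≤ 3 / 2 * t) (h1 : q * M * χ / (e * w) ≤ K)
    (h2 : χ ^ 2 * (q ^ 4) ^ 2 * M ^ 2 * G ^ 2 / ((e ^ 2) ^ 3 * B * w ^ 2) ≤ K) (h3 : χ / 2 ≤ K)
    (hN : 109200000 * K ≤ N) (hΔ : Δ ^ 2 ≤ e ^ 5 * w / (q ^ 7 * M * N)) :
    τ / 2 * ((5 * (t ^ 2 / w ^ 2) / τ * (2 * (q ^ 4 / (e ^ 2 / (2 * M))) ^ 2 * (G ^ 2 + Δ ^ 2) / B)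
      + 12 / w ^ 2 * (q ^ 2 * Δ / (e ^ 2 / (2 * M))) ^ 2) / (t / (100 * χ))) ≤ e ^ 2 / 28 := by
  have hχ0 : 0 < χ := by linarith
  have hq0 : 0 < q := by linarith
  have hB0 : 0 < B := by linarith
  have ht0 : 0 < t := by rw [ht]; positivity
  have hN0 : 0 < N := by linarith
  have hKt : t * K / χ = 1 / 168000 := by rw [ht]; field_simp
  have e1 : τ / 2 * ((5 * (t ^ 2 / w ^ 2) / τ
      * (2 * (q ^ 4 / (e ^ 2 / (2 * M))) ^ 2 * (G ^ 2 + Δ ^ 2) / B)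
      + 12 / w ^ 2 * (q ^ 2 * Δ / (e ^ 2 / (2 * M))) ^ 2) / (t / (100 * χ)))
      = 2000 * e ^ 2 * (t / χ) * (χ ^ 2 * (q ^ 4) ^ 2 * M ^ 2 * G ^ 2 / ((e ^ 2) ^ 3 * B * w ^ 2))
        + 2000 * χ * t * q ^ 8 * M ^ 2 / (w ^ 2 * e ^ 4 * B) * Δ ^ 2
        + 2400 * (τ / t) * (χ * q ^ 4 * M ^ 2 / (w ^ 2 * e ^ 4)) * Δ ^ 2 := by
    field_simp
    ring
  -- The constant in t is 168000 = 2000 · 84, so the part of the variance coming from G is at most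
  -- ε/84. The two parts coming from Δ are at most ε/168 each.
  have b1 : 2000 * e ^ 2 * (t / χ)
      * (χ ^ 2 * (q ^ 4) ^ 2 * M ^ 2 * G ^ 2 / ((e ^ 2) ^ 3 * B * w ^ 2)) ≤ e ^ 2 / 84 := by
    calc _ ≤ 2000 * e ^ 2 * (t / χ) * K := by gcongr
      _ = 2000 * e ^ 2 * (t * K / χ) := by ring
      _ = e ^ 2 / 84 := by rw [hKt]; ring
  have b2 : 2000 * χ * t * q ^ 8 * M ^ 2 / (w ^ 2 * e ^ 4 * B) * Δ ^ 2 ≤ e ^ 2 / 168 := by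
    calc _ ≤ 2000 * χ * t * q ^ 8 * M ^ 2 / (w ^ 2 * e ^ 4 * 1) * (e ^ 5 * w / (q ^ 7 * M * N)) := by
          gcongr
      _ = 2000 * e ^ 2 * t / N * (q * M * χ / (e * w)) := by field_simp
      _ ≤ 2000 * e ^ 2 * t / N * K := by gcongr
      _ = 2000 * e ^ 2 * (t * K / χ) * (χ / N) := by field_simp
      _ ≤ 2000 * e ^ 2 * (1 / 168000) * (1 / 2) := by
          have : χ / N ≤ 1 / 2 := by rw [div_le_iff₀ hN0]; linarith
          rw [hKt]
          gcongr
      _ = e ^ 2 / 168 := by ring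
  have b3 : 2400 * (τ / t) * (χ * q ^ 4 * M ^ 2 / (w ^ 2 * e ^ 4)) * Δ ^ 2 ≤ e ^ 2 / 168 := by
    have hτ' : τ / t ≤ 3 / 2 := by rwa [div_le_iff₀ ht0]
    calc _ ≤ 2400 * (3 / 2) * (χ * q ^ 4 * M ^ 2 / (w ^ 2 * e ^ 4))
          * (e ^ 5 * w / (q ^ 7 * M * N)) := by gcongr
      _ = 3600 * e ^ 2 * (1 / q ^ 4) / N * (q * M * χ / (e * w)) := by field_simp; norm_num
      _ ≤ 3600 * e ^ 2 * (1 / 1) / N * K := by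
          gcongr
          exact one_le_pow₀ hq
      _ = 3600 * e ^ 2 * (K / N) := by ring
      _ ≤ 3600 * e ^ 2 * (1 / 604800) := by
          have : K / N ≤ 1 / 604800 := by rw [div_le_iff₀ hN0]; linarith
          gcongr
      _ = e ^ 2 / 168 := by ring
  have b0 : 0 < e ^ 2 := by positivity
  rw [e1]
  linarith

/-- The first term of K equals χ√(L_γ/(2μ)), so L = μ/τ², which is proportional to μK²/χ², dominates
4L_γ. -/
theorem smoothness_le {q e w M χ K t τ : ℝ} (hq : 0 < q) (he : 0 < e) (hw : 0 < w) (hM : 0 < M)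
    (hχ : 0 < χ) (hK : 0 < K) (ht : t = χ / (168000 * K)) (hτt : τ ^ 2 = 2 * t ^ 2)
    (h : q * M * χ / (e * w) ≤ K) : 4 * (q ^ 2 * M / (e ^ 2 / (2 * M))) ≤ w ^ 2 / τ ^ 2 := by
  have h1 : q * M / e ≤ K * w / χ := by
    rw [div_le_div_iff₀ he hχ]
    rw [div_le_iff₀ (by positivity)] at h
    linarith
  have h2 := pow_le_pow_left₀ (by positivity) h1 2
  have e1 : 4 * (q ^ 2 * M / (e ^ 2 / (2 * M))) = 8 * (q * M / e) ^ 2 := by field_simp; norm_num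
  have e2 : w ^ 2 / τ ^ 2 = 168000 ^ 2 / 2 * (K * w / χ) ^ 2 := by rw [hτt, ht]; field_simp
  have h3 : 0 ≤ (K * w / χ) ^ 2 := sq_nonneg _
  rw [e1, e2]
  linarith

end Rates

/-! ### From the potential to the two accuracy statements -/

section Accuracy

variable {n d : ℕ}

/-- Serves integrability: the error for F may be negative, and a lower bound by a constant is needed
beside the upper bound. Strong convexity of H at xγ absorbs the part of -(μ/4)‖u - xs‖² that depends
on u. -/
theorem IsRegularOn.le_original {μ ℓ ε : ℝ} {F H : Stack n d → ℝ} {S : Set (Stack n d)}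
    (hreg : IsRegularOn H S μ ℓ) (hμ : 0 < μ) (hFH : ∀ x, F x ≤ H x)
    (hHF : ∀ x ∈ S, H x ≤ F x + ε / 2) {xs xγ : Stack n d}
    (hort : inner ℝ (gradient H xγ) (xs - xγ) = 0) (x : Stack n d) {u : Stack n d} (hu : u ∈ S) :
    -(ε / 2 + bregman H xs xγ + μ / 2 * ‖xs - xγ‖ ^ 2)
      ≤ μ / 2 * ‖x - xs‖ ^ 2 + (F u - F xs - inner ℝ (gradient H xγ) (u - xs))
        - μ / 4 * ‖u - xs‖ ^ 2 := by
  have h1 := hreg.strong u xγ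
  have h2 := hHF u hu
  have h3 := hFH xs
  have h4 : 0 ≤ μ / 2 * ‖x - xs‖ ^ 2 := by positivity
  have h5 := mul_le_mul_of_nonneg_left (norm_sub_sq_le_two_mul (u - xγ) (xs - xγ))
    (by positivity : 0 ≤ μ / 4)
  rw [sub_sub_sub_cancel_right] at h5
  have e0 : inner ℝ (gradient H xγ) (u - xs) = inner ℝ (gradient H xγ) (u - xγ) := by
    rw [show u - xs = (u - xγ) - (xs - xγ) by abel, inner_sub_right, hort, sub_zero]
  unfold bregman
  rw [e0, hort]
  linarith

variable {Ω : Type*} [MeasurableSpace Ω] {P : Measure Ω} [IsProbabilityMeasure P]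
  {T : Ω → Iterates n d} {S : Set (Stack n d)} {N : ℕ}

/-- Accuracy for the smoothed and for the original problem, given a bound on the potential. -/
theorem accuracy_of_potential_le {μ χ t τ ℓ ε : ℝ} {F H : Stack n d → ℝ}
    (hreg : IsRegularOn H S μ ℓ) (hμ : 0 < μ) (hχ : 1 ≤ χ) (ht : 0 < t) (hτ : 0 < τ) (hε : 0 < ε)
    (hFm : Measurable F) (hHm : Measurable H) (hFH : ∀ x, F x ≤ H x)
    (hHF : ∀ x ∈ S, H x ≤ F x + ε / 2) {xs xγ : Stack n d} (hxs : xs ∈ S)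
    (hort : inner ℝ (gradient H xγ) (xs - xγ) = 0) (hT : MeasurableIterates T N)
    (hE : MeasurableSet {ω | StaysIn S N (T ω)})
    (hV : IntegrableOn (fun ω => potential μ χ t τ H xγ (T ω) N) {ω | StaysIn S N (T ω)} P)
    (hle : τ / 2 * ∫ ω in {ω | StaysIn S N (T ω)}, potential μ χ t τ H xγ (T ω) N ∂P ≤ ε / 14) :
    (IntegrableOn (fun ω => μ / 2 * ‖(T ω).x N - xγ‖ ^ 2 + bregman H ((T ω).xf N) xγ
          - μ / 4 * ‖(T ω).xf N - xγ‖ ^ 2) {ω | StaysIn S N (T ω)} P ∧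
      ∫ ω in {ω | StaysIn S N (T ω)}, (μ / 2 * ‖(T ω).x N - xγ‖ ^ 2
          + bregman H ((T ω).xf N) xγ - μ / 4 * ‖(T ω).xf N - xγ‖ ^ 2) ∂P ≤ ε / 2) ∧
    (IntegrableOn (fun ω => μ / 2 * ‖(T ω).x N - xs‖ ^ 2
          + (F ((T ω).xf N) - F xs - inner ℝ (gradient H xγ) ((T ω).xf N - xs))
          - μ / 4 * ‖(T ω).xf N - xs‖ ^ 2) {ω | StaysIn S N (T ω)} P ∧
      ∫ ω in {ω | StaysIn S N (T ω)}, (μ / 2 * ‖(T ω).x N - xs‖ ^ 2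
          + (F ((T ω).xf N) - F xs - inner ℝ (gradient H xγ) ((T ω).xf N - xs))
          - μ / 4 * ‖(T ω).xf N - xs‖ ^ 2) ∂P ≤ ε) := by
  have hx := hT.x
  have hxf := hT.xf
  have hFx : Measurable fun ω => F ((T ω).xf N) := hFm.comp hxf
  have hHx : Measurable fun ω => H ((T ω).xf N) := hHm.comp hxf
  set E := {ω | StaysIn S N (T ω)} with hEd
  have hW : ∀ ω, μ / 2 * ‖(T ω).x N - xγ‖ ^ 2 + bregman H ((T ω).xf N) xγ
          - μ / 4 * ‖(T ω).xf N - xγ‖ ^ 2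
      = μ / 2 * ‖(T ω).x N - xγ‖ ^ 2 + reducedBregman μ H xγ ((T ω).xf N) := fun ω => by
    rw [reducedBregman, add_sub_assoc]
  simp only [hW]
  set U : Ω → ℝ := fun ω => μ / 2 * ‖(T ω).x N - xγ‖ ^ 2 + reducedBregman μ H xγ ((T ω).xf N)
    with hU
  have hUm : Measurable U := by
    have hi : Measurable fun ω => (inner ℝ (gradient H xγ) ((T ω).xf N - xγ) : ℝ) :=
      measurable_const.inner (hxf.sub_const xγ)
    simp only [hU, reducedBregman, bregman]
    fun_prop
  have hU0 : ∀ ω, 0 ≤ U ω := fun ω => by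
    have h1 : 0 ≤ μ / 4 * ‖(T ω).xf N - xγ‖ ^ 2 := by positivity
    have h2 := hreg.reducedBregman_ge xγ ((T ω).xf N)
    have h3 : 0 ≤ μ / 2 * ‖(T ω).x N - xγ‖ ^ 2 := by positivity
    simp only [hU]
    linarith
  have hUV : ∀ ω, U ω ≤ τ / 2 * potential μ χ t τ H xγ (T ω) N := fun ω =>
    le_mul_potential hμ hχ ht hτ xγ (T ω) N
  have hUi : IntegrableOn U E P := by
    refine Integrable.mono' (hV.const_mul (τ / 2)) hUm.aestronglyMeasurable
      (Filter.Eventually.of_forall fun ω => ?_)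
    rw [Real.norm_eq_abs, abs_of_nonneg (hU0 ω)]
    exact hUV ω
  have hUle : ∫ ω in E, U ω ∂P ≤ ε / 14 := by
    refine le_trans ?_ hle
    rw [← integral_const_mul]
    exact integral_mono hUi (hV.const_mul _) hUV
  refine ⟨⟨hUi, by linarith⟩, ?_⟩
  set R : Ω → ℝ := fun ω => μ / 2 * ‖(T ω).x N - xs‖ ^ 2
    + (F ((T ω).xf N) - F xs - inner ℝ (gradient H xγ) ((T ω).xf N - xs))
    - μ / 4 * ‖(T ω).xf N - xs‖ ^ 2 with hR
  have hRm : Measurable R := by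
    have hi : Measurable fun ω => (inner ℝ (gradient H xγ) ((T ω).xf N - xs) : ℝ) :=
      measurable_const.inner (hxf.sub_const xs)
    simp only [hR]
    fun_prop
  have hRU : ∀ ω, R ω ≤ 7 * U ω + ε / 2 := fun ω =>
    hreg.original_le hμ hFH hHF hxs hort ((T ω).x N) ((T ω).xf N)
  set c := ε / 2 + bregman H xs xγ + μ / 2 * ‖xs - xγ‖ ^ 2 with hc
  have hc0 : ε / 2 ≤ c := by
    have h1 := hreg.strong xs xγ
    have h2 : 0 ≤ μ / 2 * ‖xs - xγ‖ ^ 2 := by positivity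
    simp only [hc, bregman]
    linarith
  have hUi7 : IntegrableOn (fun ω => 7 * U ω + ε / 2) E P :=
    (hUi.const_mul 7).add (integrable_const _)
  have hRi : IntegrableOn R E P := by
    refine Integrable.mono' ((hUi.const_mul 7).add (integrable_const c)) hRm.aestronglyMeasurable ?_
    refine (ae_restrict_iff' hE).2 (Filter.Eventually.of_forall fun ω hω => ?_)
    have h1 : -c ≤ R ω := hreg.le_original hμ hFH hHF hort ((T ω).x N) (hω.2 N le_rfl)
    have h2 := hRU ω
    have h3 := hU0 ω
    simp only [Pi.add_apply, Real.norm_eq_abs]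
    exact abs_le.2 ⟨by linarith, by linarith⟩
  refine ⟨hRi, ?_⟩
  have hPE : P.real E ≤ 1 := measureReal_le_one
  calc _ ≤ ∫ ω in E, (7 * U ω + ε / 2) ∂P := integral_mono hRi hUi7 hRU
    _ = 7 * ∫ ω in E, U ω ∂P + P.real E * (ε / 2) := by
        rw [integral_add (hUi.const_mul 7) (integrable_const _), integral_const_mul]
        simp
    _ ≤ 7 * (ε / 14) + 1 * (ε / 2) := by gcongr
    _ = ε := by ring

end Accuracy

set_option maxHeartbeats 1000000 in
theorem mainTheorem6 :
    ∃ C c : ℝ, 0 < C ∧ 0 < c ∧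
    ∀ (n d B N : ℕ) (μ M G χ ε γ : ℝ), 1 ≤ n → 1 ≤ d → 1 ≤ B → 0 < μ → 0 < M → 0 ≤ G → 1 ≤ χ →
      0 < ε → γ = ε / (2 * M) →
    ∃ L β : ℝ, √((n * d : ℕ) : ℝ) * M / γ ≤ L ∧ 0 < β ∧ β ≤ 1 / (2 * L) ∧
    ∀ {Ω Ξ : Type*} [MeasurableSpace Ω] [MeasurableSpace Ξ]
      (P : Measure Ω) [IsProbabilityMeasure P] (𝒟 : Measure Ξ) [IsProbabilityMeasure 𝒟]
      -- the network
      (𝒢 : ℕ → SimpleGraph (Fin n)) (W : ℕ → Matrix (Fin n) (Fin n) ℝ) (_ : IsGossip 𝒢 W χ)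
      -- the objective
      (f : Fin n → EuclideanSpace ℝ (Fin d) → Ξ → ℝ)
      (_ : ∀ i, Measurable (fun p : EuclideanSpace ℝ (Fin d) × Ξ => f i p.1 p.2))
      (_ : ∀ i x, Integrable (f i x) 𝒟)
      (_ : ∀ i, StrongConvexOn Set.univ μ (fun x => ∫ ξ, f i x ξ ∂𝒟))
      -- the domain on which the assumptions on `F(x, ξ)` hold
      (S : Set (Stack n d)) (_ : Convex ℝ S) (_ : MeasurableSet S)
      (_ : LipschitzInMean 𝒟 f (neigh S γ) M)
      (_ : SecondMomentBound 𝒟 f (neigh S γ) G)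
      -- the adversarial noise
      (δ : Stack n d → Ξ → ℝ) (_ : Measurable (fun p : Stack n d × Ξ => δ p.1 p.2))
      (Δ : ℝ) (_ : ∀ x ξ, |δ x ξ| ≤ Δ)
      -- the solutions of the original problem and of the smoothed problem
      (xs xγ : Stack n d) (_ : xs ∈ S ∩ consensus n d) (_ : xγ ∈ S ∩ consensus n d)
      (_ : IsMinOn (meanF 𝒟 f) (consensus n d) xs)
      (_ : IsMinOn (smoothF γ (meanF 𝒟 f)) (consensus n d) xγ)
      -- the random samples, `B` in each iteration
      (ξ : ℕ → Fin B → Ω → Ξ) (e : ℕ → Fin B → Ω → Stack n d)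
      (_ : ∀ k j, Measurable (ξ k j)) (_ : ∀ k j, Measurable (e k j))
      (_ : ∀ k j, P.map (fun ω => (ξ k j ω, e k j ω)) = 𝒟.prod (uniformSphere n d))
      (_ : iIndepFun (fun (s : ℕ × Fin B) (ω : Ω) => (ξ s.1 s.2 ω, e s.1 s.2 ω)) P)
      -- the run of the algorithm
      (x0 y0 z0 m0 : Stack n d) (_ : z0 ∈ consensusPerp n d) (T : Ω → Iterates n d)
      (_ : ∀ ω, IsSADOM (sadomParams μ χ L β) W
        (fun k x => opfBatch γ f δ x (fun j => ξ k j ω) (fun j => e k j ω))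
        x0 y0 z0 m0 (T ω))
      -- the number of iterations
      (_ : C * Real.log (2 + initialError μ χ (smoothF γ (meanF 𝒟 f)) xγ x0 y0 z0 m0 / ε)
          * max (((n * d : ℕ) : ℝ) ^ (1 / 4 : ℝ) * M * χ / √(ε * μ))
              (χ ^ 2 * ((n * d : ℕ) : ℝ) ^ 2 * M ^ 2 * G ^ 2 / (ε ^ 3 * B * μ))
          ≤ N)
      -- the tolerated noise level
      (_ : Δ ^ 2 ≤ c * min
          (ε ^ (5 / 2 : ℝ) * μ ^ (1 / 2 : ℝ) / (((n * d : ℕ) : ℝ) ^ (7 / 4 : ℝ) * M * N))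
          (B * μ * N * ε ^ 3 / (χ ^ 2 * M ^ 2 * ((n * d : ℕ) : ℝ) ^ 2))),
      -- accuracy for the smoothed problem
      (IntegrableOn (fun ω => μ / 2 * ‖(T ω).x N - xγ‖ ^ 2
            + bregman (smoothF γ (meanF 𝒟 f)) ((T ω).xf N) xγ
            - μ / 4 * ‖(T ω).xf N - xγ‖ ^ 2) {ω | StaysIn S N (T ω)} P ∧
        ∫ ω in {ω | StaysIn S N (T ω)}, (μ / 2 * ‖(T ω).x N - xγ‖ ^ 2
            + bregman (smoothF γ (meanF 𝒟 f)) ((T ω).xf N) xγ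
            - μ / 4 * ‖(T ω).xf N - xγ‖ ^ 2) ∂P ≤ ε / 2) ∧
      -- accuracy for the original problem
      (IntegrableOn (fun ω => μ / 2 * ‖(T ω).x N - xs‖ ^ 2
            + (meanF 𝒟 f ((T ω).xf N) - meanF 𝒟 f xs
              - inner ℝ (gradient (smoothF γ (meanF 𝒟 f)) xγ) ((T ω).xf N - xs))
            - μ / 4 * ‖(T ω).xf N - xs‖ ^ 2) {ω | StaysIn S N (T ω)} P ∧
        ∫ ω in {ω | StaysIn S N (T ω)}, (μ / 2 * ‖(T ω).x N - xs‖ ^ 2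
            + (meanF 𝒟 f ((T ω).xf N) - meanF 𝒟 f xs
              - inner ℝ (gradient (smoothF γ (meanF 𝒟 f)) xγ) ((T ω).xf N - xs))
            - μ / 4 * ‖(T ω).xf N - xs‖ ^ 2) ∂P ≤ ε) := by
  -- The contraction rate will be 1/(16800000 K), and 218400000 = 13 · 16800000 provides the
  -- thirteen powers of 2 + C₀/ε.
  refine ⟨218400000, 1, by norm_num, one_pos, ?_⟩
  intro n d B N μ M G χ ε γ hn hd hB hμ hM hG0 hχ hε hγ
  have hχ0 : 0 < χ := by linarith
  have hγ0 : 0 < γ := by rw [hγ]; positivity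
  have hD1 : (1 : ℝ) ≤ ((n * d : ℕ) : ℝ) := by
    have : 1 ≤ n * d := Nat.mul_pos hn hd
    exact_mod_cast this
  have hB1 : (1 : ℝ) ≤ (B : ℝ) := by exact_mod_cast hB
  set D : ℝ := ((n * d : ℕ) : ℝ) with hD
  have hD0 : 0 < D := by linarith
  set K := max (D ^ (1 / 4 : ℝ) * M * χ / √(ε * μ))
    (χ ^ 2 * D ^ 2 * M ^ 2 * G ^ 2 / (ε ^ 3 * B * μ)) with hK
  have hK0 : 0 < K := lt_max_of_lt_left (by positivity)
  -- Working with D = q⁴, ε = e², μ = w² turns all fractional powers in the rates into integer ones.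
  obtain ⟨q, hq⟩ : ∃ q, q = D ^ (1 / 4 : ℝ) := ⟨_, rfl⟩
  obtain ⟨e, he⟩ : ∃ e, e = √ε := ⟨_, rfl⟩
  obtain ⟨w, hw⟩ : ∃ w, w = √μ := ⟨_, rfl⟩
  have hq1 : 1 ≤ q := hq ▸ Real.one_le_rpow hD1 (by norm_num)
  have hq0 : 0 < q := by linarith
  have he0 : 0 < e := he ▸ Real.sqrt_pos.2 hε
  have hw0 : 0 < w := hw ▸ Real.sqrt_pos.2 hμ
  have hq4 : q ^ 4 = D := by
    rw [hq, ← Real.rpow_natCast, ← Real.rpow_mul hD0.le]; norm_num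
  have hq2 : q ^ 2 = √D := by
    rw [← hq4, show q ^ 4 = (q ^ 2) ^ 2 by ring, Real.sqrt_sq (by positivity)]
  have hq7 : q ^ 7 = D ^ (7 / 4 : ℝ) := by
    rw [hq, ← Real.rpow_natCast, ← Real.rpow_mul hD0.le]; norm_num
  have he2 : e ^ 2 = ε := he ▸ Real.sq_sqrt hε.le
  have hw2 : w ^ 2 = μ := hw ▸ Real.sq_sqrt hμ.le
  have he5 : e ^ 5 = ε ^ (5 / 2 : ℝ) := by
    rw [he, Real.sqrt_eq_rpow, ← Real.rpow_natCast, ← Real.rpow_mul hε.le]; norm_num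
  have hw1 : w = μ ^ (1 / 2 : ℝ) := by rw [hw, Real.sqrt_eq_rpow]
  have hew : √(ε * μ) = e * w := by rw [Real.sqrt_mul hε.le, he, hw]
  have hK1 : q * M * χ / (e * w) ≤ K := by
    rw [hq, ← hew]; exact le_max_left _ _
  have hK2 : χ ^ 2 * (q ^ 4) ^ 2 * M ^ 2 * G ^ 2 / ((e ^ 2) ^ 3 * B * w ^ 2) ≤ K := by
    rw [hq4, he2, hw2]; exact le_max_right _ _
  obtain ⟨t, ht⟩ : ∃ t, t = χ / (168000 * K) := ⟨_, rfl⟩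
  have ht0 : 0 < t := by rw [ht]; positivity
  obtain ⟨τ, hτ⟩ : ∃ τ, τ = √2 * t := ⟨_, rfl⟩
  have hτ0 : 0 < τ := by rw [hτ]; positivity
  have hτt : τ ^ 2 = 2 * t ^ 2 := by rw [hτ, mul_pow, Real.sq_sqrt zero_le_two]
  have hτ32 : τ ≤ 3 / 2 * t := by nlinarith
  have hL4 : 4 * (√D * M / γ) ≤ μ / τ ^ 2 := by
    have h1 := smoothness_le hq0 he0 hw0 hM hχ0 hK0 ht hτt hK1
    rwa [hq2, he2, hw2, ← hγ] at h1
  have hLγ0 : 0 ≤ √D * M / γ := by positivity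
  -- Since τ² = 2t², β attains its upper limit 1/(2L). Both numbers are functions of K and the
  -- problem constants, fixed before the setting is introduced.
  refine ⟨μ / τ ^ 2, t ^ 2 / μ, by linarith, by positivity, le_of_eq ?_, ?_⟩
  · rw [hτt]; field_simp
  intro Ω Ξ _ _ P _ 𝒟 _ 𝒢 W hW f hf hfi hfc S hSc hS hLip hSM δ hδ Δ hΔ xs xγ hxs hxγ hmin hminγ
    ξ e' hξ he' hlaw hind x0 y0 z0 m0 hz0 T hT hN hΔ2
  have hstrong : StrongConvexOn Set.univ μ (meanF 𝒟 f) := strongConvexOn_meanF hfi hfc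
  have hconv : ConvexOn ℝ Set.univ (meanF 𝒟 f) := strongConvexOn_zero.1 (hstrong.mono hμ.le)
  have hcont : Continuous (meanF 𝒟 f) := continuous_of_convexOn hconv
  have hlip : ∀ x ∈ neigh S γ, ∀ y ∈ neigh S γ,
      |meanF 𝒟 f y - meanF 𝒟 f x| ≤ M * ‖y - x‖ := fun x hx y hy =>
    abs_meanF_sub_le hM.le hfi hLip hx hy
  have hreg := isRegularOn_smoothF hn hd hγ0 hM hμ.le hstrong hSc hlip
  have hgrad := fun x => hasGradientAt_smoothF hn hd hγ0 hcont x
  have hHc : Continuous (smoothF γ (meanF 𝒟 f)) :=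
    continuous_iff_continuousAt.2 fun x => (hgrad x).continuousAt
  have hdiff : DifferentiableAt ℝ (smoothF γ (meanF 𝒟 f)) xγ := (hgrad xγ).differentiableAt
  have hgr := gradient_mem_perpSubmodule hdiff hxγ.2 hminγ
  have hort : inner ℝ (gradient (smoothF γ (meanF 𝒟 f)) xγ) (xs - xγ) = 0 :=
    inner_eq_zero_of_isMinOn hdiff hxγ.2 hminγ fun i j => by
      simp only [PiLp.sub_apply, hxs.2 i j, hxγ.2 i j]
  have hγM : γ * M = ε / 2 := by rw [hγ]; field_simp
  have hμγ := mul_le_of_strongConvexOn_of_lipschitz hn hd hγ0 hstrong hlip hxs.1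
  -- Together with D ≥ 1 this gives K ≥ χ/2, hence t ≤ 1/2.
  have hewM : e * w ≤ 2 * M := by
    refine abs_le_of_sq_le_sq' ?_ (by positivity) |>.2
    rw [mul_pow, he2, hw2]
    rw [hγ, mul_div_assoc', div_le_iff₀ (by positivity)] at hμγ
    linarith
  have hKχ : χ / 2 ≤ K := by
    refine le_trans ?_ hK1
    rw [div_le_div_iff₀ two_pos (by positivity)]
    have h1 := mul_le_mul_of_nonneg_left hewM hχ0.le
    have h2 := mul_le_mul_of_nonneg_right hq1 (by positivity : 0 ≤ M * χ)
    linarith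
  have ht1 : t ≤ 1 / 2 := by
    rw [ht, div_le_iff₀ (by positivity)]; linarith
  have hℓ : 8 * (t ^ 2 / μ) * (√D * M / γ) ≤ 1 := by
    have h1 := mul_le_mul_of_nonneg_left hL4 (by positivity : 0 ≤ 2 * (t ^ 2 / μ))
    have e1 : 2 * (t ^ 2 / μ) * (μ / τ ^ 2) = 1 := by rw [hτt]; field_simp
    linarith
  obtain ⟨ω0⟩ : Nonempty Ω := P.nonempty_of_neZero
  have hΔ0 : 0 ≤ Δ := (abs_nonneg _).trans (hΔ x0 (ξ 0 ⟨0, hB⟩ ω0))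
  obtain ⟨C0, hC0⟩ : ∃ C0, C0 = initialError μ χ (smoothF γ (meanF 𝒟 f)) xγ x0 y0 z0 m0 :=
    ⟨_, rfl⟩
  have hC0n : 0 ≤ C0 := by
    have h1 := hreg.strong x0 xγ
    have h2 : 0 ≤ μ / 2 * ‖x0 - xγ‖ ^ 2 := by positivity
    have h3 : 0 ≤ bregman (smoothF γ (meanF 𝒟 f)) x0 xγ := by unfold bregman; linarith
    rw [hC0]
    unfold initialError
    positivity
  rw [← hC0] at hN
  have hs0 : 0 ≤ C0 / ε := by positivity
  have hlog : 1 / 2 ≤ Real.log (2 + C0 / ε) := by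
    have h1 := Real.log_two_gt_d9
    have h2 := Real.log_le_log two_pos (by linarith : 2 ≤ 2 + C0 / ε)
    linarith
  have hNK : 109200000 * K ≤ N := by
    have := mul_le_mul_of_nonneg_right hlog hK0.le
    linarith
  have hN0 : (0 : ℝ) < N := by linarith
  have hρN : 13 * Real.log (2 + C0 / ε) ≤ t / (100 * χ) * N := by
    have e1 : t / (100 * χ) = 1 / (16800000 * K) := by rw [ht]; field_simp; norm_num
    rw [e1, div_mul_eq_mul_div, le_div_iff₀ (by positivity)]
    linarith
  -- The first term of the minimum suffices: since N is at least a large multiple of K, it controls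
  -- the contribution of Δ both to the bias and to the variance.
  have hΔq : Δ ^ 2 ≤ e ^ 5 * w / (q ^ 7 * M * N) := by
    rw [he5, hw1, hq7]
    refine hΔ2.trans ?_
    rw [one_mul]
    exact min_le_left _ _
  have hnoise := noise_le (τ := τ) hq1 he0 hw0 hM hχ hB1 hK0 hτ0 ht hτ32 hK1 hK2 hKχ hNK hΔq
  rw [hq4, hq2, he2, hw2, ← hγ] at hnoise
  have hdecay := pow_mul_le_of_log_le (ρ := t / (100 * χ)) (by
    rw [div_le_iff₀ (by positivity)]; linarith) hs0 hρN rfl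
  have hZ : ∀ s : ℕ × Fin B, Measurable fun ω => (ξ s.1 s.2 ω, e' s.1 s.2 ω) := fun s =>
    (hξ s.1 s.2).prodMk (he' s.1 s.2)
  have hTm : ∀ k, @MeasurableIterates n d Ω
      (history (fun (s : ℕ × Fin B) ω => (ξ s.1 s.2 ω, e' s.1 s.2 ω)) k) T k := by
    have hp := sadomParams_fields hμ hχ ht0 hτ0 hτt rfl
    refine measurableIterates_history (Z := fun (s : ℕ × Fin B) ω => (ξ s.1 s.2 ω, e' s.1 s.2 ω))
      hf hδ hT ?_ ?_ ?_ ?_ <;> rw [hp] <;> positivity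
  have hbound := setIntegral_potential_le
    (Z := fun (s : ℕ × Fin B) ω => (ξ s.1 s.2 ω, e' s.1 s.2 ω))
    hn hd hB hγ0 hf hδ hΔ hΔ0 hSM hS hZ (fun s => hlaw s.1 s.2) hind hT hTm hW hz0 hμ hχ ht0 ht1 hτ0
    hτt hLγ0 hℓ hreg hHc.measurable (fun x => (hgrad x).gradient) hxγ.1 hxγ.2 hgr N
  refine accuracy_of_potential_le hreg hμ hχ ht0 hτ0 hε hcont.measurable hHc.measurable
    (le_smoothF hcont hconv) (fun x hx => ?_) hxs.1 hort ((hTm N).mono (history_le hZ N))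
    (history_le hZ N _ (measurableSet_staysIn hT hS hTm N)) hbound.1 (hbound.2.trans ?_)
  · rw [← hγM]
    exact smoothF_le hγ0.le hM.le hcont hlip hx
  -- The initial error contributes at most ε/42 and the noise at most ε/28, in total 5ε/84 ≤ ε/14.
  · rw [← hC0]
    unfold batchVariance
    have h1 := mul_le_mul_of_nonneg_right hdecay hε.le
    have e1 : 51 * (1 - t / (100 * χ)) ^ N * (C0 / ε) * ε = 51 * (1 - t / (100 * χ)) ^ N * C0 := by
      field_simp
    rw [e1] at h1
    linarith
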